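/- A knot is an oriented smoothly embedded circle in the oriented sphere $S^3$, and $-K$ denotes $K$ with the reversed orientation. A diagram of a link is a planar projection of it (stereographic projection from a point off the link, followed by an orthogonal projection to a plane) which is an immersion with finitely many crossings, all of them transversal double points, together with the over/under information at the crossings. For disjoint knots $J,K$, the linking number $lk(J,K)$ is one half of the sum of the signs of the crossings between $J$ and $K$ (self-crossings are not counted) in a diagram of the link $J\cup K$. A connected sum $K_1\# K_2$ of disjoint knots is a knot obtained by removing an arc from each of $K_1$, $K_2$ and joining the two remaining arcs, consistently with their orientations, by two new arcs, such that the union of the new arcs and the removed arcs is the boundary of a topologically embedded closed disc $D\subset S^3$ which meets $K_1\cup K_2$ only along the removed arcs. For knots $K_1,K_2$ disjoint from $K_3$, we say that $K_2$ is obtained from $K_1$ by a single crossing change (in the presence of $K_3$) if, up to ambient isotopy of oriented two-component links, the links $K_1\cup K_3$ and $K_2\cup K_3$ have diagrams that differ only in that over and under are interchanged at one crossing of the first component with itself. **Theorem.** Any two disjoint knots $J,K$ in $S^3$ have a diagram, and $lk(J,K)$ is a well-defined integer: in every diagram of $J\cup K$ the sum of the signs of the crossings between $J$ and $K$ equals $2\,lk(J,K)$.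 Moreover: 1. If $K_1,K_2,K_3$ are pairwise disjoint and $K_1\# K_2$ is formed along a disc $D$ that is disjoint from $K_3$, then $lk(K_1\# K_2,K_3)=lk(K_1,K_3)+lk(K_2,K_3)$. 2. If $K_1,K_2$ are disjoint, then $lk(K_1,-K_2)=lk(-K_1,K_2)=-lk(K_1,K_2)$. 3. If $K_1$ and $K_2$ are disjoint from $K_3$ and $K_2$ is obtained from $K_1$ by a single crossing change in the presence of $K_3$, then $lk(K_1,K_3)=lk(K_2,K_3)$. -/

import Mathlib

open scoped Manifold ContDiff

noncomputable section

namespace KnotTheory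

/-- The 3-sphere, as the unit sphere of Euclidean 4-space. -/
abbrev S3 : Type := Metric.sphere (0 : EuclideanSpace ℝ (Fin 4)) 1

instance factFinrankFour : Fact (Module.finrank ℝ (EuclideanSpace ℝ (Fin 4)) = 3 + 1) :=
  ⟨by simp⟩

/-- An oriented smooth knot in `S3`: a smooth embedding (injective immersion) of the circle
`ℝ / ℤ`, written as a 1-periodic map on `ℝ`.  The orientation is the direction of increasing
parameter. -/
structure Knot where
  toFun : ℝ → S3
  periodic : Function.Periodic toFun 1
  smooth : ContDiff ℝ ∞ (fun t => (toFun t : EuclideanSpace ℝ (Fin 4)))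
  immersive : ∀ t, deriv (fun t => (toFun t : EuclideanSpace ℝ (Fin 4))) t ≠ 0
  injective : ∀ s t, toFun s = toFun t → ∃ n : ℤ, s - t = n

instance : CoeFun Knot (fun _ => ℝ → S3) := ⟨Knot.toFun⟩

/-- The two knots have no common point. -/
def Knot.Disjoint (J K : Knot) : Prop := ∀ s t, J s ≠ K t

/-- The knot `-K`: the same curve with the reversed orientation. -/
def Knot.reverse (K : Knot) : Knot where
  toFun t := K (-t)
  periodic t := by
    have h := K.periodic (-(t + 1))
    have e : -(t + 1) + 1 = -t := by ring
    rw [e] at h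
    exact h.symm
  smooth := K.smooth.comp contDiff_neg
  immersive t := by
    have h := deriv_comp_neg (fun t => (K t : EuclideanSpace ℝ (Fin 4))) t
    rw [h]
    exact neg_ne_zero.mpr (K.immersive (-t))
  injective s t h := by
    obtain ⟨n, hn⟩ := K.injective _ _ h
    exact ⟨-n, by push_cast; linarith⟩

/-! ### Diagrams -/

/-- The rotations of 4-space. -/
abbrev Rotation : Type := Matrix.specialOrthogonalGroup (Fin 4) ℝ

/-- The four coordinates of the rotated point `A x`. -/
def rotate (A : Rotation) (x : S3) : Fin 4 → ℝ :=
  A.1.mulVec (x : EuclideanSpace ℝ (Fin 4)).ofLp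

/-- Coordinates `0, 1, 2` in 3-space of the image of `x` under the rotation `A` followed by the
stereographic projection from the pole `(0, 0, 0, 1)`; meaningful if `A x` is not the pole. As `A`
varies, one gets the stereographic projections of the oriented 3-sphere from all points, composed
with all rotations of 3-space. -/
def stereo (A : Rotation) (x : S3) (i : Fin 3) : ℝ :=
  rotate A x i.castSucc / (1 - rotate A x 3)

/-- The projection of the knot to the plane of the first two coordinates. -/
def shadow (A : Rotation) (K : Knot) (t : ℝ) : ℝ × ℝ :=
  (stereo A (K t) 0, stereo A (K t) 1)

/-- The height of a point of the knot above the plane of projection. -/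
def height (A : Rotation) (K : Knot) (t : ℝ) : ℝ := stereo A (K t) 2

/-- The determinant of two plane vectors. -/
def planeDet (v w : ℝ × ℝ) : ℝ := v.1 * w.2 - v.2 * w.1

/-- The pairs of distinct points `(i, s)`, `(j, t)` of the link with components `L i` which have the
same projection. The parameter of a point of the link is taken in `[0, 1)`. -/
def doublePoints {ι : Type} (A : Rotation) (L : ι → Knot) : Set ((ι × ℝ) × (ι × ℝ)) :=
  {q | q.1.2 ∈ Set.Ico (0 : ℝ) 1 ∧ q.2.2 ∈ Set.Ico (0 : ℝ) 1 ∧ q.1 ≠ q.2 ∧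
    shadow A (L q.1.1) q.1.2 = shadow A (L q.2.1) q.2.2}

/-- The projection belonging to `A` yields a diagram of the link with components `L i`: the link
misses the centre of the stereographic projection, its planar projection is an immersion with
finitely many crossings, at each crossing exactly two points of the link meet, and they cross
transversally. -/
structure IsDiagram {ι : Type} (A : Rotation) (L : ι → Knot) : Prop where
  misses_pole : ∀ i t, rotate A (L i t) 3 ≠ 1
  immersion : ∀ i t, deriv (shadow A (L i)) t ≠ 0
  finite : (doublePoints A L).Finite
  transversal : ∀ q ∈ doublePoints A L,
    planeDet (deriv (shadow A (L q.1.1)) q.1.2) (deriv (shadow A (L q.2.1)) q.2.2) ≠ 0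
  no_triple : ∀ x y z, (x, y) ∈ doublePoints A L → (x, z) ∈ doublePoints A L → y = z

/-- The crossings between `J` and `K`: a crossing is given by the parameters in `[0, 1)` of its
point on `J` and of its point on `K`. -/
def crossings (A : Rotation) (J K : Knot) : Set (ℝ × ℝ) :=
  {p | p.1 ∈ Set.Ico (0 : ℝ) 1 ∧ p.2 ∈ Set.Ico (0 : ℝ) 1 ∧ shadow A J p.1 = shadow A K p.2}

/-- The sign of a crossing between `J` and `K`, by the right hand rule: it is `+1` if the direction
of the over-strand followed by that of the under-strand is a positively oriented basis of the plane,
and `-1` if it is a negatively oriented one. -/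
def crossingSign (A : Rotation) (J K : Knot) (p : ℝ × ℝ) : ℤ :=
  if height A K p.2 < height A J p.1 then
    (SignType.sign (planeDet (deriv (shadow A J) p.1) (deriv (shadow A K) p.2)) : ℤ)
  else
    (SignType.sign (planeDet (deriv (shadow A K) p.2) (deriv (shadow A J) p.1)) : ℤ)

/-- The sum of the signs of all crossings between `J` and `K`; self-crossings do not count. -/
def crossingSum (A : Rotation) (J K : Knot) : ℤ :=
  ∑ᶠ p ∈ crossings A J K, crossingSign A J K p

open Classical in
/-- The linking number: one half of the sum of the signs of the crossings between `J` and `K` in a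
diagram of the link with components `J`, `K`. -/
def lk (J K : Knot) : ℤ :=
  if h : ∃ A, IsDiagram A ![J, K] then crossingSum h.choose J K / 2 else 0

/-! ### Connected sums -/

/-- On `[s, t]`, the curve `f` runs through the part of the curve `g` between the parameters `u` and
`v`, in the same direction. -/
def Traces (f : ℝ → S3) (s t : ℝ) (g : ℝ → S3) (u v : ℝ) : Prop :=
  ∃ φ : ℝ → ℝ, ContinuousOn φ (Set.Icc s t) ∧ StrictMonoOn φ (Set.Icc s t) ∧
    φ s = u ∧ φ t = v ∧ ∀ x ∈ Set.Icc s t, f x = g (φ x)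

/-- The unit square, a model of the closed disc. -/
def unitSquare : Set (ℝ × ℝ) := Set.Icc (0 : ℝ) 1 ×ˢ Set.Icc (0 : ℝ) 1

/-- `K` is the oriented connected sum of the disjoint knots `K₁` and `K₂` formed along the
topological disc `D(unitSquare)`. The arcs `K₁ [a, b]` and `K₂ [c, d]`, which are the left side
(run through upwards) and the right side (run through downwards) of the disc, are removed, and the
remaining arcs are joined by the lower and the upper side; the disc meets `K₁` and `K₂` only
along the removed arcs. -/
def IsConnectedSumAlong (D : ℝ × ℝ → S3) (K₁ K₂ K : Knot) : Prop :=
  ContinuousOn D unitSquare ∧ Set.InjOn D unitSquare ∧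
  (∀ q ∈ unitSquare, D q ∈ Set.range K₁ → q.1 = 0) ∧
  (∀ q ∈ unitSquare, D q ∈ Set.range K₂ → q.1 = 1) ∧
  ∃ a b c d p₀ p₁ p₂ p₃ : ℝ,
    a < b ∧ b < a + 1 ∧ c < d ∧ d < c + 1 ∧
    p₀ < p₁ ∧ p₁ < p₂ ∧ p₂ < p₃ ∧ p₃ < p₀ + 1 ∧
    (∀ t ∈ Set.Icc (0 : ℝ) 1, D (0, t) = K₁ (a + t * (b - a))) ∧
    (∀ t ∈ Set.Icc (0 : ℝ) 1, D (1, 1 - t) = K₂ (c + t * (d - c))) ∧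
    Traces K p₀ p₁ K₁ b (a + 1) ∧
    (∀ t ∈ Set.Icc (0 : ℝ) 1, K (p₁ + t * (p₂ - p₁)) = D (t, 0)) ∧
    Traces K p₂ p₃ K₂ d (c + 1) ∧
    (∀ t ∈ Set.Icc (0 : ℝ) 1, K (p₃ + t * (p₀ + 1 - p₃)) = D (1 - t, 1))

/-! ### Ambient isotopy and crossing changes -/

/-- The links with components `L i` and `L' i` are (smoothly) ambient isotopic as oriented
links: a smooth family of diffeomorphisms of the sphere, which starts at the identity, ends with
a diffeomorphism that carries each `L i` to `L' i`. -/
def AmbientIsotopic {ι : Type} (L L' : ι → Knot) : Prop :=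
  ∃ H : ℝ → Diffeomorph (𝓡 3) (𝓡 3) S3 S3 ∞,
    ContMDiff (𝓘(ℝ, ℝ).prod (𝓡 3)) (𝓡 3) ∞ (fun p : ℝ × S3 => H p.1 p.2) ∧
    (∀ x, H 0 x = x) ∧ ∀ i t, H 1 (L i t) = L' i t

/-- In the projection belonging to `A`, the diagrams of `L` and `L'` differ exactly in that over and
under are interchanged at one crossing, and this is a crossing of the component `i` with
itself. -/
def DiffersByCrossingChange {ι : Type} (A : Rotation) (L L' : ι → Knot) (i : ι) : Prop :=
  IsDiagram A L ∧ IsDiagram A L' ∧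
  (∀ j t, shadow A (L j) t = shadow A (L' j) t) ∧
  ∃ s₀ t₀ : ℝ, ((i, s₀), (i, t₀)) ∈ doublePoints A L ∧
    height A (L i) t₀ < height A (L i) s₀ ∧ height A (L' i) s₀ < height A (L' i) t₀ ∧
    ∀ x y, (x, y) ∈ doublePoints A L →
      (x, y) ≠ ((i, s₀), (i, t₀)) → (x, y) ≠ ((i, t₀), (i, s₀)) →
      (height A (L x.1) x.2 < height A (L y.1) y.2 ↔
        height A (L' x.1) x.2 < height A (L' y.1) y.2)

/-- In the presence of the knot `M`, the knot `K` is obtained from `J` by a single crossing change: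
up to ambient isotopy of links, `K ∪ M` arises from `J ∪ M` by changing one crossing of the
first component with itself in a diagram. -/
def IsCrossingChange (J K M : Knot) : Prop :=
  ∃ (A : Rotation) (L L' : Fin 2 → Knot),
    AmbientIsotopic ![J, M] L ∧ AmbientIsotopic ![K, M] L' ∧ DiffersByCrossingChange A L L' 0

end KnotTheory

end

open KnotTheory

section

set_option maxSynthPendingDepth 3
set_option autoImplicit false

open scoped Manifold ContDiff Topology
open MeasureTheory Set Filter

namespace KnotTheory

/-! ### Integrals depending on a parameter -/

section Parametric

variable {H F : Type*} [NormedAddCommGroup H] [NormedAddCommGroup F]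

/-! The linking number is recognised as the degree of a map, computed by integration in 4-space. For
disjoint closed curves X, Y on the sphere, the chords (1 - r) X(s) - r Y(t), 0 ≤ r ≤ 1, never meet
the origin, and together they map the join of two circles, a 3-sphere, to ℝ⁴ minus the origin. A
function h homogeneous of degree -4 (`IsKernel`) is the density of a closed 3-form on that space.
Pulling the form back and carrying out the r-integration first leaves the Gauss-type double integral
`linkInt`. It makes sense as soon as no point of X lies on a common closed ray with a point of Y
(`IndepCurves`), so no centre of projection enters.

For fixed Y the inner integral is a 1-form in x, and it is closed (`linkFormDeriv_symm`). Primitives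
over squares then show that `linkInt` is unchanged under homotopies through independent pairs
(`linkInt_eq_of_homotopy`). Exchanging the curves replaces h(v) by h(-v) (`linkInt_swap`). For
kernels concentrated around an axis (`coneKernel`) the choice of the axis does not matter
(`linkInt_coneKernel_eq`), because reflections form a connected family and can be absorbed into the
curves.

A diagram enters through stereographic projection: translating the apex of the rays from the centre
to the pole and rescaling are admissible homotopies, and they carry the knots to their stereographic
images in an affine hyperplane (`linkInt_stereoCurve`). There a chord points vertically upwards
exactly at r = 1/2 over a crossing where the first curve is on top. For a sufficiently concentrated
kernel, change of variables near these crossings gives minus the mass of the kernel times the signed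
number of such crossings (`exists_linkInt_affineCurve_eq`).

So the number of crossings with J above K, counted with sign, is an integer determined by the
integrals alone (`HasLinkNumber`). By the exchange symmetry it equals the number with K above J; the
whole crossing sum is therefore twice this integer in every diagram
(`IsTransversal.crossingSum_eq_two_mul`).

The three rules become statements about integrals or diagrams. For a connected sum, the linking form
has a primitive on the disc, so the four sides of the disc contribute zero (`linkInt_connectedSum`).
Reversal is a substitution. An ambient isotopy is an admissible homotopy, and a self-crossing change
does not touch the crossings between different components.

Diagrams exist by general position (`exists_isDiagram`): some point of the sphere is missed by the
link, and after projecting from it almost every direction in 3-space avoids tangents of the link,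
non-transversal double points and triple points. -/

theorem eventually_norm_le_of_continuousOn_prod {f : H → ℝ → F} {U : Set H} (hU : IsOpen U)
    (hf : ContinuousOn (Function.uncurry f) (U ×ˢ Icc (0 : ℝ) 1)) {x₀ : H} (hx : x₀ ∈ U) :
    ∃ M : ℝ, ∀ᶠ x in 𝓝 x₀, ∀ t ∈ Icc (0 : ℝ) 1, ‖f x t‖ ≤ M := by
  have hc : ContinuousOn (fun t => f x₀ t) (Icc (0 : ℝ) 1) :=
    hf.comp (f := fun t => (x₀, t)) (by fun_prop) fun t ht => ⟨hx, ht⟩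
  obtain ⟨M, hM⟩ := isCompact_Icc.exists_bound_of_continuousOn hc
  refine ⟨M + 1, ?_⟩
  have key : ∀ t ∈ Icc (0 : ℝ) 1, ∀ᶠ z : H × ℝ in 𝓝 (x₀, t),
      z.2 ∈ Icc (0 : ℝ) 1 → ‖f z.1 z.2‖ ≤ M + 1 := by
    intro t ht
    have h1 := (hf (x₀, t) ⟨hx, ht⟩).norm
    have h2 : ∀ᶠ z in 𝓝[U ×ˢ Icc (0 : ℝ) 1] (x₀, t), ‖f z.1 z.2‖ < M + 1 :=
      h1.eventually_lt_const (by have := hM t ht; simp only [Function.uncurry]; linarith)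
    rw [eventually_nhdsWithin_iff] at h2
    have h3 : ∀ᶠ z : H × ℝ in 𝓝 (x₀, t), z.1 ∈ U :=
      continuousAt_fst.eventually_mem (hU.mem_nhds hx)
    filter_upwards [h2, h3] with z hz hz' ht'
    exact (hz ⟨hz', ht'⟩).le
  have := isCompact_Icc.eventually_forall_of_forall_eventually (x₀ := x₀)
    (P := fun x t => t ∈ Icc (0 : ℝ) 1 → ‖f x t‖ ≤ M + 1) key
  filter_upwards [this] with x h t ht using h t ht ht

theorem continuousOn_section {f : H → ℝ → F} {U : Set H}
    (hf : ContinuousOn (Function.uncurry f) (U ×ˢ Icc (0 : ℝ) 1)) {x : H} (hx : x ∈ U) :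
    ContinuousOn (f x) (Icc (0 : ℝ) 1) :=
  hf.comp (f := fun t => (x, t)) (by fun_prop) fun t ht => ⟨hx, ht⟩

theorem intervalIntegrable_section {f : H → ℝ → F} {U : Set H}
    (hf : ContinuousOn (Function.uncurry f) (U ×ˢ Icc (0 : ℝ) 1)) {x : H} (hx : x ∈ U) :
    IntervalIntegrable (f x) volume 0 1 := by
  apply ContinuousOn.intervalIntegrable
  rw [uIcc_of_le zero_le_one]
  exact continuousOn_section hf hx

variable [NormedSpace ℝ H] [NormedSpace ℝ F]

theorem continuousOn_intervalIntegral_param {f : H → ℝ → F} {U : Set H} (hU : IsOpen U)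
    (hf : ContinuousOn (Function.uncurry f) (U ×ˢ Icc (0 : ℝ) 1)) :
    ContinuousOn (fun x => ∫ t in (0 : ℝ)..1, f x t) U := by
  intro x₀ hx
  apply ContinuousAt.continuousWithinAt
  obtain ⟨M, hM⟩ := eventually_norm_le_of_continuousOn_prod hU hf hx
  refine intervalIntegral.continuousAt_of_dominated_interval (bound := fun _ => M) ?_ ?_
    intervalIntegrable_const ?_
  · filter_upwards [hU.mem_nhds hx] with x h
    exact (intervalIntegrable_section hf h).aestronglyMeasurable_restrict_uIoc
  · filter_upwards [hM] with x h
    refine ae_of_all _ fun t ht => h t ?_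
    rw [uIoc_of_le zero_le_one] at ht
    exact Ioc_subset_Icc_self ht
  · refine ae_of_all _ fun t ht => ?_
    rw [uIoc_of_le zero_le_one] at ht
    have : ContinuousOn (fun x => f x t) U :=
      hf.comp (f := fun x => (x, t)) (by fun_prop) fun x hx => ⟨hx, Ioc_subset_Icc_self ht⟩
    exact this.continuousAt (hU.mem_nhds hx)

/-- Dominated differentiation: compactness of [0, 1] turns joint continuity of f' into a constant
bound valid for all x near x₀. -/
theorem hasFDerivAt_intervalIntegral_param {f : H → ℝ → F} {f' : H → ℝ → H →L[ℝ] F} {U : Set H}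
    (hU : IsOpen U) (hf : ContinuousOn (Function.uncurry f) (U ×ˢ Icc (0 : ℝ) 1))
    (hf' : ContinuousOn (Function.uncurry f') (U ×ˢ Icc (0 : ℝ) 1))
    (hd : ∀ x ∈ U, ∀ t ∈ Icc (0 : ℝ) 1, HasFDerivAt (fun x => f x t) (f' x t) x)
    {x₀ : H} (hx : x₀ ∈ U) :
    HasFDerivAt (fun x => ∫ t in (0 : ℝ)..1, f x t) (∫ t in (0 : ℝ)..1, f' x₀ t) x₀ := by
  obtain ⟨M, hM⟩ := eventually_norm_le_of_continuousOn_prod hU hf' hx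
  refine intervalIntegral.hasFDerivAt_integral_of_dominated_of_fderiv_le (bound := fun _ => M)
    (s := {x | x ∈ U ∧ ∀ t ∈ Icc (0 : ℝ) 1, ‖f' x t‖ ≤ M})
    (inter_mem (hU.mem_nhds hx) hM) ?_ (intervalIntegrable_section hf hx)
    (intervalIntegrable_section hf' hx).aestronglyMeasurable_restrict_uIoc ?_ intervalIntegrable_const ?_
  · filter_upwards [hU.mem_nhds hx] with x h
    exact (intervalIntegrable_section hf h).aestronglyMeasurable_restrict_uIoc
  · refine ae_of_all _ fun t ht x h => h.2 t ?_
    rw [uIoc_of_le zero_le_one] at ht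
    exact Ioc_subset_Icc_self ht
  · refine ae_of_all _ fun t ht x h => hd x h.1 t ?_
    rw [uIoc_of_le zero_le_one] at ht
    exact Ioc_subset_Icc_self ht

end Parametric

/-! ### The determinant of four vectors -/

/-- Euclidean 4-space. -/
abbrev E4 : Type := EuclideanSpace ℝ (Fin 4)

/-- The determinant of four vectors, expanded by the minors of the first two. -/
def det4 (x y v w : E4) : ℝ :=
  (x 0 * y 1 - x 1 * y 0) * (v 2 * w 3 - v 3 * w 2) -
  (x 0 * y 2 - x 2 * y 0) * (v 1 * w 3 - v 3 * w 1) +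
  (x 0 * y 3 - x 3 * y 0) * (v 1 * w 2 - v 2 * w 1) +
  (x 1 * y 2 - x 2 * y 1) * (v 0 * w 3 - v 3 * w 0) -
  (x 1 * y 3 - x 3 * y 1) * (v 0 * w 2 - v 2 * w 0) +
  (x 2 * y 3 - x 3 * y 2) * (v 0 * w 1 - v 1 * w 0)

theorem det4_eq_det (x y v w : E4) :
    det4 x y v w = Matrix.det (Matrix.of ![x.ofLp, y.ofLp, v.ofLp, w.ofLp]) := by
  simp [det4, Matrix.det_succ_row_zero, Fin.sum_univ_succ, Fin.succAbove]
  ring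

theorem det4_mulVec (M : Matrix (Fin 4) (Fin 4) ℝ) (x y v w : E4) :
    det4 (WithLp.toLp 2 (M.mulVec x.ofLp)) (WithLp.toLp 2 (M.mulVec y.ofLp))
      (WithLp.toLp 2 (M.mulVec v.ofLp)) (WithLp.toLp 2 (M.mulVec w.ofLp)) =
      M.det * det4 x y v w := by
  rw [det4_eq_det, det4_eq_det, ← Matrix.det_transpose M, mul_comm, ← Matrix.det_mul]
  congr 1
  ext i j
  fin_cases i <;> simp [Matrix.mul_apply, Matrix.mulVec, dotProduct, mul_comm]

/-- `v ↦ det4 x y v z` as a continuous linear form. -/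
noncomputable def det4L (x y z : E4) : E4 →L[ℝ] ℝ :=
  LinearMap.toContinuousLinearMap
    { toFun := fun v => det4 x y v z
      map_add' := by intro a b; simp [det4]; ring
      map_smul' := by intro a b; simp [det4]; ring }

@[simp] theorem det4L_apply (x y z v : E4) : det4L x y z v = det4 x y v z := rfl

/-- `x ↦ det4L x y z` as a continuous linear map. -/
noncomputable def det4LL (y z : E4) : E4 →L[ℝ] E4 →L[ℝ] ℝ :=
  LinearMap.toContinuousLinearMap
    { toFun := fun x => det4L x y z
      map_add' := by intro a b; ext v; simp [det4]; ring
      map_smul' := by intro a b; ext v; simp [det4]; ring }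

@[simp] theorem det4LL_apply (x y z : E4) : det4LL y z x = det4L x y z := rfl

@[fun_prop]
theorem continuous_det4 {α : Type*} [TopologicalSpace α] {x y v w : α → E4} (hx : Continuous x)
    (hy : Continuous y) (hv : Continuous v) (hw : Continuous w) :
    Continuous fun a => det4 (x a) (y a) (v a) (w a) := by
  unfold det4; fun_prop

theorem continuous_det4L : Continuous fun p : E4 × E4 × E4 => det4L p.1 p.2.1 p.2.2 := by
  rw [continuous_clm_apply]
  intro v
  simp only [det4L_apply]
  fun_prop

theorem continuous_det4LL : Continuous fun p : E4 × E4 => det4LL p.1 p.2 := by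
  rw [continuous_clm_apply]
  intro v
  simp only [det4LL_apply]
  exact continuous_det4L.comp (f := fun p : E4 × E4 => (v, p.1, p.2)) (by fun_prop)

/-- Cramer's rule for five vectors in 4-space, with a linear form applied. -/
theorem cramer_det4 (g : E4 →L[ℝ] ℝ) (x y u v w : E4) :
    g x * det4 y u v w - g y * det4 x u v w + g u * det4 x y v w - g v * det4 x y u w
      + g w * det4 x y u v = 0 := by
  have key : det4 y u v w • x - det4 x u v w • y + det4 x y v w • u - det4 x y u w • v
      + det4 x y u v • w = 0 := by
    ext i
    fin_cases i <;> simp [det4] <;> ring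
  have := congrArg g key
  simp only [map_add, map_sub, map_smul, smul_eq_mul, map_zero] at this
  linarith

end KnotTheory

namespace KnotTheory

noncomputable section

/-! ### The linking form -/

/-- A function on 4-space, homogeneous of degree `-4` and continuously differentiable off the
origin: the density of a closed 3-form. -/
structure IsKernel (h : E4 → ℝ) : Prop where
  smooth : ContDiffOn ℝ 1 h {0}ᶜ
  euler : ∀ v, v ≠ 0 → fderiv ℝ h v v = -4 * h v

/-- The pairs of vectors, the first of which and the negative of the second are not separated by
the origin: they do not lie on a common closed ray. -/
def indepPairs : Set (E4 × E4) :=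
  {p | ∀ r ∈ Icc (0 : ℝ) 1, (1 - r) • p.1 - r • p.2 ≠ 0}

theorem isOpen_indepPairs : IsOpen indepPairs := by
  rw [isOpen_iff_mem_nhds]
  intro p hp
  have key : ∀ r ∈ Icc (0 : ℝ) 1, ∀ᶠ z : (E4 × E4) × ℝ in 𝓝 (p, r),
      z.2 ∈ Icc (0 : ℝ) 1 → (1 - z.2) • z.1.1 - z.2 • z.1.2 ≠ 0 := by
    intro r hr
    have hc : Continuous fun z : (E4 × E4) × ℝ => (1 - z.2) • z.1.1 - z.2 • z.1.2 := by fun_prop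
    filter_upwards [hc.continuousAt.eventually_ne (hp r hr)] with z hz _ using hz
  have := isCompact_Icc.eventually_forall_of_forall_eventually
    (P := fun (q : E4 × E4) (r : ℝ) => r ∈ Icc (0 : ℝ) 1 → (1 - r) • q.1 - r • q.2 ≠ 0) key
  filter_upwards [this] with q hq r hr using hq r hr hr

/-- The integral of `h` with weight `m` over the segment from `x` to `-y`. -/
def segInt (m : ℝ → ℝ) (h : E4 → ℝ) (p : E4 × E4) : ℝ :=
  ∫ r in (0 : ℝ)..1, m r * h ((1 - r) • p.1 - r • p.2)

/-- The integral of the derivative of `h` with weight `m` over the segment from `x` to `-y`. -/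
def segIntDeriv (m : ℝ → ℝ) (h : E4 → ℝ) (p : E4 × E4) : E4 →L[ℝ] ℝ :=
  ∫ r in (0 : ℝ)..1, m r • fderiv ℝ h ((1 - r) • p.1 - r • p.2)

section Kernel

variable {h : E4 → ℝ} (hh : IsKernel h) {m : ℝ → ℝ}

include hh in
theorem IsKernel.continuousOn_segment (hm : Continuous m) :
    ContinuousOn (Function.uncurry fun (p : E4 × E4) r => m r * h ((1 - r) • p.1 - r • p.2))
      (indepPairs ×ˢ Icc (0 : ℝ) 1) := by
  refine ContinuousOn.mul (by fun_prop) ?_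
  exact hh.smooth.continuousOn.comp (f := fun z : (E4 × E4) × ℝ => (1 - z.2) • z.1.1 - z.2 • z.1.2)
    (by fun_prop) fun z hz => hz.1 z.2 hz.2

include hh in
theorem IsKernel.continuousOn_fderiv : ContinuousOn (fderiv ℝ h) {0}ᶜ :=
  hh.smooth.continuousOn_fderiv_of_isOpen isOpen_compl_singleton le_rfl

include hh in
theorem IsKernel.hasFDerivAt {v : E4} (hv : v ≠ 0) : HasFDerivAt h (fderiv ℝ h v) v :=
  ((hh.smooth.contDiffAt (isOpen_compl_singleton.mem_nhds hv)).differentiableAt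
    one_ne_zero).hasFDerivAt

include hh in
theorem IsKernel.continuousOn_fderiv_segment (hm : Continuous m) :
    ContinuousOn (Function.uncurry fun (p : E4 × E4) r =>
      m r • fderiv ℝ h ((1 - r) • p.1 - r • p.2)) (indepPairs ×ˢ Icc (0 : ℝ) 1) := by
  refine ContinuousOn.smul (f := fun z : (E4 × E4) × ℝ => m z.2)
    (g := fun z : (E4 × E4) × ℝ => fderiv ℝ h ((1 - z.2) • z.1.1 - z.2 • z.1.2)) (by fun_prop) ?_
  exact hh.continuousOn_fderiv.comp (f := fun z : (E4 × E4) × ℝ => (1 - z.2) • z.1.1 - z.2 • z.1.2)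
    (by fun_prop) fun z hz => hz.1 z.2 hz.2

include hh in
theorem IsKernel.continuousOn_segInt (hm : Continuous m) :
    ContinuousOn (segInt m h) indepPairs :=
  continuousOn_intervalIntegral_param isOpen_indepPairs (hh.continuousOn_segment hm)

include hh in
theorem IsKernel.continuousOn_segIntDeriv (hm : Continuous m) :
    ContinuousOn (segIntDeriv m h) indepPairs :=
  continuousOn_intervalIntegral_param isOpen_indepPairs (hh.continuousOn_fderiv_segment hm)

include hh in
theorem IsKernel.hasFDerivAt_segInt_left (hm : Continuous m) {p : E4 × E4} (hp : p ∈ indepPairs) :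
    HasFDerivAt (fun x => segInt m h (x, p.2)) (segIntDeriv (fun r => m r * (1 - r)) h p) p.1 := by
  have hU : IsOpen {x : E4 | (x, p.2) ∈ indepPairs} :=
    isOpen_indepPairs.preimage (by fun_prop : Continuous fun x : E4 => (x, p.2))
  refine hasFDerivAt_intervalIntegral_param (U := {x : E4 | (x, p.2) ∈ indepPairs})
    (f := fun x r => m r * h ((1 - r) • x - r • p.2))
    (f' := fun x r => (m r * (1 - r)) • fderiv ℝ h ((1 - r) • x - r • p.2)) hU ?_ ?_ ?_ hp
  · exact (hh.continuousOn_segment hm).comp (f := fun z : E4 × ℝ => ((z.1, p.2), z.2))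
      (by fun_prop) fun z hz => ⟨hz.1, hz.2⟩
  · exact (hh.continuousOn_fderiv_segment (m := fun r => m r * (1 - r)) (by fun_prop)).comp
      (f := fun z : E4 × ℝ => ((z.1, p.2), z.2)) (by fun_prop) fun z hz => ⟨hz.1, hz.2⟩
  · intro x hx r hr
    have h1 : HasFDerivAt (fun x : E4 => (1 - r) • x - r • p.2)
        ((1 - r) • ContinuousLinearMap.id ℝ E4) x :=
      ((hasFDerivAt_id x).const_smul (1 - r)).sub_const _
    have h2 := ((hh.hasFDerivAt (hx r hr)).comp x h1).const_mul (m r)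
    refine h2.congr_fderiv ?_
    ext v
    simp [mul_assoc]

include hh in
theorem IsKernel.hasFDerivAt_segInt_right (hm : Continuous m) {p : E4 × E4}
    (hp : p ∈ indepPairs) :
    HasFDerivAt (fun y => segInt m h (p.1, y)) (segIntDeriv (fun r => m r * -r) h p) p.2 := by
  have hU : IsOpen {y : E4 | (p.1, y) ∈ indepPairs} :=
    isOpen_indepPairs.preimage (by fun_prop : Continuous fun y : E4 => (p.1, y))
  refine hasFDerivAt_intervalIntegral_param (U := {y : E4 | (p.1, y) ∈ indepPairs})
    (f := fun y r => m r * h ((1 - r) • p.1 - r • y))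
    (f' := fun y r => (m r * -r) • fderiv ℝ h ((1 - r) • p.1 - r • y)) hU ?_ ?_ ?_ hp
  · exact (hh.continuousOn_segment hm).comp (f := fun z : E4 × ℝ => ((p.1, z.1), z.2))
      (by fun_prop) fun z hz => ⟨hz.1, hz.2⟩
  · exact (hh.continuousOn_fderiv_segment (m := fun r => m r * -r) (by fun_prop)).comp
      (f := fun z : E4 × ℝ => ((p.1, z.1), z.2)) (by fun_prop) fun z hz => ⟨hz.1, hz.2⟩
  · intro y hy r hr
    have h1 : HasFDerivAt (fun y : E4 => (1 - r) • p.1 - r • y)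
        (-(r • ContinuousLinearMap.id ℝ E4)) y :=
      ((hasFDerivAt_id y).const_smul r).const_sub _
    have h2 := ((hh.hasFDerivAt (hy r hr)).comp y h1).const_mul (m r)
    refine h2.congr_fderiv ?_
    ext v
    simp [mul_assoc]

include hh in
theorem IsKernel.segIntDeriv_apply (hm : Continuous m) {p : E4 × E4} (hp : p ∈ indepPairs)
    (w : E4) : segIntDeriv m h p w =
      ∫ r in (0 : ℝ)..1, m r * fderiv ℝ h ((1 - r) • p.1 - r • p.2) w := by
  rw [segIntDeriv, ContinuousLinearMap.intervalIntegral_apply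
    (intervalIntegrable_section (hh.continuousOn_fderiv_segment hm) hp)]
  rfl

/-- The coefficient of the linking form. -/
def kerG (h : E4 → ℝ) : E4 × E4 → ℝ := segInt (fun r => r * (1 - r)) h

/-- The coefficient of the primitive of the exterior derivative of the linking form along the
second curve. -/
def kerB (h : E4 → ℝ) : E4 × E4 → ℝ := segInt (fun r => (1 - r) ^ 2) h

/-- The gradient of `kerG` in the first variable. -/
def kerg (h : E4 → ℝ) : E4 × E4 → E4 →L[ℝ] ℝ := segIntDeriv (fun r => r * (1 - r) ^ 2) h

include hh in
theorem IsKernel.hasFDerivAt_kerG {p : E4 × E4} (hp : p ∈ indepPairs) :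
    HasFDerivAt (fun x => kerG h (x, p.2)) (kerg h p) p.1 := by
  refine (hh.hasFDerivAt_segInt_left (m := fun r => r * (1 - r)) (by fun_prop) hp).congr_fderiv ?_
  unfold kerg
  congr 1
  ext r; ring

include hh in
-- The chain rule in y contributes the factor -r, and (1 - r)² · (-r) is minus the weight of `kerg`.
-- This match with the x-derivative of `kerG` is what makes the linking form closed.
theorem IsKernel.hasFDerivAt_kerB {p : E4 × E4} (hp : p ∈ indepPairs) :
    HasFDerivAt (fun y => kerB h (p.1, y)) (-kerg h p) p.2 := by
  refine (hh.hasFDerivAt_segInt_right (m := fun r => (1 - r) ^ 2) (by fun_prop) hp).congr_fderiv ?_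
  unfold kerg segIntDeriv
  rw [← intervalIntegral.integral_neg]
  congr 1
  funext r
  have e : (1 - r) ^ 2 * -r = -(r * (1 - r) ^ 2) := by ring
  beta_reduce
  rw [e]
  exact neg_smul _ _

include hh in
/-- Integration by parts along the segment. -/
theorem IsKernel.segInt_parts {p : E4 × E4} (hp : p ∈ indepPairs) {n n' : ℝ → ℝ}
    (hn : ∀ r, HasDerivAt n (n' r) r) (hn' : Continuous n') (h0 : n 0 = 0) (h1 : n 1 = 0) :
    segInt n' h p = ∫ r in (0 : ℝ)..1,
      n r * fderiv ℝ h ((1 - r) • p.1 - r • p.2) (p.1 + p.2) := by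
  have hnc : Continuous n := continuous_iff_continuousAt.2 fun r => (hn r).continuousAt
  have hd : ∀ r ∈ uIcc (0 : ℝ) 1, HasDerivAt (fun r => n r * h ((1 - r) • p.1 - r • p.2))
      (n' r * h ((1 - r) • p.1 - r • p.2) -
        n r * fderiv ℝ h ((1 - r) • p.1 - r • p.2) (p.1 + p.2)) r := by
    intro r hr
    rw [uIcc_of_le zero_le_one] at hr
    have e1 : HasDerivAt (fun r : ℝ => (1 - r) • p.1 - r • p.2) (-(p.1 + p.2)) r := by
      have a := (((hasDerivAt_id r).const_sub 1).smul_const p.1).sub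
        ((hasDerivAt_id r).smul_const p.2)
      refine a.congr_deriv ?_
      simp; abel
    have e2 := (hn r).mul ((hh.hasFDerivAt (hp r hr)).comp_hasDerivAt r e1)
    refine e2.congr_deriv ?_
    rw [map_neg]; simp only [Function.comp]; ring
  have i1 := intervalIntegrable_section (hh.continuousOn_segment hn') hp
  have i2 : IntervalIntegrable (fun r => n r * fderiv ℝ h ((1 - r) • p.1 - r • p.2) (p.1 + p.2))
      volume 0 1 := by
    apply ContinuousOn.intervalIntegrable
    rw [uIcc_of_le zero_le_one]
    exact (continuousOn_section (hh.continuousOn_fderiv_segment hnc) hp).clm_apply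
      (by fun_prop : ContinuousOn (fun _ => p.1 + p.2) _)
  have := intervalIntegral.integral_eq_sub_of_hasDerivAt hd (i1.sub i2)
  rw [h0, h1, zero_mul, zero_mul, sub_zero, intervalIntegral.integral_sub i1 i2] at this
  unfold segInt
  linarith

include hh in
theorem IsKernel.continuousOn_fderiv_segment_apply (hm : Continuous m) {p : E4 × E4}
    (hp : p ∈ indepPairs) (w : E4) :
    IntervalIntegrable (fun r => m r * fderiv ℝ h ((1 - r) • p.1 - r • p.2) w) volume 0 1 := by
  apply ContinuousOn.intervalIntegrable
  rw [uIcc_of_le zero_le_one]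
  exact (continuousOn_section (hh.continuousOn_fderiv_segment hm) hp).clm_apply
    (by fun_prop : ContinuousOn (fun _ => w) _)

include hh in
-- With v the point of the segment, x = v + r(x + y). Euler's relation handles the direction v. The
-- direction x + y is minus the velocity of the segment, so integration by parts with r²(1 - r)²
-- applies; the weights add up to -2r(1 - r).
theorem IsKernel.kerg_left {p : E4 × E4} (hp : p ∈ indepPairs) :
    kerg h p p.1 = -2 * kerG h p := by
  have key := hh.segInt_parts hp (n := fun r => r ^ 2 * (1 - r) ^ 2)
    (n' := fun r => 2 * r * (1 - r) ^ 2 - 2 * r ^ 2 * (1 - r))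
    (fun r => by
      have := ((hasDerivAt_id r).pow 2).mul (((hasDerivAt_id r).const_sub 1).pow 2)
      refine this.congr_deriv ?_
      simp; ring) (by fun_prop) (by norm_num) (by norm_num)
  have i1 := hh.continuousOn_fderiv_segment_apply (m := fun r => r ^ 2 * (1 - r) ^ 2)
    (by fun_prop) hp (p.1 + p.2)
  have i2 := intervalIntegrable_section
    (hh.continuousOn_segment (m := fun r => 4 * r * (1 - r) ^ 2) (by fun_prop)) hp
  have i3 := intervalIntegrable_section (hh.continuousOn_segment
    (m := fun r => 2 * r * (1 - r) ^ 2 - 2 * r ^ 2 * (1 - r)) (by fun_prop)) hp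
  rw [kerg, hh.segIntDeriv_apply (by fun_prop) hp]
  have e : ∀ r ∈ uIcc (0 : ℝ) 1, r * (1 - r) ^ 2 * fderiv ℝ h ((1 - r) • p.1 - r • p.2) p.1 =
      r ^ 2 * (1 - r) ^ 2 * fderiv ℝ h ((1 - r) • p.1 - r • p.2) (p.1 + p.2) -
        4 * r * (1 - r) ^ 2 * h ((1 - r) • p.1 - r • p.2) := by
    intro r hr
    rw [uIcc_of_le zero_le_one] at hr
    have h1 := hh.euler _ (hp r hr)
    have h2 : p.1 = ((1 - r) • p.1 - r • p.2) + r • (p.1 + p.2) := by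
      module
    have h3 := congrArg (fderiv ℝ h ((1 - r) • p.1 - r • p.2)) h2
    rw [map_add _ ((1 - r) • p.1 - r • p.2), h1, map_smul, smul_eq_mul] at h3
    rw [h3]
    ring
  rw [intervalIntegral.integral_congr e, intervalIntegral.integral_sub i1 i2, ← key]
  unfold segInt kerG segInt
  rw [← intervalIntegral.integral_sub i3 i2, ← intervalIntegral.integral_const_mul]
  congr 1
  ext r
  ring

include hh in
-- As in the other slot, now with y = (1 - r)(x + y) - v and the boundary weight r(1 - r)³; the
-- weights add up to (1 - r)².
theorem IsKernel.kerg_right {p : E4 × E4} (hp : p ∈ indepPairs) :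
    kerg h p p.2 = kerB h p := by
  have key := hh.segInt_parts hp (n := fun r => r * (1 - r) ^ 3)
    (n' := fun r => (1 - r) ^ 3 - 3 * r * (1 - r) ^ 2)
    (fun r => by
      have := (hasDerivAt_id r).mul (((hasDerivAt_id r).const_sub 1).pow 3)
      refine this.congr_deriv ?_
      simp; ring) (by fun_prop) (by norm_num) (by norm_num)
  have i1 := hh.continuousOn_fderiv_segment_apply (m := fun r => r * (1 - r) ^ 3)
    (by fun_prop) hp (p.1 + p.2)
  have i2 := intervalIntegrable_section
    (hh.continuousOn_segment (m := fun r => 4 * r * (1 - r) ^ 2) (by fun_prop)) hp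
  have i3 := intervalIntegrable_section (hh.continuousOn_segment
    (m := fun r => (1 - r) ^ 3 - 3 * r * (1 - r) ^ 2) (by fun_prop)) hp
  rw [kerg, hh.segIntDeriv_apply (by fun_prop) hp]
  have e : ∀ r ∈ uIcc (0 : ℝ) 1, r * (1 - r) ^ 2 * fderiv ℝ h ((1 - r) • p.1 - r • p.2) p.2 =
      r * (1 - r) ^ 3 * fderiv ℝ h ((1 - r) • p.1 - r • p.2) (p.1 + p.2) +
        4 * r * (1 - r) ^ 2 * h ((1 - r) • p.1 - r • p.2) := by
    intro r hr
    rw [uIcc_of_le zero_le_one] at hr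
    have h1 := hh.euler _ (hp r hr)
    have h2 : p.2 = (1 - r) • (p.1 + p.2) - ((1 - r) • p.1 - r • p.2) := by
      module
    have h3 := congrArg (fderiv ℝ h ((1 - r) • p.1 - r • p.2)) h2
    rw [map_sub _ _ ((1 - r) • p.1 - r • p.2), h1, map_smul, smul_eq_mul] at h3
    rw [h3]
    ring
  rw [intervalIntegral.integral_congr e, intervalIntegral.integral_add i1 i2, ← key]
  unfold segInt kerB segInt
  rw [← intervalIntegral.integral_add i3 i2]
  congr 1
  ext r
  ring

end Kernel

end

end KnotTheory

/-! ### Closed curves and the closed 1-form attached to a curve. -/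

namespace KnotTheory

noncomputable section

/-- A closed continuously differentiable curve in 4-space. -/
structure IsLoop (X : ℝ → E4) : Prop where
  periodic : Function.Periodic X 1
  contDiff : ContDiff ℝ 1 X

theorem IsLoop.continuous {X : ℝ → E4} (hX : IsLoop X) : Continuous X := hX.contDiff.continuous

theorem IsLoop.continuous_deriv {X : ℝ → E4} (hX : IsLoop X) : Continuous (deriv X) :=
  hX.contDiff.continuous_deriv le_rfl

theorem IsLoop.hasDerivAt {X : ℝ → E4} (hX : IsLoop X) (t : ℝ) : HasDerivAt X (deriv X t) t :=
  (hX.contDiff.differentiable one_ne_zero t).hasDerivAt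

theorem IsLoop.deriv_periodic {X : ℝ → E4} (hX : IsLoop X) : Function.Periodic (deriv X) 1 := by
  intro t
  rw [← deriv_comp_add_const]
  congr 1
  exact funext hX.periodic

theorem periodic_exists_mem_Icc {α : Type*} {f : ℝ → α} (hf : Function.Periodic f 1) (t : ℝ) :
    ∃ s ∈ Icc (0 : ℝ) 1, f t = f s := by
  obtain ⟨s, hs, h⟩ := hf.exists_mem_Ico₀ one_pos t
  exact ⟨s, Ico_subset_Icc_self hs, h⟩

/-- The set of points which are independent of all points of the curve `Y`. -/
def coneCompl (Y : ℝ → E4) : Set E4 := {x | ∀ t, (x, Y t) ∈ indepPairs}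

theorem isOpen_coneCompl {Y : ℝ → E4} (hY : IsLoop Y) : IsOpen (coneCompl Y) := by
  rw [isOpen_iff_mem_nhds]
  intro x hx
  have key : ∀ t ∈ Icc (0 : ℝ) 1, ∀ᶠ z : E4 × ℝ in 𝓝 (x, t), (z.1, Y z.2) ∈ indepPairs := by
    intro t _
    have hc : Continuous fun z : E4 × ℝ => (z.1, Y z.2) := by
      have := hY.continuous
      fun_prop
    exact hc.continuousAt.eventually_mem (isOpen_indepPairs.mem_nhds (hx t))
  have := isCompact_Icc.eventually_forall_of_forall_eventually
    (P := fun (x : E4) (t : ℝ) => (x, Y t) ∈ indepPairs) key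
  filter_upwards [this] with z hz t
  obtain ⟨s, hs, e⟩ := periodic_exists_mem_Icc hY.periodic t
  rw [e]
  exact hz s hs

/-- The linking form of the curve `Y` with kernel `h`, a closed 1-form on the complement of the
cone over `Y`. -/
def linkForm (h : E4 → ℝ) (Y : ℝ → E4) (x : E4) : E4 →L[ℝ] ℝ :=
  ∫ t in (0 : ℝ)..1, kerG h (x, Y t) • det4L x (Y t) (deriv Y t)

/-- The derivative of the linking form. -/
def linkFormDeriv (h : E4 → ℝ) (Y : ℝ → E4) (x : E4) (t : ℝ) : E4 →L[ℝ] E4 →L[ℝ] ℝ :=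
  kerG h (x, Y t) • det4LL (Y t) (deriv Y t) +
    (kerg h (x, Y t)).smulRight (det4L x (Y t) (deriv Y t))

section LinkForm

variable {h : E4 → ℝ} (hh : IsKernel h) {Y : ℝ → E4} (hY : IsLoop Y)

include hh in
theorem IsKernel.continuousOn_kerG : ContinuousOn (kerG h) indepPairs :=
  hh.continuousOn_segInt (m := fun r => r * (1 - r)) (by fun_prop)

include hh in
theorem IsKernel.continuousOn_kerg : ContinuousOn (kerg h) indepPairs :=
  hh.continuousOn_segIntDeriv (m := fun r => r * (1 - r) ^ 2) (by fun_prop)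

include hY in
theorem IsLoop.continuous_det4L_curve :
    Continuous fun z : E4 × ℝ => det4L z.1 (Y z.2) (deriv Y z.2) := by
  have h1 := hY.continuous
  have h2 := hY.continuous_deriv
  exact continuous_det4L.comp (f := fun z : E4 × ℝ => (z.1, Y z.2, deriv Y z.2)) (by fun_prop)

include hY in
theorem IsLoop.continuous_pair : Continuous fun z : E4 × ℝ => (z.1, Y z.2) := by
  have h1 := hY.continuous
  fun_prop

include hh hY in
theorem continuousOn_linkForm_integrand :
    ContinuousOn (Function.uncurry fun x t => kerG h (x, Y t) • det4L x (Y t) (deriv Y t))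
      (coneCompl Y ×ˢ Icc (0 : ℝ) 1) := by
  refine ContinuousOn.smul (f := fun z : E4 × ℝ => kerG h (z.1, Y z.2))
    (g := fun z : E4 × ℝ => det4L z.1 (Y z.2) (deriv Y z.2)) ?_
    hY.continuous_det4L_curve.continuousOn
  exact hh.continuousOn_kerG.comp hY.continuous_pair.continuousOn fun z hz => hz.1 z.2

include hh hY in
theorem continuousOn_linkFormDeriv :
    ContinuousOn (Function.uncurry (linkFormDeriv h Y)) (coneCompl Y ×ˢ Icc (0 : ℝ) 1) := by
  have h1 := hY.continuous
  have h2 := hY.continuous_deriv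
  have e1 : ContinuousOn (fun z : E4 × ℝ => kerG h (z.1, Y z.2)) (coneCompl Y ×ˢ Icc (0 : ℝ) 1) :=
    hh.continuousOn_kerG.comp hY.continuous_pair.continuousOn fun z hz => hz.1 z.2
  have e2 : ContinuousOn (fun z : E4 × ℝ => kerg h (z.1, Y z.2)) (coneCompl Y ×ˢ Icc (0 : ℝ) 1) :=
    hh.continuousOn_kerg.comp hY.continuous_pair.continuousOn fun z hz => hz.1 z.2
  have e3 : Continuous fun z : E4 × ℝ => det4LL (Y z.2) (deriv Y z.2) :=
    continuous_det4LL.comp (f := fun z : E4 × ℝ => (Y z.2, deriv Y z.2)) (by fun_prop)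
  have e4 := hY.continuous_det4L_curve.continuousOn (s := coneCompl Y ×ˢ Icc (0 : ℝ) 1)
  refine (e1.smul e3.continuousOn).add (f := fun z : E4 × ℝ => _)
    (g := fun z : E4 × ℝ => (kerg h (z.1, Y z.2)).smulRight (det4L z.1 (Y z.2) (deriv Y z.2))) ?_
  rw [continuousOn_clm_apply]
  intro v
  simp only [ContinuousLinearMap.smulRight_apply]
  exact (e2.clm_apply continuousOn_const).smul e4

include hh hY in
theorem hasFDerivAt_linkForm {x : E4} (hx : x ∈ coneCompl Y) :
    HasFDerivAt (linkForm h Y) (∫ t in (0 : ℝ)..1, linkFormDeriv h Y x t) x := by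
  refine hasFDerivAt_intervalIntegral_param (isOpen_coneCompl hY)
    (continuousOn_linkForm_integrand hh hY) (continuousOn_linkFormDeriv hh hY) ?_ hx
  intro x hx t _
  have h1 : HasFDerivAt (fun x => kerG h (x, Y t)) (kerg h (x, Y t)) x :=
    hh.hasFDerivAt_kerG (hx t)
  have h2 : HasFDerivAt (fun x => det4L x (Y t) (deriv Y t)) (det4LL (Y t) (deriv Y t)) x :=
    (det4LL (Y t) (deriv Y t)).hasFDerivAt
  exact h1.smul h2

include hh hY in
/-- The linking form is closed. -/
theorem linkFormDeriv_symm {x : E4} (hx : x ∈ coneCompl Y) (u v : E4) :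
    (∫ t in (0 : ℝ)..1, linkFormDeriv h Y x t) u v =
      (∫ t in (0 : ℝ)..1, linkFormDeriv h Y x t) v u := by
  have hi := intervalIntegrable_section (continuousOn_linkFormDeriv hh hY) hx
  have hc := continuousOn_section (continuousOn_linkFormDeriv hh hY) hx
  have hi' : ∀ u v : E4, IntervalIntegrable (fun t => linkFormDeriv h Y x t u v) volume 0 1 := by
    intro u v
    apply ContinuousOn.intervalIntegrable
    rw [uIcc_of_le zero_le_one]
    exact (hc.clm_apply continuousOn_const).clm_apply continuousOn_const
  have happ : ∀ u v : E4, (∫ t in (0 : ℝ)..1, linkFormDeriv h Y x t) u v =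
      ∫ t in (0 : ℝ)..1, linkFormDeriv h Y x t u v := by
    intro u v
    rw [ContinuousLinearMap.intervalIntegral_apply hi, ContinuousLinearMap.intervalIntegral_apply]
    apply ContinuousOn.intervalIntegrable
    rw [uIcc_of_le zero_le_one]
    exact hc.clm_apply continuousOn_const
  rw [happ, happ, ← sub_eq_zero, ← intervalIntegral.integral_sub (hi' _ _) (hi' _ _)]
  -- The antisymmetrised derivative is a total t-derivative, so its integral over the closed curve
  -- vanishes.
  have hd : ∀ t ∈ uIcc (0 : ℝ) 1, HasDerivAt (fun t => kerB h (x, Y t) * det4 x (Y t) u v)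
      (linkFormDeriv h Y x t u v - linkFormDeriv h Y x t v u) t := by
    intro t _
    have h1 : HasDerivAt (fun t => kerB h (x, Y t)) (-kerg h (x, Y t) (deriv Y t)) t := by
      have := (hh.hasFDerivAt_kerB (hx t)).comp_hasDerivAt t (hY.hasDerivAt t)
      exact this
    have h2 : HasDerivAt (fun t => det4 x (Y t) u v) (det4 x (deriv Y t) u v) t := by
      have e : ∀ y : E4, det4 x y u v = det4L u x v y := by
        intro y; simp [det4]; ring
      simp only [e]
      exact ((det4L u x v).hasFDerivAt).comp_hasDerivAt t (hY.hasDerivAt t)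
    refine (h1.mul h2).congr_deriv ?_
    -- Five vectors in 4-space are dependent. Applying the gradient of `kerG` to this relation gives
    -- the required identity once its values on x and Y(t) are known.
    have c := cramer_det4 (kerg h (x, Y t)) x (Y t) u v (deriv Y t)
    have g1 := hh.kerg_left (hx t)
    have g2 := hh.kerg_right (hx t)
    simp only at g1 g2
    rw [g1, g2] at c
    have d1 : det4 x (deriv Y t) u v = det4 x u v (deriv Y t) := by simp [det4]; ring
    have d2 : det4 u (Y t) v (deriv Y t) = - det4 (Y t) u v (deriv Y t) := by simp [det4]; ring
    have d3 : det4 v (Y t) u (deriv Y t) = det4 (Y t) u v (deriv Y t) := by simp [det4]; ring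
    simp only [linkFormDeriv, add_apply, smul_apply,
      ContinuousLinearMap.smulRight_apply, det4LL_apply, det4L_apply, smul_eq_mul]
    rw [d1, d2, d3]
    linarith
  rw [intervalIntegral.integral_eq_sub_of_hasDerivAt hd ((hi' _ _).sub (hi' _ _))]
  have := hY.periodic 0
  rw [zero_add] at this
  rw [this, sub_self]

/-- The 1-form `η` is exact near each point of `U`. -/
def LocallyExact (η : E4 → E4 →L[ℝ] ℝ) (U : Set E4) : Prop :=
  ∀ x ∈ U, ∃ f : E4 → ℝ, ∀ᶠ y in 𝓝 x, HasFDerivAt f (η y) y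

include hh hY in
-- The Poincaré lemma for a closed form, on a ball inside the open set `coneCompl Y`.
theorem locallyExact_linkForm : LocallyExact (linkForm h Y) (coneCompl Y) := by
  intro x hx
  obtain ⟨ε, hε, hb⟩ := Metric.isOpen_iff.1 (isOpen_coneCompl hY) x hx
  obtain ⟨f, hf⟩ : ∃ f : E4 → ℝ, ∀ a ∈ Metric.ball x ε, HasFDerivAt f (linkForm h Y a) a :=
    (convex_ball x ε).exists_forall_hasFDerivAt_of_fderiv_symmetric Metric.isOpen_ball
    (fun y hy => (hasFDerivAt_linkForm hh hY (hb hy)).differentiableAt.differentiableWithinAt)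
    (fun y hy u v => by
      rw [(hasFDerivAt_linkForm hh hY (hb hy)).fderiv]
      exact linkFormDeriv_symm hh hY (hb hy) u v)
  exact ⟨f, by filter_upwards [Metric.ball_mem_nhds x hε] with y hy using hf y hy⟩

include hh hY in
theorem continuousOn_linkForm : ContinuousOn (linkForm h Y) (coneCompl Y) :=
  continuousOn_intervalIntegral_param (isOpen_coneCompl hY) (continuousOn_linkForm_integrand hh hY)

end LinkForm

/-! ### Primitives of a locally exact form along a map -/

/-- On `S`, the function `F` is a primitive of the form `η` pulled back by the map `D`: locally it
is the composition of `D` with a primitive of `η`. -/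
def PrimitiveOn {α : Type*} [TopologicalSpace α] (η : E4 → E4 →L[ℝ] ℝ) (D : α → E4) (F : α → ℝ)
    (S : Set α) : Prop :=
  ∀ a ∈ S, ∃ f : E4 → ℝ, (∀ᶠ y in 𝓝 (D a), HasFDerivAt f (η y) y) ∧ ∀ᶠ b in 𝓝[S] a, F b = f (D b)

section Primitive

variable {α β : Type*} [TopologicalSpace α] [TopologicalSpace β] {η : E4 → E4 →L[ℝ] ℝ}

theorem PrimitiveOn.mono {D : α → E4} {F : α → ℝ} {S T : Set α} (hF : PrimitiveOn η D F S)
    (hT : T ⊆ S) : PrimitiveOn η D F T := fun a ha =>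
  let ⟨f, h1, h2⟩ := hF a (hT ha)
  ⟨f, h1, h2.filter_mono (nhdsWithin_mono a hT)⟩

theorem PrimitiveOn.comp {D : α → E4} {F : α → ℝ} {S : Set α} (hF : PrimitiveOn η D F S)
    {φ : β → α} {T : Set β} (hφ : ContinuousOn φ T) (hT : MapsTo φ T S) :
    PrimitiveOn η (D ∘ φ) (F ∘ φ) T := fun b hb =>
  let ⟨f, h1, h2⟩ := hF (φ b) (hT hb)
  ⟨f, h1, ((hφ b hb).tendsto_nhdsWithin hT).eventually h2⟩

theorem PrimitiveOn.congr_map {D D' : α → E4} {F : α → ℝ} {S : Set α} (hF : PrimitiveOn η D F S)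
    (h : EqOn D D' S) : PrimitiveOn η D' F S := fun a ha => by
  obtain ⟨f, h1, h2⟩ := hF a ha
  refine ⟨f, h ha ▸ h1, ?_⟩
  filter_upwards [h2, self_mem_nhdsWithin] with b hb hS
  rw [hb, h hS]

theorem eventually_sub_eq_const {f g : E4 → ℝ} {x : E4}
    (hf : ∀ᶠ y in 𝓝 x, HasFDerivAt f (η y) y) (hg : ∀ᶠ y in 𝓝 x, HasFDerivAt g (η y) y) :
    ∀ᶠ y in 𝓝 x, f y - g y = f x - g x := by
  obtain ⟨ε, hε, hb⟩ := Metric.eventually_nhds_iff_ball.1 (hf.and hg)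
  filter_upwards [Metric.ball_mem_nhds x hε] with y hy
  refine (convex_ball x ε).is_const_of_fderivWithin_eq_zero (𝕜 := ℝ) (f := fun y => f y - g y)
    (fun z hz => ((hb z hz).1.sub (hb z hz).2).differentiableAt.differentiableWithinAt)
    (fun z hz => ?_) hy (Metric.mem_ball_self hε)
  have := ((hb z hz).1.sub (hb z hz).2).hasFDerivWithinAt (s := Metric.ball x ε)
  rw [sub_self] at this
  exact this.fderivWithin (Metric.isOpen_ball.uniqueDiffOn z hz)

/-- Two primitives along the same map differ by a constant on connected sets. -/
theorem PrimitiveOn.sub_eq_const {D : α → E4} {F G : α → ℝ} {S : Set α} (hS : IsPreconnected S)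
    (hD : ContinuousOn D S) (hF : PrimitiveOn η D F S) (hG : PrimitiveOn η D G S) {a b : α}
    (ha : a ∈ S) (hb : b ∈ S) : F a - G a = F b - G b := by
  have := isPreconnected_iff_preconnectedSpace.1 hS
  have hl : IsLocallyConstant fun a : S => F a - G a := by
    rw [IsLocallyConstant.iff_eventually_eq]
    rintro ⟨a, ha⟩
    rw [eventually_nhds_subtype_iff S ⟨a, ha⟩ fun b => F b - G b = F a - G a]
    obtain ⟨f, f1, f2⟩ := hF a ha
    obtain ⟨g, g1, g2⟩ := hG a ha
    have h3 := (hD a ha).eventually (eventually_sub_eq_const f1 g1)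
    have h4 := f2.self_of_nhdsWithin ha
    have h5 := g2.self_of_nhdsWithin ha
    filter_upwards [f2, g2, h3] with b e1 e2 e3
    rw [e1, e2, h4, h5, e3]
  exact hl.apply_eq_of_preconnectedSpace ⟨a, ha⟩ ⟨b, hb⟩

end Primitive

end

end KnotTheory

/-! ### Primitives over the unit square and along differentiable curves. -/

namespace KnotTheory

noncomputable section

section Square

variable {α : Type*} [TopologicalSpace α] {η : E4 → E4 →L[ℝ] ℝ}

/-- Primitives on two closed sets with a connected intersection can be glued. -/
theorem PrimitiveOn.exists_union {D : α → E4} {F G : α → ℝ} {S T : Set α} (hS : IsClosed S)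
    (hT : IsClosed T) (hST : IsPreconnected (S ∩ T)) (hD : ContinuousOn D (S ∪ T))
    (hF : PrimitiveOn η D F S) (hG : PrimitiveOn η D G T) :
    ∃ H, PrimitiveOn η D H (S ∪ T) := by
  classical
  obtain ⟨k, hk⟩ : ∃ k, ∀ a ∈ S ∩ T, F a = G a + k := by
    rcases (S ∩ T).eq_empty_or_nonempty with h | ⟨c, hc⟩
    · exact ⟨0, fun a ha => by simp [h] at ha⟩
    · refine ⟨F c - G c, fun a ha => ?_⟩
      have := (hF.mono inter_subset_left).sub_eq_const hST
        (hD.mono (inter_subset_left.trans subset_union_left)) (hG.mono inter_subset_right) ha hc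
      linarith
  have hHS : ∀ a ∈ S, S.piecewise F (fun a => G a + k) a = F a := fun a ha =>
    piecewise_eq_of_mem _ _ _ ha
  have hHT : ∀ a ∈ T, S.piecewise F (fun a => G a + k) a = G a + k := fun a ha => by
    by_cases h : a ∈ S
    · rw [hHS a h, hk a ⟨h, ha⟩]
    · exact piecewise_eq_of_notMem _ _ _ h
  refine ⟨S.piecewise F (fun a => G a + k), fun a ha => ?_⟩
  by_cases haS : a ∈ S
  · obtain ⟨f, f1, f2⟩ := hF a haS
    refine ⟨f, f1, ?_⟩
    rw [nhdsWithin_union, eventually_sup]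
    constructor
    · filter_upwards [f2, self_mem_nhdsWithin] with b hb hbS
      rw [hHS b hbS, hb]
    · by_cases haT : a ∈ T
      · obtain ⟨g, g1, g2⟩ := hG a haT
        have h3 := ((hD.mono subset_union_right) a haT).eventually (eventually_sub_eq_const f1 g1)
        have e1 := f2.self_of_nhdsWithin haS
        have e2 := g2.self_of_nhdsWithin haT
        have e3 := hk a ⟨haS, haT⟩
        filter_upwards [g2, h3, self_mem_nhdsWithin] with b hb hb' hbT
        rw [hHT b hbT, hb]
        linarith
      · rw [notMem_closure_iff_nhdsWithin_eq_bot.1 (by rwa [hT.closure_eq])]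
        exact eventually_bot
  · have haT : a ∈ T := ha.resolve_left haS
    obtain ⟨g, g1, g2⟩ := hG a haT
    refine ⟨fun y => g y + k, g1.mono fun y hy => hy.add_const k, ?_⟩
    rw [nhdsWithin_union, notMem_closure_iff_nhdsWithin_eq_bot.1 (by rwa [hS.closure_eq]), bot_sup_eq]
    filter_upwards [g2, self_mem_nhdsWithin] with b hb hbT
    rw [hHT b hbT, hb]

/-- An additive property of intervals which holds for small intervals holds for `[0, 1]`. -/
theorem unitInterval_induction {q : ℝ → ℝ → Prop}
    (hadd : ∀ a b c, 0 ≤ a → a ≤ b → b ≤ c → c ≤ 1 → q a b → q b c → q a c)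
    (hloc : ∀ x ∈ Icc (0 : ℝ) 1, ∃ ε > 0, ∀ a b, 0 ≤ a → a ≤ b → b ≤ 1 → x - ε < a → b < x + ε →
      q a b) : q 0 1 := by
  choose! ε hε hq using hloc
  obtain ⟨δ, hδ, hb⟩ := lebesgue_number_lemma_of_metric (s := Icc (0 : ℝ) 1)
    (c := fun x : Icc (0 : ℝ) 1 => Metric.ball (x : ℝ) (ε x)) isCompact_Icc
    (fun _ => Metric.isOpen_ball)
    (fun x hx => mem_iUnion.2 ⟨⟨x, hx⟩, Metric.mem_ball_self (hε x hx)⟩)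
  obtain ⟨n, hn⟩ := exists_nat_one_div_lt hδ
  have hn0 : (0 : ℝ) < n + 1 := by positivity
  have small : ∀ a b, 0 ≤ a → a ≤ b → b ≤ 1 → b - a < δ → q a b := by
    intro a b h0 hab h1 hd
    obtain ⟨x, hx⟩ := hb a ⟨h0, hab.trans h1⟩
    have e1 := hx (Metric.mem_ball_self hδ)
    have e2 := hx (show b ∈ Metric.ball a δ by rw [Metric.mem_ball, Real.dist_eq, abs_of_nonneg] <;>
      linarith)
    rw [Metric.mem_ball, Real.dist_eq, abs_lt] at e1 e2
    exact hq x x.2 a b h0 hab h1 (by linarith) (by linarith)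
  have step : ∀ k : ℕ, (k : ℝ) ≤ n + 1 → q 0 (k / (n + 1)) := by
    intro k
    induction k with
    | zero => intro _; simpa using small 0 0 le_rfl le_rfl zero_le_one (by simpa)
    | succ k ih =>
      intro hk
      push_cast at hk ⊢
      refine hadd 0 (k / (n + 1)) _ le_rfl (by positivity) (by gcongr; linarith)
        (by rw [div_le_one hn0]; exact hk) (ih (by linarith)) (small _ _ (by positivity)
          (by gcongr; linarith) (by rw [div_le_one hn0]; exact hk) ?_)
      rw [← sub_div]
      simpa using hn
  have := step (n + 1) (by push_cast; exact le_rfl)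
  push_cast at this
  rwa [div_self hn0.ne'] at this

/-- A locally exact form pulled back to the square by a continuous map has a primitive. -/
theorem LocallyExact.exists_primitiveOn_square {U : Set E4} (hη : LocallyExact η U)
    {D : ℝ × ℝ → E4} (hD : ContinuousOn D unitSquare) (hDU : MapsTo D unitSquare U) :
    ∃ F, PrimitiveOn η D F unitSquare := by
  have hsub : ∀ {a b c d : ℝ}, 0 ≤ a → b ≤ 1 → 0 ≤ c → d ≤ 1 →
      Icc a b ×ˢ Icc c d ⊆ unitSquare := fun ha hb hc hd =>
    prod_mono (Icc_subset_Icc ha hb) (Icc_subset_Icc hc hd)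
  have loc : ∀ p ∈ unitSquare, ∃ ε > 0, ∀ R ⊆ unitSquare, R ⊆ Metric.ball p ε →
      ∃ F, PrimitiveOn η D F R := by
    intro p hp
    obtain ⟨f, hf⟩ := hη (D p) (hDU hp)
    have h1 := (hD p hp).eventually (eventually_eventually_nhds.2 hf)
    obtain ⟨ε, hε, hb⟩ := Metric.mem_nhdsWithin_iff.1 h1
    exact ⟨ε, hε, fun R hR hRb => ⟨f ∘ D, fun a ha => ⟨f, hb ⟨hRb ha, hR ha⟩, by simp⟩⟩⟩
  -- Small rectangles are glued along vertical edges into a thin horizontal strip, with the height ε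
  -- shrinking at each gluing; the strips are then glued along horizontal edges. The overlaps are
  -- segments, hence connected.
  have strip : ∀ y ∈ Icc (0 : ℝ) 1, ∃ ε > 0, ∀ c d, 0 ≤ c → c ≤ d → d ≤ 1 → y - ε < c → d < y + ε →
      ∃ F, PrimitiveOn η D F (Icc 0 1 ×ˢ Icc c d) := by
    intro y hy
    refine unitInterval_induction (q := fun a b => ∃ ε > 0, ∀ c d, 0 ≤ c → c ≤ d → d ≤ 1 →
      y - ε < c → d < y + ε → ∃ F, PrimitiveOn η D F (Icc a b ×ˢ Icc c d)) ?_ ?_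
    · rintro a b c h0 hab hbc h1 ⟨ε, hε, h⟩ ⟨ε', hε', h'⟩
      refine ⟨min ε ε', lt_min hε hε', fun u v hu huv hv huy hvy => ?_⟩
      have m1 := min_le_left ε ε'
      have m2 := min_le_right ε ε'
      obtain ⟨F, hF⟩ := h u v hu huv hv (by linarith) (by linarith)
      obtain ⟨G, hG⟩ := h' u v hu huv hv (by linarith) (by linarith)
      have hun : Icc a c ×ˢ Icc u v = Icc a b ×ˢ Icc u v ∪ Icc b c ×ˢ Icc u v := by
        rw [← union_prod, Icc_union_Icc_eq_Icc hab hbc]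
      rw [hun]
      refine hF.exists_union (isClosed_Icc.prod isClosed_Icc) (isClosed_Icc.prod isClosed_Icc) ?_
        (hD.mono ?_) hG
      · rw [← inter_prod]
        refine IsPreconnected.prod ?_ isPreconnected_Icc
        rw [Icc_inter_Icc]
        exact isPreconnected_Icc
      · rw [← hun]; exact hsub h0 h1 hu hv
    · intro x hx
      obtain ⟨ε, hε, h⟩ := loc (x, y) ⟨hx, hy⟩
      refine ⟨ε, hε, fun a b h0 hab h1 hxa hbx => ⟨ε, hε, fun c d hc hcd hd hyc hdy =>
        h _ (hsub h0 h1 hc hd) ?_⟩⟩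
      rintro ⟨u, v⟩ ⟨hu, hv⟩
      rw [Metric.mem_ball, Prod.dist_eq, max_lt_iff, Real.dist_eq, Real.dist_eq, abs_lt, abs_lt]
      simp only [mem_Icc] at hu hv
      refine ⟨⟨?_, ?_⟩, ⟨?_, ?_⟩⟩ <;> linarith
  refine unitInterval_induction (q := fun c d => ∃ F, PrimitiveOn η D F (Icc 0 1 ×ˢ Icc c d)) ?_
    strip
  rintro a b c h0 hab hbc h1 ⟨F, hF⟩ ⟨G, hG⟩
  have hun : Icc (0 : ℝ) 1 ×ˢ Icc a c = Icc 0 1 ×ˢ Icc a b ∪ Icc 0 1 ×ˢ Icc b c := by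
    rw [← prod_union, Icc_union_Icc_eq_Icc hab hbc]
  rw [hun]
  refine hF.exists_union (isClosed_Icc.prod isClosed_Icc) (isClosed_Icc.prod isClosed_Icc) ?_
    (hD.mono ?_) hG
  · rw [← prod_inter]
    refine isPreconnected_Icc.prod ?_
    rw [Icc_inter_Icc]
    exact isPreconnected_Icc
  · rw [← hun]; exact hsub le_rfl le_rfl h0 h1

/-- The integral of a form along a continuously differentiable curve is a primitive. -/
theorem primitiveOn_integral {U : Set E4} (hη : LocallyExact η U) (hc : ContinuousOn η U)
    {X : ℝ → E4} (hX : ContDiff ℝ 1 X) (hXU : ∀ t, X t ∈ U) :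
    PrimitiveOn η X (fun s => ∫ t in (0 : ℝ)..s, η (X t) (deriv X t)) univ := by
  have hcont : Continuous fun t => η (X t) (deriv X t) :=
    (hc.comp_continuous hX.continuous hXU).clm_apply (hX.continuous_deriv le_rfl)
  intro s _
  obtain ⟨f, hf⟩ := hη (X s) (hXU s)
  set F : ℝ → ℝ := fun s => ∫ t in (0 : ℝ)..s, η (X t) (deriv X t)
  have hF : ∀ s, HasDerivAt F (η (X s) (deriv X s)) s := fun s =>
    (hcont.integral_hasStrictDerivAt 0 s).hasDerivAt
  -- The local primitive is shifted to agree with F at s; they stay equal along X nearby because F -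
  -- f ∘ X has zero derivative.
  refine ⟨fun y => f y + (F s - f (X s)), hf.mono fun y hy => hy.add_const _, ?_⟩
  rw [nhdsWithin_univ]
  obtain ⟨ε, hε, hb⟩ := Metric.eventually_nhds_iff_ball.1 (hX.continuous.continuousAt.eventually hf)
  filter_upwards [Metric.ball_mem_nhds s hε] with b hbε
  have hd : ∀ t ∈ Metric.ball s ε, HasDerivAt (fun t => F t - f (X t)) 0 t := by
    intro t ht
    have := (hF t).sub ((hb t ht).comp_hasDerivAt t
      (hX.differentiable one_ne_zero t).hasDerivAt)
    rwa [sub_self] at this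
  have := (convex_ball s ε).is_const_of_fderivWithin_eq_zero (𝕜 := ℝ)
    (f := fun t => F t - f (X t))
    (fun z hz => (hd z hz).differentiableAt.differentiableWithinAt)
    (fun z hz => by
      rw [fderivWithin_of_isOpen Metric.isOpen_ball hz]
      ext
      simp [(hd z hz).deriv]) hbε (Metric.mem_ball_self hε)
  linarith

end Square

end

end KnotTheory

/-! ### The linking integral: symmetry and homotopy invariance. -/

namespace KnotTheory

noncomputable section

/-- The linking integral of two closed curves, with kernel `h`. -/
def linkInt (h : E4 → ℝ) (X Y : ℝ → E4) : ℝ :=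
  ∫ s in (0 : ℝ)..1, linkForm h Y (X s) (deriv X s)

/-- No point of the first curve lies on a closed ray through a point of the second. -/
def IndepCurves (X Y : ℝ → E4) : Prop := ∀ s t, (X s, Y t) ∈ indepPairs

theorem swap_mem_indepPairs {x y : E4} (hp : (x, y) ∈ indepPairs) : (y, x) ∈ indepPairs := by
  intro r hr h0
  refine hp (1 - r) ⟨by linarith [hr.2], by linarith [hr.1]⟩ ?_
  simp only at h0 ⊢
  rw [← neg_eq_zero, ← h0]
  module

theorem IndepCurves.symm {X Y : ℝ → E4} (h : IndepCurves X Y) : IndepCurves Y X :=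
  fun s t => swap_mem_indepPairs (h t s)

theorem IsKernel.comp_neg {h : E4 → ℝ} (hh : IsKernel h) : IsKernel fun v => h (-v) where
  smooth := hh.smooth.comp contDiff_neg.contDiffOn fun v hv => by simpa using hv
  euler v hv := by
    have h1 := hh.hasFDerivAt (neg_ne_zero.2 hv)
    have h2 : HasFDerivAt (fun v => h (-v))
        ((fderiv ℝ h (-v)).comp (-ContinuousLinearMap.id ℝ E4)) v :=
      h1.comp v (hasFDerivAt_id v).neg
    rw [h2.fderiv, ← hh.euler (-v) (neg_ne_zero.2 hv)]
    simp

/-- The substitution r ↦ 1 - r preserves the weight r(1 - r) and turns the segment from x to -y into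
the negative of the segment from y to -x. -/
theorem kerG_swap (h : E4 → ℝ) (x y : E4) : kerG h (x, y) = kerG (fun v => h (-v)) (y, x) := by
  unfold kerG segInt
  have := intervalIntegral.integral_comp_sub_left (a := 0) (b := 1)
    (fun r => r * (1 - r) * h ((1 - r) • x - r • y)) 1
  rw [sub_self, sub_zero] at this
  rw [← this]
  congr 1
  funext r
  have e : (1 - (1 - r)) • x - (1 - r) • y = -((1 - r) • y - r • x) := by module
  simp only [e]
  ring

section

variable {h : E4 → ℝ} (hh : IsKernel h) {X X' Y : ℝ → E4} (hX : IsLoop X) (hX' : IsLoop X')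
  (hY : IsLoop Y)

include hh hX hY in
theorem continuous_linkInt_integrand (hXY : IndepCurves X Y) :
    Continuous fun z : ℝ × ℝ =>
      kerG h (X z.1, Y z.2) * det4 (X z.1) (Y z.2) (deriv X z.1) (deriv Y z.2) := by
  have h1 := hX.continuous
  have h2 := hY.continuous
  have h3 := hX.continuous_deriv
  have h4 := hY.continuous_deriv
  refine Continuous.mul ?_ (by fun_prop)
  exact hh.continuousOn_kerG.comp_continuous (f := fun z : ℝ × ℝ => (X z.1, Y z.2))
    (by fun_prop) fun z => hXY _ _

include hh hY in
theorem linkInt_eq (hXY : IndepCurves X Y) : linkInt h X Y = ∫ s in (0 : ℝ)..1, ∫ t in (0 : ℝ)..1,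
    kerG h (X s, Y t) * det4 (X s) (Y t) (deriv X s) (deriv Y t) := by
  unfold linkInt linkForm
  congr 1
  funext s
  rw [ContinuousLinearMap.intervalIntegral_apply
    (intervalIntegrable_section (continuousOn_linkForm_integrand hh hY) (hXY s))]
  rfl

include hh hX hY in
-- Fubini. Passing from (X, Y, X', Y') to (Y, X, Y', X') is an even permutation, so no sign arises
-- and only the kernel is reflected.
theorem linkInt_swap (hXY : IndepCurves X Y) :
    linkInt h X Y = linkInt (fun v => h (-v)) Y X := by
  rw [linkInt_eq hh hY hXY, linkInt_eq hh.comp_neg hX hXY.symm,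
    intervalIntegral_intervalIntegral_swap]
  · congr 1
    funext t
    congr 1
    funext s
    rw [kerG_swap]
    congr 1
    simp [det4]; ring
  · have := (continuous_linkInt_integrand hh hX hY hXY).continuousOn.integrableOn_compact
      (μ := volume) (isCompact_Icc.prod isCompact_Icc : IsCompact (Icc (0 : ℝ) 1 ×ˢ Icc (0 : ℝ) 1))
    refine this.mono_set ?_
    rw [uIoc_of_le zero_le_one]
    exact prod_mono Ioc_subset_Icc_self Ioc_subset_Icc_self

include hh hX hX' hY in
/-- The linking integral does not change if the first curve is moved in the complement of the cone
over the second. -/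
theorem linkInt_eq_of_segment (hs : ∀ s, segment ℝ (X s) (X' s) ⊆ coneCompl Y) :
    linkInt h X Y = linkInt h X' Y := by
  have hη := locallyExact_linkForm hh hY
  have hc := continuousOn_linkForm hh hY
  have c1 := hX.continuous
  have c2 := hX'.continuous
  let D : ℝ × ℝ → E4 := fun p => (1 - p.1) • X p.2 + p.1 • X' p.2
  have hD : Continuous D := by fun_prop
  obtain ⟨F, hF⟩ := hη.exists_primitiveOn_square hD.continuousOn (fun p hp =>
    hs p.2 ⟨1 - p.1, p.1, by linarith [hp.1.2], hp.1.1, by ring, rfl⟩)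
  have mem : ∀ {u v : ℝ}, u ∈ Icc (0 : ℝ) 1 → v ∈ Icc (0 : ℝ) 1 → (u, v) ∈ unitSquare :=
    fun hu hv => ⟨hu, hv⟩
  have h0 : (0 : ℝ) ∈ Icc (0 : ℝ) 1 := by simp
  have h1 : (1 : ℝ) ∈ Icc (0 : ℝ) 1 := by simp
  have left := hF.comp (φ := fun s : ℝ => ((0 : ℝ), s)) (T := Icc 0 1) (by fun_prop)
    fun s hs => mem h0 hs
  have right := hF.comp (φ := fun s : ℝ => ((1 : ℝ), s)) (T := Icc 0 1) (by fun_prop)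
    fun s hs => mem h1 hs
  have bot := hF.comp (φ := fun s : ℝ => (s, (0 : ℝ))) (T := Icc 0 1) (by fun_prop)
    fun s hs => mem hs h0
  have top := hF.comp (φ := fun s : ℝ => (s, (1 : ℝ))) (T := Icc 0 1) (by fun_prop)
    fun s hs => mem hs h1
  have pX : ∀ s, X s ∈ coneCompl Y := fun s => hs s (left_mem_segment ℝ _ _)
  have pX' : ∀ s, X' s ∈ coneCompl Y := fun s => hs s (right_mem_segment ℝ _ _)
  have i0 := (primitiveOn_integral hη hc hX.contDiff pX).mono (subset_univ (Icc (0 : ℝ) 1))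
  have i1 := (primitiveOn_integral hη hc hX'.contDiff pX').mono (subset_univ (Icc (0 : ℝ) 1))
  have e0 : D ∘ (fun s : ℝ => ((0 : ℝ), s)) = X := by funext s; simp [D]
  have e1 : D ∘ (fun s : ℝ => ((1 : ℝ), s)) = X' := by funext s; simp [D]
  -- Both curves close up, so the two sides of the square run through by the homotopy parameter
  -- carry the same path. Their contributions cancel, and the other two sides give the two
  -- integrals.
  have e2 : D ∘ (fun s : ℝ => (s, (1 : ℝ))) = D ∘ (fun s : ℝ => (s, (0 : ℝ))) := by
    funext s
    have p1 := hX.periodic 0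
    have p2 := hX'.periodic 0
    rw [zero_add] at p1 p2
    simp [D, p1, p2]
  rw [e0] at left
  rw [e1] at right
  rw [e2] at top
  have q1 := i0.sub_eq_const isPreconnected_Icc c1.continuousOn left h0 h1
  have q2 := i1.sub_eq_const isPreconnected_Icc c2.continuousOn right h0 h1
  have q3 := top.sub_eq_const isPreconnected_Icc (by fun_prop) bot h0 h1
  simp only [intervalIntegral.integral_same, Function.comp] at q1 q2 q3
  unfold linkInt
  linarith

end

/-- The linking integral is invariant under a homotopy of pairs of curves. -/
theorem linkInt_eq_of_homotopy {h : E4 → ℝ} (hh : IsKernel h) {T : Type*} [TopologicalSpace T]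
    [PreconnectedSpace T] {X Y : T → ℝ → E4} (cX : Continuous (Function.uncurry X))
    (cY : Continuous (Function.uncurry Y)) (hX : ∀ τ, IsLoop (X τ)) (hY : ∀ τ, IsLoop (Y τ))
    (hXY : ∀ τ, IndepCurves (X τ) (Y τ)) (τ τ' : T) :
    linkInt h (X τ) (Y τ) = linkInt h (X τ') (Y τ') := by
  suffices hl : IsLocallyConstant fun τ => linkInt h (X τ) (Y τ) from
    hl.apply_eq_of_preconnectedSpace τ τ'
  rw [IsLocallyConstant.iff_eventually_eq]
  intro τ₀
  have close : ∀ Z : T → ℝ → E4, Continuous (Function.uncurry Z) → (∀ τ, IsLoop (Z τ)) →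
      ∀ δ > 0, ∀ᶠ τ in 𝓝 τ₀, ∀ s, dist (Z τ s) (Z τ₀ s) < δ := by
    intro Z cZ hZ δ hδ
    have key : ∀ s ∈ Icc (0 : ℝ) 1, ∀ᶠ z : T × ℝ in 𝓝 (τ₀, s), dist (Z z.1 z.2) (Z τ₀ z.2) < δ := by
      intro s _
      have c : Continuous fun z : T × ℝ => dist (Z z.1 z.2) (Z τ₀ z.2) :=
        cZ.dist (cZ.comp (f := fun z : T × ℝ => (τ₀, z.2)) (by fun_prop))
      exact c.continuousAt.eventually_lt_const (by simpa using hδ)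
    filter_upwards [isCompact_Icc.eventually_forall_of_forall_eventually
      (P := fun (τ : T) (s : ℝ) => dist (Z τ s) (Z τ₀ s) < δ) key] with τ hτ s
    have per : Function.Periodic (fun s => dist (Z τ s) (Z τ₀ s)) 1 := fun s => by
      simp only [(hZ τ).periodic s, (hZ τ₀).periodic s]
    obtain ⟨s', hs', e⟩ := periodic_exists_mem_Icc per s
    rw [e]
    exact hτ s' hs'
  have c1 := (hX τ₀).continuous
  have c2 := (hY τ₀).continuous
  -- The pairs of points at time τ₀ form a compact subset of the open set `indepPairs`, so all pairs
  -- δ-close to them are independent as well.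
  obtain ⟨δ, hδ, hb⟩ := ((isCompact_Icc.prod isCompact_Icc :
      IsCompact (Icc (0 : ℝ) 1 ×ˢ Icc (0 : ℝ) 1)).image
      (f := fun z : ℝ × ℝ => (X τ₀ z.1, Y τ₀ z.2)) (by fun_prop)).exists_thickening_subset_open
      isOpen_indepPairs (by rintro _ ⟨z, _, rfl⟩; exact hXY τ₀ _ _)
  have near : ∀ x y s t, dist x (X τ₀ s) < δ → dist y (Y τ₀ t) < δ → (x, y) ∈ indepPairs := by
    intro x y s t hx hy
    obtain ⟨s', hs', e1⟩ := periodic_exists_mem_Icc (hX τ₀).periodic s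
    obtain ⟨t', ht', e2⟩ := periodic_exists_mem_Icc (hY τ₀).periodic t
    refine hb (Metric.mem_thickening_iff.2 ⟨_, ⟨(s', t'), ⟨hs', ht'⟩, rfl⟩, ?_⟩)
    rw [Prod.dist_eq]
    exact max_lt (by rw [e1] at hx; exact hx) (by rw [e2] at hy; exact hy)
  have seg : ∀ {a b c : E4}, dist a c < δ → dist b c < δ → ∀ x ∈ segment ℝ a b, dist x c < δ :=
    fun ha hb x hx => (convex_ball _ δ).segment_subset ha hb hx
  filter_upwards [close X cX hX δ hδ, close Y cY hY δ hδ] with τ tX tY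
  have self : ∀ Z : ℝ → E4, ∀ s, dist (Z s) (Z s) < δ := fun Z s => by simpa using hδ
  have i1 : IndepCurves (X τ₀) (Y τ) := fun s t => near _ _ s t (self _ s) (tY t)
  -- The first curve is moved while the second stays at time τ; after exchanging the roles, the
  -- second curve is moved against the first at time τ₀.
  rw [linkInt_eq_of_segment hh (hX τ) (hX τ₀) (hY τ) fun s x hx t =>
      near _ _ s t (seg (tX s) (self _ s) x hx) (tY t),
    linkInt_swap hh (hX τ₀) (hY τ) i1, linkInt_swap hh (hX τ₀) (hY τ₀) (hXY τ₀)]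
  exact linkInt_eq_of_segment hh.comp_neg (hY τ) (hY τ₀) (hX τ₀) fun t y hy s =>
    swap_mem_indepPairs (near _ _ s t (self _ s) (seg (tY t) (self _ t) y hy))

/-! ### Linear maps -/

/-- The linear map of 4-space with the matrix `M`. -/
def matMap (M : Matrix (Fin 4) (Fin 4) ℝ) : E4 →L[ℝ] E4 :=
  LinearMap.toContinuousLinearMap
    { toFun := fun x => WithLp.toLp 2 (M.mulVec x.ofLp)
      map_add' := by intro x y; simp [Matrix.mulVec_add]
      map_smul' := by intro c x; simp [Matrix.mulVec_smul] }

theorem matMap_apply (M : Matrix (Fin 4) (Fin 4) ℝ) (x : E4) :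
    matMap M x = WithLp.toLp 2 (M.mulVec x.ofLp) := rfl

theorem IsLoop.matMap {X : ℝ → E4} (hX : IsLoop X) (M : Matrix (Fin 4) (Fin 4) ℝ) :
    IsLoop fun t => matMap M (X t) where
  periodic t := by simp only [hX.periodic t]
  contDiff := (KnotTheory.matMap M).contDiff.comp hX.contDiff

theorem mem_indepPairs_matMap {M : Matrix (Fin 4) (Fin 4) ℝ} (hM : ∀ v, matMap M v = 0 → v = 0)
    {x y : E4} (h : (x, y) ∈ indepPairs) : (matMap M x, matMap M y) ∈ indepPairs := by
  intro r hr h0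
  refine h r hr (hM _ ?_)
  simpa using h0

/-- A linear map carries chords to chords, so it acts on the kernel by composition; the determinant
of four vectors produces the factor. -/
theorem linkInt_matMap {h h' : E4 → ℝ} (hh : IsKernel h) (hh' : IsKernel h')
    {M : Matrix (Fin 4) (Fin 4) ℝ} (hM : ∀ v, matMap M v = 0 → v = 0)
    (e : ∀ v, h (matMap M v) = h' v) {X Y : ℝ → E4} (hX : IsLoop X) (hY : IsLoop Y)
    (hXY : IndepCurves X Y) :
    linkInt h (fun t => matMap M (X t)) (fun t => matMap M (Y t)) = M.det * linkInt h' X Y := by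
  rw [linkInt_eq hh (hY.matMap M) fun s t => mem_indepPairs_matMap hM (hXY s t),
    linkInt_eq hh' hY hXY, ← intervalIntegral.integral_const_mul]
  congr 1
  funext s
  rw [← intervalIntegral.integral_const_mul]
  congr 1
  funext t
  have d : ∀ {Z : ℝ → E4}, IsLoop Z → ∀ t, deriv (fun t => matMap M (Z t)) t =
      matMap M (deriv Z t) := fun hZ t =>
    ((matMap M).hasFDerivAt.comp_hasDerivAt t (hZ.hasDerivAt t)).deriv
  rw [d hX, d hY]
  simp only [matMap_apply]
  rw [det4_mulVec]
  have : kerG h (WithLp.toLp 2 (M.mulVec (X s).ofLp), WithLp.toLp 2 (M.mulVec (Y t).ofLp)) =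
      kerG h' (X s, Y t) := by
    unfold kerG segInt
    congr 1
    funext r
    simp only [← matMap_apply, ← map_smul, ← map_sub, e]
  rw [this]
  ring

end

end KnotTheory

namespace KnotTheory

noncomputable section

/-! ### Kernels concentrated near a direction -/

/-- The kernel with angular profile `θ` around the direction `u`. -/
def coneKernel (θ : ℝ → ℝ) (u v : E4) : ℝ := θ (inner ℝ u v / ‖v‖) / ‖v‖ ^ 4

theorem coneKernel_smul (θ : ℝ → ℝ) (u v : E4) {c : ℝ} (hc : 0 < c) :
    coneKernel θ u (c • v) = coneKernel θ u v / c ^ 4 := by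
  unfold coneKernel
  rw [inner_smul_right, norm_smul, Real.norm_of_nonneg hc.le, mul_div_mul_left _ _ hc.ne', mul_pow,
    div_div, mul_comm (c ^ 4)]

theorem isKernel_coneKernel {θ : ℝ → ℝ} (hθ : ContDiff ℝ 1 θ) (u : E4) :
    IsKernel (coneKernel θ u) := by
  have hs : ∀ v : E4, v ≠ 0 → ContDiffAt ℝ 1 (coneKernel θ u) v := by
    intro v hv
    have h1 : ContDiffAt ℝ 1 (fun v : E4 => ‖v‖) v := contDiffAt_norm ℝ hv
    have h2 : ContDiffAt ℝ 1 (fun v : E4 => inner ℝ u v) v :=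
      contDiffAt_const.inner ℝ contDiffAt_id
    have h3 : ‖v‖ ≠ 0 := norm_ne_zero_iff.2 hv
    exact (hθ.contDiffAt.comp v (h2.div h1 h3)).div (h1.pow 4) (pow_ne_zero 4 h3)
  refine ⟨fun v hv => (hs v hv).contDiffWithinAt, fun v hv => ?_⟩
  have h1 := ((hs v hv).differentiableAt one_ne_zero).hasFDerivAt
  -- Euler's relation is the derivative at c = 1 of the homogeneity relation along the ray through
  -- v.
  have h2 : HasDerivAt (fun c : ℝ => coneKernel θ u (c • v))
      (fderiv ℝ (coneKernel θ u) v v) 1 := by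
    have e : HasDerivAt (fun c : ℝ => c • v) v 1 := by
      simpa using (hasDerivAt_id (1 : ℝ)).smul_const v
    have h1' : HasFDerivAt (coneKernel θ u) (fderiv ℝ (coneKernel θ u) v) ((1 : ℝ) • v) := by
      rwa [one_smul]
    exact h1'.comp_hasDerivAt 1 e
  have h3 : HasDerivAt (fun c : ℝ => coneKernel θ u v / c ^ 4) (-4 * coneKernel θ u v) 1 := by
    have := (hasDerivAt_const (1 : ℝ) (coneKernel θ u v)).div ((hasDerivAt_id (1 : ℝ)).pow 4)
      (by norm_num)
    refine this.congr_deriv ?_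
    simp; ring
  refine h2.unique (h3.congr_of_eventuallyEq ?_)
  filter_upwards [lt_mem_nhds (zero_lt_one' ℝ)] with c hc using coneKernel_smul θ u v hc

theorem coneKernel_neg (θ : ℝ → ℝ) (u v : E4) : coneKernel θ u (-v) = coneKernel θ (-u) v := by
  simp [coneKernel]

theorem inner_matMap (M : Matrix (Fin 4) (Fin 4) ℝ) (u v : E4) :
    inner ℝ u (matMap M v) = inner ℝ (matMap M.transpose u) v := by
  simp only [matMap_apply, EuclideanSpace.inner_eq_star_dotProduct, star_trivial]
  rw [Matrix.mulVec_transpose, dotProduct_comm, Matrix.dotProduct_mulVec, dotProduct_comm]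

theorem matMap_mul (M N : Matrix (Fin 4) (Fin 4) ℝ) (v : E4) :
    matMap (M * N) v = matMap M (matMap N v) := by
  simp [matMap_apply]

@[simp] theorem matMap_one (v : E4) : matMap 1 v = v := by
  simp [matMap_apply]

theorem norm_matMap {M : Matrix (Fin 4) (Fin 4) ℝ} (hM : M.transpose * M = 1) (v : E4) :
    ‖matMap M v‖ = ‖v‖ := by
  rw [← sq_eq_sq₀ (norm_nonneg _) (norm_nonneg _), ← real_inner_self_eq_norm_sq,
    ← real_inner_self_eq_norm_sq, inner_matMap, ← matMap_mul, hM, matMap_one]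

/-- An orthogonal matrix preserves norms, so composing a cone kernel with it only moves the axis, by
the transpose. -/
theorem linkInt_orthogonal {θ : ℝ → ℝ} (hθ : ContDiff ℝ 1 θ) (u : E4)
    {M : Matrix (Fin 4) (Fin 4) ℝ} (hM : M.transpose * M = 1) {X Y : ℝ → E4} (hX : IsLoop X)
    (hY : IsLoop Y) (hXY : IndepCurves X Y) :
    linkInt (coneKernel θ u) (fun t => matMap M (X t)) (fun t => matMap M (Y t)) =
      M.det * linkInt (coneKernel θ (matMap M.transpose u)) X Y := by
  refine linkInt_matMap (isKernel_coneKernel hθ _) (isKernel_coneKernel hθ _) (fun v hv => ?_)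
    (fun v => ?_) hX hY hXY
  · rw [← norm_eq_zero, ← norm_matMap hM, hv, norm_zero]
  · simp only [coneKernel, inner_matMap, norm_matMap hM]

/-- The matrix of the reflection in the hyperplane orthogonal to the unit vector `v`. -/
def reflMatrix (v : E4) : Matrix (Fin 4) (Fin 4) ℝ :=
  1 - (2 : ℝ) • Matrix.vecMulVec v.ofLp v.ofLp

theorem matMap_reflMatrix (v x : E4) : matMap (reflMatrix v) x = x - (2 * inner ℝ v x) • v := by
  ext i
  simp only [matMap_apply, reflMatrix, Matrix.sub_mulVec, Matrix.one_mulVec, Matrix.smul_mulVec,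
    Matrix.vecMulVec_mulVec, EuclideanSpace.inner_eq_star_dotProduct, star_trivial,
    dotProduct_comm v.ofLp]
  simp
  ring

theorem reflMatrix_transpose (v : E4) : (reflMatrix v).transpose = reflMatrix v := by
  simp [reflMatrix, Matrix.transpose_vecMulVec]

theorem reflMatrix_det {v : E4} (hv : ‖v‖ = 1) : (reflMatrix v).det = -1 := by
  have h : v.ofLp 0 ^ 2 + v.ofLp 1 ^ 2 + v.ofLp 2 ^ 2 + v.ofLp 3 ^ 2 = 1 := by
    have := EuclideanSpace.real_norm_sq_eq v
    rw [hv] at this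
    simp [Fin.sum_univ_four] at this
    linarith
  have e := det4_eq_det (WithLp.toLp 2 (reflMatrix v 0)) (WithLp.toLp 2 (reflMatrix v 1))
    (WithLp.toLp 2 (reflMatrix v 2)) (WithLp.toLp 2 (reflMatrix v 3))
  have e' : Matrix.of ![reflMatrix v 0, reflMatrix v 1, reflMatrix v 2, reflMatrix v 3] =
      reflMatrix v := by
    ext i j
    fin_cases i <;> rfl
  simp only [e'] at e
  rw [← e]
  simp [det4, reflMatrix, Matrix.vecMulVec_apply]
  linear_combination (-2) * h

theorem reflMatrix_mul_self {v : E4} (hv : ‖v‖ = 1) :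
    (reflMatrix v).transpose * reflMatrix v = 1 := by
  have h : v.ofLp ⬝ᵥ v.ofLp = 1 := by
    have := real_inner_self_eq_norm_sq v
    rw [hv, EuclideanSpace.inner_eq_star_dotProduct, star_trivial] at this
    simpa using this
  rw [reflMatrix_transpose, reflMatrix, sub_mul, mul_sub, mul_sub]
  simp [Matrix.vecMulVec_mul_vecMulVec, h]
  module

/-- The linking integral does not depend on the direction around which its kernel is
concentrated. -/
theorem linkInt_coneKernel_eq {θ : ℝ → ℝ} (hθ : ContDiff ℝ 1 θ) {u u' : E4} (hu : ‖u‖ = 1)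
    (hu' : ‖u'‖ = 1) {X Y : ℝ → E4} (hX : IsLoop X) (hY : IsLoop Y) (hXY : IndepCurves X Y) :
    linkInt (coneKernel θ u) X Y = linkInt (coneKernel θ u') X Y := by
  by_cases huu : u = u'
  · rw [huu]
  have hn : ‖u - u'‖ ≠ 0 := norm_ne_zero_iff.2 (sub_ne_zero.2 huu)
  have : PreconnectedSpace (Metric.sphere (0 : E4) 1) :=
    isPreconnected_iff_preconnectedSpace.1 (isPreconnected_sphere
      (by rw [← Module.finrank_eq_rank, finrank_euclideanSpace_fin]; norm_num) 0 1)
  -- A reflection of the axis can be transferred to the curves at the cost of a sign, the same for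
  -- all reflections. The reflected curves vary continuously with the normal v in the connected
  -- sphere, so the homotopy theorem applies.
  have key : ∀ v w : Metric.sphere (0 : E4) 1,
      linkInt (coneKernel θ (matMap (reflMatrix v) u')) X Y =
        linkInt (coneKernel θ (matMap (reflMatrix w) u')) X Y := by
    intro v w
    have e : ∀ v : Metric.sphere (0 : E4) 1,
        linkInt (coneKernel θ (matMap (reflMatrix v) u')) X Y =
        - linkInt (coneKernel θ u') (fun t => matMap (reflMatrix v) (X t))
          (fun t => matMap (reflMatrix v) (Y t)) := by
      intro v
      have hv : ‖(v : E4)‖ = 1 := by simp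
      rw [linkInt_orthogonal hθ u' (reflMatrix_mul_self hv) hX hY hXY, reflMatrix_det hv,
        reflMatrix_transpose]
      ring
    rw [e v, e w]
    congr 1
    have cX := hX.continuous
    have cY := hY.continuous
    refine linkInt_eq_of_homotopy (isKernel_coneKernel hθ u')
      (X := fun (v : Metric.sphere (0 : E4) 1) t => matMap (reflMatrix v) (X t))
      (Y := fun (v : Metric.sphere (0 : E4) 1) t => matMap (reflMatrix v) (Y t)) ?_ ?_
      (fun v => hX.matMap _) (fun v => hY.matMap _) (fun v s t => mem_indepPairs_matMap ?_ (hXY s t))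
      v w
    · simp only [Function.uncurry_def, matMap_reflMatrix]
      fun_prop
    · simp only [Function.uncurry_def, matMap_reflMatrix]
      fun_prop
    · intro x hx
      rw [← norm_eq_zero, ← norm_matMap (reflMatrix_mul_self (v := v) (by simp)), hx, norm_zero]
  -- The reflection with this normal exchanges u and u'.
  let v₀ : E4 := ‖u - u'‖⁻¹ • (u - u')
  have hv₀ : v₀ ∈ Metric.sphere (0 : E4) 1 := by
    rw [mem_sphere_zero_iff_norm, norm_smul, norm_inv, norm_norm, inv_mul_cancel₀ hn]
  -- A unit vector orthogonal to u', whose reflection therefore fixes u'.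
  let w₀ : E4 := !₂[-u' 1, u' 0, -u' 3, u' 2]
  have hw₀ : w₀ ∈ Metric.sphere (0 : E4) 1 := by
    rw [mem_sphere_zero_iff_norm, ← hu', EuclideanSpace.norm_eq, EuclideanSpace.norm_eq]
    congr 1
    simp [Fin.sum_univ_four, w₀]
    ring
  have e1 : matMap (reflMatrix v₀) u' = u := by
    rw [matMap_reflMatrix, smul_smul]
    have h1 : ‖u - u'‖ ^ 2 = 2 - 2 * inner ℝ u u' := by
      rw [norm_sub_sq_real, hu, hu']; ring
    have h2 : inner ℝ v₀ u' = ‖u - u'‖⁻¹ * (inner ℝ u u' - 1) := by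
      rw [inner_smul_left, inner_sub_left, real_inner_self_eq_norm_sq, hu']; simp
    have h3 : 2 * inner ℝ v₀ u' * ‖u - u'‖⁻¹ = -1 := by
      rw [h2]
      field_simp
      linarith
    rw [h3]
    module
  have e2 : matMap (reflMatrix w₀) u' = u' := by
    have : inner ℝ w₀ u' = 0 := by
      simp [EuclideanSpace.inner_eq_star_dotProduct, dotProduct, Fin.sum_univ_four, w₀]
      ring
    rw [matMap_reflMatrix, this]
    simp
  have := key ⟨v₀, hv₀⟩ ⟨w₀, hw₀⟩
  rwa [e1, e2] at this

/-! ### Moving the apex -/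

/-- The pole of the stereographic projection. -/
def pole : E4 := EuclideanSpace.single 3 1

theorem norm_pole : ‖pole‖ = 1 := by simp [pole]

/-- A ray starting at a point of the closed ball on the axis meets the sphere at most once, apart
from its starting point. Analytically, a x = b y + (a - b)σ p with b ≤ a, and strict convexity makes
the right side shorter than a outside the degenerate cases. -/
theorem mem_indepPairs_sub_pole_aux {x y : E4} (hx : ‖x‖ = 1) (hy : ‖y‖ = 1) (hxp : x ≠ pole)
    (hyp : y ≠ pole) (hxy : x ≠ y) {σ : ℝ} (hσ : σ ∈ Icc (0 : ℝ) 1) {a b : ℝ} (hb : 0 ≤ b)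
    (hab : b ≤ a) (ha : 0 < a) (h : a • (x - σ • pole) = b • (y - σ • pole)) : False := by
  have e : a • x = b • y + ((a - b) * σ) • pole := by
    have h' : a • x - (a * σ) • pole = b • y - (b * σ) • pole := by
      rw [smul_sub, smul_sub, smul_smul, smul_smul] at h
      exact h
    rw [sub_eq_iff_eq_add] at h'
    rw [h']
    module
  have hc : inner ℝ y pole < 1 := by
    have h1 : 0 < ‖y - pole‖ ^ 2 := by
      have : ‖y - pole‖ ≠ 0 := norm_ne_zero_iff.2 (sub_ne_zero.2 hyp)
      positivity
    rw [norm_sub_sq_real, hy, norm_pole] at h1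
    linarith
  have hn : a ^ 2 = b ^ 2 + 2 * (b * ((a - b) * σ) * inner ℝ y pole) + ((a - b) * σ) ^ 2 := by
    have h1 : ‖a • x‖ ^ 2 = a ^ 2 := by rw [norm_smul, hx, mul_one, Real.norm_eq_abs, sq_abs]
    rw [← h1, e, norm_add_sq_real, norm_smul, norm_smul, hy, norm_pole, inner_smul_left,
      inner_smul_right, mul_one, mul_one, Real.norm_eq_abs, Real.norm_eq_abs, sq_abs, sq_abs]
    simp
    ring
  rcases hab.eq_or_lt with rfl | hlt
  · rw [sub_self, zero_mul, zero_smul, add_zero] at e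
    exact hxy (smul_right_injective _ ha.ne' e)
  · rcases hb.eq_or_lt with rfl | hb0
    · have h1 : σ = 1 := by
        have : a ^ 2 * (1 - σ ^ 2) = 0 := by linear_combination hn
        rcases mul_eq_zero.1 this with h | h
        · exact absurd h (by positivity)
        · nlinarith [hσ.1, hσ.2]
      rw [h1, zero_smul, zero_add, sub_zero, mul_one] at e
      exact hxp (smul_right_injective _ ha.ne' e)
    · have hd : 0 < a - b := sub_pos.2 hlt
      rcases hσ.1.eq_or_lt with h0 | h0
      · rw [← h0] at hn
        nlinarith
      · have h1 : b * ((a - b) * σ) * inner ℝ y pole < b * ((a - b) * σ) :=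
          mul_lt_of_lt_one_right (by positivity) hc
        have h2 : (a - b) * σ ≤ a - b := mul_le_of_le_one_right hd.le hσ.2
        have h3 : ((a - b) * σ) ^ 2 ≤ (a - b) ^ 2 := by
          apply pow_le_pow_left₀ (by positivity) h2
        have h4 : b * ((a - b) * σ) ≤ b * (a - b) := by gcongr
        nlinarith

theorem mem_indepPairs_sub_pole {x y : E4} (hx : ‖x‖ = 1) (hy : ‖y‖ = 1) (hxp : x ≠ pole)
    (hyp : y ≠ pole) (hxy : x ≠ y) {σ : ℝ} (hσ : σ ∈ Icc (0 : ℝ) 1) :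
    (x - σ • pole, y - σ • pole) ∈ indepPairs := by
  intro r hr h
  simp only [sub_eq_zero] at h
  rcases le_total r (1 - r) with hle | hle
  · exact mem_indepPairs_sub_pole_aux hx hy hxp hyp hxy hσ hr.1 hle (by linarith [hr.1]) h
  · exact mem_indepPairs_sub_pole_aux hy hx hyp hxp hxy.symm hσ (by linarith [hr.2]) hle
      (by linarith [hr.1]) h.symm

theorem mem_indepPairs_of_norm {x y : E4} (hx : ‖x‖ = 1) (hy : ‖y‖ = 1) (hxy : x ≠ y) :
    (x, y) ∈ indepPairs := by
  intro r hr h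
  simp only [sub_eq_zero] at h
  have := congrArg norm h
  rw [norm_smul, norm_smul, hx, hy, mul_one, mul_one, Real.norm_of_nonneg hr.1,
    Real.norm_of_nonneg (by linarith [hr.2])] at this
  rw [this] at h
  exact hxy (smul_right_injective _ (by linarith : r ≠ 0) h)

/-- The apex of the rays is moved from the centre of the sphere along the axis to the pole, where
the rays become those of the stereographic projection. -/
theorem linkInt_sub_pole {h : E4 → ℝ} (hh : IsKernel h) {X Y : ℝ → E4} (hX : IsLoop X)
    (hY : IsLoop Y) (nX : ∀ t, ‖X t‖ = 1) (nY : ∀ t, ‖Y t‖ = 1) (pX : ∀ t, X t ≠ pole)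
    (pY : ∀ t, Y t ≠ pole) (hXY : ∀ s t, X s ≠ Y t) :
    linkInt h X Y = linkInt h (fun t => X t - pole) (fun t => Y t - pole) := by
  have cX := hX.continuous
  have cY := hY.continuous
  have loop : ∀ {Z : ℝ → E4}, IsLoop Z → ∀ σ : ℝ, IsLoop fun t => Z t - σ • pole := fun hZ σ =>
    ⟨fun t => by simp only [hZ.periodic t], hZ.contDiff.sub contDiff_const⟩
  have := linkInt_eq_of_homotopy hh (T := unitInterval)
    (X := fun σ t => X t - (σ : ℝ) • pole) (Y := fun σ t => Y t - (σ : ℝ) • pole)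
    (by simp only [Function.uncurry_def]; fun_prop) (by simp only [Function.uncurry_def]; fun_prop)
    (fun σ => loop hX σ) (fun σ => loop hY σ)
    (fun σ s t => mem_indepPairs_sub_pole (nX s) (nY t) (pX s) (pY t) (hXY s t) σ.2) 0 1
  simpa using this

theorem smul_mem_indepPairs {x y : E4} (h : (x, y) ∈ indepPairs) {a b : ℝ} (ha : 0 < a)
    (hb : 0 < b) : (a • x, b • y) ∈ indepPairs := by
  intro r hr h0
  have h1 : 0 ≤ 1 - r := by linarith [hr.2]
  have hm : 0 < (1 - r) * a + r * b := by
    rcases hr.1.eq_or_lt with h | h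
    · rw [← h]; linarith
    · have := mul_pos h hb
      have := mul_nonneg h1 ha.le
      linarith
  -- The parameter at which the segment from x to -y meets the ray through the point r of the
  -- segment from a x to -b y.
  refine h (r * b / ((1 - r) * a + r * b)) ⟨div_nonneg (mul_nonneg hr.1 hb.le) hm.le,
    (div_le_one hm).2 (by linarith [mul_nonneg h1 ha.le])⟩ ?_
  have e : 1 - r * b / ((1 - r) * a + r * b) = ((1 - r) * a + r * b)⁻¹ * ((1 - r) * a) := by
    field_simp; ring
  have e' : r * b / ((1 - r) * a + r * b) = ((1 - r) * a + r * b)⁻¹ * (r * b) := by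
    field_simp
  simp only at h0 ⊢
  rw [e, e']
  set c := ((1 - r) * a + r * b)⁻¹
  have : (c * ((1 - r) * a)) • x - (c * (r * b)) • y = c • ((1 - r) • a • x - r • b • y) := by
    module
  rw [this, h0, smul_zero]

theorem linkInt_smul {h : E4 → ℝ} (hh : IsKernel h) {X Y : ℝ → E4} (hX : IsLoop X)
    (hY : IsLoop Y) (hXY : IndepCurves X Y) {a b : ℝ → ℝ} (ha : ContDiff ℝ 1 a)
    (hb : ContDiff ℝ 1 b) (pa : Function.Periodic a 1) (pb : Function.Periodic b 1)
    (ha0 : ∀ t, 0 < a t) (hb0 : ∀ t, 0 < b t) :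
    linkInt h X Y = linkInt h (fun t => a t • X t) (fun t => b t • Y t) := by
  have cX := hX.continuous
  have cY := hY.continuous
  have ca := ha.continuous
  have cb := hb.continuous
  have loop : ∀ {Z : ℝ → E4} {c : ℝ → ℝ}, IsLoop Z → ContDiff ℝ 1 c → Function.Periodic c 1 →
      ∀ σ : ℝ, IsLoop fun t => ((1 - σ) + σ * c t) • Z t := fun hZ hc pc σ =>
    ⟨fun t => by simp only [hZ.periodic t, pc t],
      (contDiff_const.add (contDiff_const.mul hc)).smul hZ.contDiff⟩
  have pos : ∀ (σ : unitInterval) {c : ℝ}, 0 < c → 0 < (1 - (σ : ℝ)) + σ * c := by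
    intro σ c hc
    rcases σ.2.1.eq_or_lt with h | h
    · rw [← h]; norm_num
    · have := mul_pos h hc
      have := σ.2.2
      linarith
  have := linkInt_eq_of_homotopy hh (T := unitInterval)
    (X := fun σ t => ((1 - (σ : ℝ)) + σ * a t) • X t)
    (Y := fun σ t => ((1 - (σ : ℝ)) + σ * b t) • Y t)
    (by simp only [Function.uncurry_def]; fun_prop) (by simp only [Function.uncurry_def]; fun_prop)
    (fun σ => loop hX ha pa σ) (fun σ => loop hY hb pb σ)
    (fun σ s t => smul_mem_indepPairs (hXY s t) (pos σ (ha0 s)) (pos σ (hb0 t))) 0 1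
  simpa using this

end

end KnotTheory

namespace KnotTheory

noncomputable section

/-! ### Localization of integrals at nondegenerate zeros -/

/-- Near a nondegenerate zero Q is a diffeomorphism onto a neighbourhood of 0 with Jacobian of
constant sign. Once the support of Ψ fits into the image, the change of variables yields its whole
integral with that sign. -/
theorem exists_nhds_integral_comp_mul_det {E : Type*} [NormedAddCommGroup E] [NormedSpace ℝ E]
    [FiniteDimensional ℝ E] [MeasurableSpace E] [BorelSpace E] (μ : Measure E) [μ.IsAddHaarMeasure]
    {Q : E → E} {z : E} (hQ : ContDiffAt ℝ 1 Q z) (hz : Q z = 0) (hd : (fderiv ℝ Q z).det ≠ 0)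
    {V : Set E} (hV : V ∈ 𝓝 z) :
    ∃ N ⊆ V, IsOpen N ∧ z ∈ N ∧ (∀ x ∈ N, DifferentiableAt ℝ Q x) ∧ ∃ ε > 0, ∀ Ψ : E → ℝ,
      (∀ q, ε ≤ ‖q‖ → Ψ q = 0) →
      ∫ x in N, Ψ (Q x) * (fderiv ℝ Q x).det ∂μ =
        (SignType.sign (fderiv ℝ Q z).det : ℝ) * ∫ q, Ψ q ∂μ := by
  let L : E ≃L[ℝ] E := (fderiv ℝ Q z).toContinuousLinearEquivOfDetNeZero hd
  have hL : (L : E →L[ℝ] E) = fderiv ℝ Q z := by ext; rfl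
  have hs : HasStrictFDerivAt Q (L : E →L[ℝ] E) z := by
    rw [hL]; exact hQ.hasStrictFDerivAt one_ne_zero
  let e := hs.toOpenPartialHomeomorph Q
  have hdc : ContinuousAt (fun x => (fderiv ℝ Q x).det) z :=
    ContinuousLinearMap.continuous_det.continuousAt.comp
      ((hQ.fderiv_right (m := 0) le_rfl).continuousAt)
  have hsign : ∀ᶠ x in 𝓝 z, SignType.sign (fderiv ℝ Q x).det = SignType.sign (fderiv ℝ Q z).det := by
    rcases hd.lt_or_gt with h | h
    · filter_upwards [hdc.eventually_lt_const h] with x hx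
      rw [sign_neg hx, sign_neg h]
    · filter_upwards [hdc.eventually_const_lt h] with x hx
      rw [sign_pos hx, sign_pos h]
  have hdiff : ∀ᶠ x in 𝓝 z, DifferentiableAt ℝ Q x :=
    (hQ.eventually (by simp)).mono fun x hx => hx.differentiableAt one_ne_zero
  have hmem : ∀ᶠ x in 𝓝 z, x ∈ e.source ∧ x ∈ V ∧ DifferentiableAt ℝ Q x ∧
      SignType.sign (fderiv ℝ Q x).det = SignType.sign (fderiv ℝ Q z).det :=
    Filter.Eventually.and (e.open_source.mem_nhds hs.mem_toOpenPartialHomeomorph_source)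
      (Filter.Eventually.and hV (hdiff.and hsign))
  obtain ⟨N, hN, hNo, hzN⟩ := eventually_nhds_iff.1 hmem
  have hinj : InjOn Q N := e.injOn.mono fun x hx => (hN x hx).1
  have himg : IsOpen (Q '' N) :=
    e.isOpen_image_of_subset_source hNo fun x hx => (hN x hx).1
  obtain ⟨ε, hε, hball⟩ := Metric.isOpen_iff.1 himg 0 ⟨z, hzN, hz⟩
  refine ⟨N, fun x hx => (hN x hx).2.1, hNo, hzN, fun x hx => (hN x hx).2.2.1, ε, hε,
    fun Ψ hΨ => ?_⟩
  have h1 := integral_image_eq_integral_abs_det_fderiv_smul μ hNo.measurableSet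
    (fun x hx => (hN x hx).2.2.1.hasFDerivAt.hasFDerivWithinAt) hinj Ψ
  have h2 : ∫ q in Q '' N, Ψ q ∂μ = ∫ q, Ψ q ∂μ :=
    setIntegral_eq_integral_of_forall_compl_eq_zero fun q hq => hΨ q (by
      by_contra hlt
      exact hq (hball (by simpa using hlt)))
  rw [← h2, h1, ← integral_const_mul]
  refine setIntegral_congr_fun hNo.measurableSet fun x hx => ?_
  have e1 := (hN x hx).2.2.2
  have e2 := sign_mul_abs (fderiv ℝ Q x).det
  rw [← e1, smul_eq_mul, ← mul_assoc, e2, mul_comm]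

theorem det_clm_prod_three (L : ℝ × ℝ × ℝ →L[ℝ] ℝ × ℝ × ℝ) {a b c : ℝ × ℝ × ℝ}
    (ha : L (1, 0, 0) = a) (hb : L (0, 1, 0) = b) (hc : L (0, 0, 1) = c) :
    L.det = a.1 * (b.2.1 * c.2.2 - b.2.2 * c.2.1) - b.1 * (a.2.1 * c.2.2 - a.2.2 * c.2.1) +
      c.1 * (a.2.1 * b.2.2 - a.2.2 * b.2.1) := by
  let e : (Fin 3 → ℝ) ≃ₗ[ℝ] ℝ × ℝ × ℝ :=
    { toFun := fun v => (v 0, v 1, v 2)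
      invFun := fun p => ![p.1, p.2.1, p.2.2]
      map_add' := fun _ _ => rfl
      map_smul' := fun _ _ => rfl
      left_inv := fun v => by ext i; fin_cases i <;> rfl
      right_inv := fun _ => rfl }
  have h1 : L.det = LinearMap.det ((e.symm : ℝ × ℝ × ℝ →ₗ[ℝ] (Fin 3 → ℝ)) ∘ₗ
      (L : ℝ × ℝ × ℝ →ₗ[ℝ] ℝ × ℝ × ℝ) ∘ₗ (e : (Fin 3 → ℝ) →ₗ[ℝ] ℝ × ℝ × ℝ)) := by
    have := LinearMap.det_conj (L : ℝ × ℝ × ℝ →ₗ[ℝ] ℝ × ℝ × ℝ) e.symm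
    exact this.symm
  rw [h1, ← LinearMap.det_toMatrix', Matrix.det_fin_three]
  have e0 : e (Pi.single 0 1) = (1, 0, 0) := by
    change ((_ : ℝ), (_ : ℝ), (_ : ℝ)) = _
    simp
  have e1 : e (Pi.single 1 1) = (0, 1, 0) := by
    change ((_ : ℝ), (_ : ℝ), (_ : ℝ)) = _
    simp
  have e2 : e (Pi.single 2 1) = (0, 0, 1) := by
    change ((_ : ℝ), (_ : ℝ), (_ : ℝ)) = _
    simp
  have m : ∀ i j, LinearMap.toMatrix' ((e.symm : ℝ × ℝ × ℝ →ₗ[ℝ] (Fin 3 → ℝ)) ∘ₗ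
      (L : ℝ × ℝ × ℝ →ₗ[ℝ] ℝ × ℝ × ℝ) ∘ₗ (e : (Fin 3 → ℝ) →ₗ[ℝ] ℝ × ℝ × ℝ)) i j =
      ![(L (e (Pi.single j 1))).1, (L (e (Pi.single j 1))).2.1, (L (e (Pi.single j 1))).2.2] i := by
    intro i j
    rw [LinearMap.toMatrix'_apply]
    rfl
  simp only [m, e0, e1, e2, ha, hb, hc]
  simp
  ring

/-- The differential of a map to projective space in an affine chart. -/
theorem det_fderiv_chart {F : ℝ × ℝ × ℝ → E4} {p : ℝ × ℝ × ℝ} {F' : ℝ × ℝ × ℝ →L[ℝ] E4}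
    (hF : HasFDerivAt F F' p) (h2 : F p 2 ≠ 0) :
    (fderiv ℝ (fun x => (F x 0 / F x 2, F x 1 / F x 2, F x 3 / F x 2)) p).det * F p 2 ^ 4 =
      det4 (F p) (F' (1, 0, 0)) (F' (0, 1, 0)) (F' (0, 0, 1)) := by
  have hc : ∀ i, HasFDerivAt (fun x => F x i) ((EuclideanSpace.proj i).comp F') p := fun i =>
    (EuclideanSpace.proj i : E4 →L[ℝ] ℝ).hasFDerivAt.comp p hF
  have hq : ∀ i, HasFDerivAt (fun x => F x i / F x 2)
      (F p i • (-(F p 2 ^ 2)⁻¹ • (EuclideanSpace.proj 2).comp F') +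
        (F p 2)⁻¹ • (EuclideanSpace.proj i).comp F') p := fun i => by
    simp only [div_eq_mul_inv]
    exact (hc i).mul ((hasDerivAt_inv h2).comp_hasFDerivAt p (hc 2))
  have := (hq 0).prodMk ((hq 1).prodMk (hq 3))
  rw [this.fderiv, det_clm_prod_three _ rfl rfl rfl]
  simp [det4]
  field_simp
  ring

end

end KnotTheory

namespace KnotTheory

noncomputable section

/-! ### Counting crossings by the linking integral -/

/-- The curve in 3-space with coordinates `a`, in the affine hyperplane `x₃ = -1`. -/
def affineCurve (a : Fin 3 → ℝ → ℝ) (t : ℝ) : E4 := !₂[a 0 t, a 1 t, a 2 t, -1]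

/-- The direction of projection. -/
def vertical : E4 := EuclideanSpace.single 2 1

theorem norm_vertical : ‖vertical‖ = 1 := by simp [vertical]

theorem inner_vertical (v : E4) : inner ℝ vertical v = v 2 := by
  simp [vertical, EuclideanSpace.inner_single_left]

theorem isLoop_affineCurve {a : Fin 3 → ℝ → ℝ} (ha : ∀ i, ContDiff ℝ 1 (a i))
    (pa : ∀ i, Function.Periodic (a i) 1) : IsLoop (affineCurve a) where
  periodic t := by simp [affineCurve, pa _ t]
  contDiff := by
    rw [contDiff_euclidean]
    intro i
    fin_cases i
    exacts [ha 0, ha 1, ha 2, contDiff_const]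

theorem IsLoop.deriv_apply {X : ℝ → E4} (hX : IsLoop X) (t : ℝ) (i : Fin 4) :
    deriv X t i = deriv (fun t => X t i) t :=
  (((EuclideanSpace.proj i : E4 →L[ℝ] ℝ).hasFDerivAt.comp_hasDerivAt t (hX.hasDerivAt t)).deriv).symm

theorem deriv_affineCurve {a : Fin 3 → ℝ → ℝ} (ha : ∀ i, ContDiff ℝ 1 (a i))
    (pa : ∀ i, Function.Periodic (a i) 1) (t : ℝ) :
    deriv (affineCurve a) t = !₂[deriv (a 0) t, deriv (a 1) t, deriv (a 2) t, 0] := by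
  ext i
  rw [(isLoop_affineCurve ha pa).deriv_apply]
  fin_cases i <;> simp [affineCurve]

/-- The total mass of the cone kernel. -/
def coneMass (θ : ℝ → ℝ) : ℝ :=
  ∫ q : ℝ × ℝ × ℝ, coneKernel θ vertical !₂[q.1, q.2.1, 1, q.2.2]

theorem norm_sq_chart (q : ℝ × ℝ × ℝ) :
    ‖(!₂[q.1, q.2.1, 1, q.2.2] : E4)‖ ^ 2 = 1 + (q.1 ^ 2 + q.2.1 ^ 2 + q.2.2 ^ 2) := by
  rw [EuclideanSpace.real_norm_sq_eq]
  simp [Fin.sum_univ_four]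
  ring

theorem sq_le_of_le_norm {q : ℝ × ℝ × ℝ} {ε : ℝ} (hε : 0 ≤ ε) (hq : ε ≤ ‖q‖) :
    ε ^ 2 ≤ q.1 ^ 2 + q.2.1 ^ 2 + q.2.2 ^ 2 := by
  rw [Prod.norm_def, Prod.norm_def, le_max_iff, le_max_iff] at hq
  simp only [Real.norm_eq_abs] at hq
  rcases hq with h | h | h
  · have := pow_le_pow_left₀ hε h 2
    rw [sq_abs] at this
    nlinarith [sq_nonneg q.2.1, sq_nonneg q.2.2]
  · have := pow_le_pow_left₀ hε h 2
    rw [sq_abs] at this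
    nlinarith [sq_nonneg q.1, sq_nonneg q.2.2]
  · have := pow_le_pow_left₀ hε h 2
    rw [sq_abs] at this
    nlinarith [sq_nonneg q.1, sq_nonneg q.2.1]

/-- The cosine of the angle between the vertical and the chart point q is the inverse of the square
root of 1 + |q|², with |q| the Euclidean length, and this is at most κ when q is far from 0. -/
theorem coneKernel_chart_eq_zero {θ : ℝ → ℝ} {κ ε : ℝ} (hθ : ∀ x ≤ κ, θ x = 0) (hε : 0 ≤ ε)
    (hκ : (Real.sqrt (1 + ε ^ 2))⁻¹ ≤ κ) {q : ℝ × ℝ × ℝ} (hq : ε ≤ ‖q‖) :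
    coneKernel θ vertical !₂[q.1, q.2.1, 1, q.2.2] = 0 := by
  have h1 : Real.sqrt (1 + ε ^ 2) ≤ ‖(!₂[q.1, q.2.1, 1, q.2.2] : E4)‖ := by
    apply Real.sqrt_le_iff.2 ⟨norm_nonneg _, ?_⟩
    rw [norm_sq_chart]
    linarith [sq_le_of_le_norm hε hq]
  have h2 : 0 < Real.sqrt (1 + ε ^ 2) := Real.sqrt_pos.2 (by positivity)
  unfold coneKernel
  rw [hθ, zero_div]
  rw [inner_vertical]
  refine le_trans ?_ hκ
  simp only [div_eq_mul_inv]
  simpa using inv_anti₀ h2 h1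

/-- The segment joining a point of the first curve to the antipode of a point of the second. -/
def chord (X Y : ℝ → E4) (p : ℝ × ℝ × ℝ) : E4 := (1 - p.2.2) • X p.1 - p.2.2 • Y p.2.1

section

variable {X Y : ℝ → E4} (hX : IsLoop X) (hY : IsLoop Y)

include hX hY in
theorem contDiff_chord : ContDiff ℝ 1 (chord X Y) := by
  have h1 := hX.contDiff
  have h2 := hY.contDiff
  unfold chord
  fun_prop

include hX hY in
theorem exists_hasFDerivAt_chord (p : ℝ × ℝ × ℝ) : ∃ F' : ℝ × ℝ × ℝ →L[ℝ] E4,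
    HasFDerivAt (chord X Y) F' p ∧ F' (1, 0, 0) = (1 - p.2.2) • deriv X p.1 ∧
    F' (0, 1, 0) = -(p.2.2 • deriv Y p.2.1) ∧ F' (0, 0, 1) = -(X p.1 + Y p.2.1) := by
  have h := ((contDiff_chord hX hY).differentiable one_ne_zero p).hasFDerivAt
  obtain ⟨s, t, r⟩ := p
  refine ⟨_, h, ?_, ?_, ?_⟩
  · have e : HasDerivAt (fun s => ((s, t, r) : ℝ × ℝ × ℝ)) (1, 0, 0) s :=
      (hasDerivAt_id s).prodMk (hasDerivAt_const s (t, r))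
    have e1 : HasDerivAt (fun s => chord X Y (s, t, r)) ((1 - r) • deriv X s) s :=
      ((hX.hasDerivAt s).const_smul (1 - r)).sub_const (r • Y t)
    exact HasDerivAt.unique (h.comp_hasDerivAt s e :) e1
  · have e : HasDerivAt (fun t => ((s, t, r) : ℝ × ℝ × ℝ)) (0, 1, 0) t :=
      (hasDerivAt_const t s).prodMk ((hasDerivAt_id t).prodMk (hasDerivAt_const t r))
    have e1 : HasDerivAt (fun t => chord X Y (s, t, r)) (-(r • deriv Y t)) t :=
      ((hY.hasDerivAt t).const_smul r).const_sub ((1 - r) • X s)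
    exact HasDerivAt.unique (h.comp_hasDerivAt t e :) e1
  · have e : HasDerivAt (fun r => ((s, t, r) : ℝ × ℝ × ℝ)) (0, 0, 1) r :=
      (hasDerivAt_const r s).prodMk ((hasDerivAt_const r t).prodMk (hasDerivAt_id r))
    have e1 : HasDerivAt (fun r : ℝ => chord X Y (s, t, r)) (-(X s + Y t)) r := by
      have a := (((hasDerivAt_id r).const_sub 1).smul_const (X s)).sub
        ((hasDerivAt_id r).smul_const (Y t))
      refine a.congr_deriv ?_
      simp; abel
    exact HasDerivAt.unique (h.comp_hasDerivAt r e :) e1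

include hX hY in
-- The chord and its r-derivative span the wedge -X ∧ Y, and the other two partial derivatives span
-- -r(1 - r) X' ∧ Y'. This explains the weight in `kerG`: the linking integrand is the kernel times
-- the Jacobian of the chord map.
theorem det_fderiv_chord_chart {p : ℝ × ℝ × ℝ} (hp : chord X Y p 2 ≠ 0) :
    (fderiv ℝ (fun x => (chord X Y x 0 / chord X Y x 2, chord X Y x 1 / chord X Y x 2,
      chord X Y x 3 / chord X Y x 2)) p).det * chord X Y p 2 ^ 4 =
      p.2.2 * (1 - p.2.2) * det4 (X p.1) (Y p.2.1) (deriv X p.1) (deriv Y p.2.1) := by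
  obtain ⟨F', h, e1, e2, e3⟩ := exists_hasFDerivAt_chord hX hY p
  rw [det_fderiv_chart h hp, e1, e2, e3]
  simp only [chord, det4, PiLp.sub_apply, PiLp.smul_apply, PiLp.neg_apply, PiLp.add_apply,
    smul_eq_mul]
  ring

/-- By periodicity any window may serve as the domain, which allows one whose boundary avoids the
crossings. -/
theorem linkInt_eq_setIntegral {h : E4 → ℝ} (hh : IsKernel h) (hX : IsLoop X) (hY : IsLoop Y)
    (hXY : IndepCurves X Y) (s₀ t₀ : ℝ) :
    IntegrableOn (fun p : ℝ × ℝ × ℝ => p.2.2 * (1 - p.2.2) * h (chord X Y p) *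
        det4 (X p.1) (Y p.2.1) (deriv X p.1) (deriv Y p.2.1))
      (Ioc s₀ (s₀ + 1) ×ˢ Ioc t₀ (t₀ + 1) ×ˢ Ioc (0 : ℝ) 1) ∧
    linkInt h X Y = ∫ p in Ioc s₀ (s₀ + 1) ×ˢ Ioc t₀ (t₀ + 1) ×ˢ Ioc (0 : ℝ) 1,
      p.2.2 * (1 - p.2.2) * h (chord X Y p) *
        det4 (X p.1) (Y p.2.1) (deriv X p.1) (deriv Y p.2.1) := by
  have c1 := hX.continuous
  have c2 := hY.continuous
  have c3 := hX.continuous_deriv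
  have c4 := hY.continuous_deriv
  have cont : ContinuousOn (fun p : ℝ × ℝ × ℝ => p.2.2 * (1 - p.2.2) * h (chord X Y p) *
      det4 (X p.1) (Y p.2.1) (deriv X p.1) (deriv Y p.2.1)) (univ ×ˢ univ ×ˢ Icc (0 : ℝ) 1) := by
    refine ContinuousOn.mul (ContinuousOn.mul (by fun_prop) ?_) (by fun_prop)
    exact hh.smooth.continuousOn.comp (contDiff_chord hX hY).continuous.continuousOn
      fun p hp => hXY p.1 p.2.1 p.2.2 hp.2.2
  have int : IntegrableOn (fun p : ℝ × ℝ × ℝ => p.2.2 * (1 - p.2.2) * h (chord X Y p) *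
        det4 (X p.1) (Y p.2.1) (deriv X p.1) (deriv Y p.2.1))
      (Ioc s₀ (s₀ + 1) ×ˢ Ioc t₀ (t₀ + 1) ×ˢ Ioc (0 : ℝ) 1) := by
    have hc : IsCompact (Icc s₀ (s₀ + 1) ×ˢ Icc t₀ (t₀ + 1) ×ˢ Icc (0 : ℝ) 1) :=
      isCompact_Icc.prod (isCompact_Icc.prod isCompact_Icc)
    refine ((cont.mono ?_).integrableOn_compact hc).mono_set ?_
    · exact prod_mono (subset_univ _) (prod_mono (subset_univ _) le_rfl)
    · exact prod_mono Ioc_subset_Icc_self (prod_mono Ioc_subset_Icc_self Ioc_subset_Icc_self)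
  refine ⟨int, ?_⟩
  have p1 : ∀ s, Function.Periodic (fun t => kerG h (X s, Y t) *
      det4 (X s) (Y t) (deriv X s) (deriv Y t)) 1 := fun s t => by
    simp only [hY.periodic t, hY.deriv_periodic t]
  have p2 : Function.Periodic (fun s => ∫ t in (0 : ℝ)..1, kerG h (X s, Y t) *
      det4 (X s) (Y t) (deriv X s) (deriv Y t)) 1 := fun s => by
    simp only [hX.periodic s, hX.deriv_periodic s]
  have s1 := p2.intervalIntegral_add_eq 0 s₀
  rw [zero_add] at s1
  rw [linkInt_eq hh hY hXY, s1, intervalIntegral.integral_of_le (by linarith),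
    Measure.volume_eq_prod, setIntegral_prod _ int]
  refine setIntegral_congr_fun measurableSet_Ioc fun s hs => ?_
  have s2 := (p1 s).intervalIntegral_add_eq 0 t₀
  rw [zero_add] at s2
  have int2 : IntegrableOn (fun p : ℝ × ℝ => p.2 * (1 - p.2) * h (chord X Y (s, p)) *
        det4 (X s) (Y p.1) (deriv X s) (deriv Y p.1)) (Ioc t₀ (t₀ + 1) ×ˢ Ioc (0 : ℝ) 1) := by
    have hc : IsCompact (Icc t₀ (t₀ + 1) ×ˢ Icc (0 : ℝ) 1) := isCompact_Icc.prod isCompact_Icc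
    have cont2 : ContinuousOn (fun p : ℝ × ℝ => p.2 * (1 - p.2) * h (chord X Y (s, p)) *
        det4 (X s) (Y p.1) (deriv X s) (deriv Y p.1)) (Icc t₀ (t₀ + 1) ×ˢ Icc (0 : ℝ) 1) :=
      cont.comp (f := fun p : ℝ × ℝ => (s, p)) (by fun_prop) fun p hp => ⟨trivial, trivial, hp.2⟩
    refine (cont2.integrableOn_compact hc).mono_set ?_
    exact prod_mono Ioc_subset_Icc_self Ioc_subset_Icc_self
  simp only
  rw [s2, intervalIntegral.integral_of_le (by linarith), Measure.volume_eq_prod,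
    setIntegral_prod _ int2]
  refine setIntegral_congr_fun measurableSet_Ioc fun t ht => ?_
  simp only [kerG, segInt, chord]
  rw [← intervalIntegral.integral_mul_const, intervalIntegral.integral_of_le zero_le_one]

end

/-- Reduction modulo 1 is a bijection between two fundamental domains; it moves the count of
crossings to the shifted window. -/
theorem finsum_periodic_eq {M : Type*} [AddCommMonoid M] {f : ℝ × ℝ → M} {P : ℝ × ℝ → Prop}
    (hf : ∀ (p : ℝ × ℝ) (m n : ℤ), f (p.1 + m, p.2 + n) = f p)
    (hP : ∀ (p : ℝ × ℝ) (m n : ℤ), P (p.1 + m, p.2 + n) ↔ P p) (s₀ t₀ : ℝ) :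
    ∑ᶠ p ∈ {p : ℝ × ℝ | p.1 ∈ Ico (0 : ℝ) 1 ∧ p.2 ∈ Ico (0 : ℝ) 1 ∧ P p}, f p =
      ∑ᶠ p ∈ {p : ℝ × ℝ | p.1 ∈ Ico s₀ (s₀ + 1) ∧ p.2 ∈ Ico t₀ (t₀ + 1) ∧ P p}, f p := by
  have tm : ∀ a x : ℝ, ∃ m : ℤ, toIcoMod one_pos a x = x + m := fun a x =>
    ⟨-toIcoDiv one_pos a x, by rw [toIcoMod]; simp [sub_eq_add_neg]⟩
  have key : ∀ (a b : ℝ) (p : ℝ × ℝ), ∃ m n : ℤ,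
      (toIcoMod one_pos a p.1, toIcoMod one_pos b p.2) = (p.1 + m, p.2 + n) := fun a b p => by
    obtain ⟨m, hm⟩ := tm a p.1
    obtain ⟨n, hn⟩ := tm b p.2
    exact ⟨m, n, by rw [hm, hn]⟩
  refine finsum_mem_eq_of_bijOn
    (fun p : ℝ × ℝ => (toIcoMod one_pos s₀ p.1, toIcoMod one_pos t₀ p.2)) ?_ ?_
  · refine InvOn.bijOn (f' := fun p : ℝ × ℝ => (toIcoMod one_pos 0 p.1, toIcoMod one_pos 0 p.2))
      ⟨?_, ?_⟩ ?_ ?_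
    · rintro ⟨s, t⟩ ⟨h1, h2, _⟩
      simp only [toIcoMod_toIcoMod]
      rw [(toIcoMod_eq_self one_pos).2 (by simpa using h1),
        (toIcoMod_eq_self one_pos).2 (by simpa using h2)]
    · rintro ⟨s, t⟩ ⟨h1, h2, _⟩
      simp only [toIcoMod_toIcoMod]
      rw [(toIcoMod_eq_self one_pos).2 h1, (toIcoMod_eq_self one_pos).2 h2]
    · rintro p ⟨h1, h2, h3⟩
      obtain ⟨m, n, e⟩ := key s₀ t₀ p
      refine ⟨toIcoMod_mem_Ico one_pos s₀ p.1, toIcoMod_mem_Ico one_pos t₀ p.2, ?_⟩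
      simp only [e]
      exact (hP p m n).2 h3
    · rintro p ⟨h1, h2, h3⟩
      obtain ⟨m, n, e⟩ := key 0 0 p
      have q1 := toIcoMod_mem_Ico one_pos 0 p.1
      have q2 := toIcoMod_mem_Ico one_pos 0 p.2
      rw [zero_add] at q1 q2
      refine ⟨q1, q2, ?_⟩
      simp only [e]
      exact (hP p m n).2 h3
  · intro p _
    obtain ⟨m, n, e⟩ := key s₀ t₀ p
    simp only [e, hf]

theorem setIntegral_eq_sum_of_eq_zero {E ι : Type*} [MeasurableSpace E] {μ : Measure E}
    {g : E → ℝ} {B : Set E} {P : Finset ι} {N : ι → Set E} (hB : MeasurableSet B)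
    (hg : IntegrableOn g B μ) (hN : ∀ i ∈ P, MeasurableSet (N i)) (hNB : ∀ i ∈ P, N i ⊆ B)
    (hd : (P : Set ι).PairwiseDisjoint N) (h0 : ∀ x ∈ B, (∀ i ∈ P, x ∉ N i) → g x = 0) :
    ∫ x in B, g x ∂μ = ∑ i ∈ P, ∫ x in N i, g x ∂μ := by
  rw [← integral_biUnion_finset P hN hd fun i hi => hg.mono_set (hNB i hi)]
  refine (setIntegral_eq_of_subset_of_forall_sdiff_eq_zero hB (iUnion₂_subset hNB) ?_)
  rintro x ⟨hx, hx'⟩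
  refine h0 x hx fun i hi hxi => hx' ?_
  exact mem_biUnion hi hxi

end

end KnotTheory

/-! ### Localisation of the linking integral at the crossings. -/

namespace KnotTheory

noncomputable section

section Count

variable {a b : Fin 3 → ℝ → ℝ}

/-- The affine chart of projective 3-space around the vertical direction, along the chords. -/
def chordChart (X Y : ℝ → E4) (x : ℝ × ℝ × ℝ) : ℝ × ℝ × ℝ :=
  (chord X Y x 0 / chord X Y x 2, chord X Y x 1 / chord X Y x 2, chord X Y x 3 / chord X Y x 2)

theorem chord_affineCurve (x : ℝ × ℝ × ℝ) : chord (affineCurve a) (affineCurve b) x =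
    !₂[(1 - x.2.2) * a 0 x.1 - x.2.2 * b 0 x.2.1, (1 - x.2.2) * a 1 x.1 - x.2.2 * b 1 x.2.1,
      (1 - x.2.2) * a 2 x.1 - x.2.2 * b 2 x.2.1, 2 * x.2.2 - 1] := by
  ext i
  fin_cases i <;> simp [chord, affineCurve]
  ring

/-- The last coordinate 2r - 1 of a vanishing chord forces r = 1/2, and then the two points
coincide. -/
theorem indepCurves_affineCurve
    (hab : ∀ s t, a 0 s = b 0 t → a 1 s = b 1 t → a 2 s ≠ b 2 t) :
    IndepCurves (affineCurve a) (affineCurve b) := by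
  intro s t r hr h
  have e := chord_affineCurve (a := a) (b := b) (s, t, r)
  rw [chord, h] at e
  have e0 := congrArg (fun v : E4 => v 0) e
  have e1 := congrArg (fun v : E4 => v 1) e
  have e2 := congrArg (fun v : E4 => v 2) e
  have e3 := congrArg (fun v : E4 => v 3) e
  simp at e0 e1 e2 e3
  have hr2 : r = 1 / 2 := by linarith
  subst hr2
  exact hab s t (by linarith) (by linarith) (by linarith)

theorem coneKernel_chord {X Y : ℝ → E4} (θ : ℝ → ℝ) {x : ℝ × ℝ × ℝ} (hx : 0 < chord X Y x 2) :
    coneKernel θ vertical (chord X Y x) = coneKernel θ vertical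
      !₂[(chordChart X Y x).1, (chordChart X Y x).2.1, 1, (chordChart X Y x).2.2] /
        chord X Y x 2 ^ 4 := by
  rw [← coneKernel_smul _ _ _ hx]
  congr 1
  ext i
  fin_cases i <;> simp [chordChart] <;> field_simp

theorem contDiffAt_chordChart {X Y : ℝ → E4} (hX : IsLoop X) (hY : IsLoop Y) {x : ℝ × ℝ × ℝ}
    (hx : chord X Y x 2 ≠ 0) : ContDiffAt ℝ 1 (chordChart X Y) x := by
  have h : ∀ i, ContDiffAt ℝ 1 (fun x => chord X Y x i) x := fun i =>
    (contDiff_euclidean.1 (contDiff_chord hX hY) i).contDiffAt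
  exact ((h 0).div (h 2) hx).prodMk (((h 1).div (h 2) hx).prodMk ((h 3).div (h 2) hx))

theorem eventually_inv_sqrt_le {ε : ℝ} (hε : 0 < ε) :
    ∀ᶠ κ in 𝓝[<] (1 : ℝ), (Real.sqrt (1 + ε ^ 2))⁻¹ ≤ κ := by
  have h1 : 1 < Real.sqrt (1 + ε ^ 2) := by
    rw [Real.lt_sqrt zero_le_one]
    nlinarith [pow_pos hε 2]
  have h2 : (Real.sqrt (1 + ε ^ 2))⁻¹ < 1 := inv_lt_one_of_one_lt₀ h1
  filter_upwards [nhdsWithin_le_nhds (lt_mem_nhds h2)] with κ h using le_of_lt h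

variable (ha : ∀ i, ContDiff ℝ 1 (a i)) (hb : ∀ i, ContDiff ℝ 1 (b i))
  (pa : ∀ i, Function.Periodic (a i) 1) (pb : ∀ i, Function.Periodic (b i) 1)

include ha hb pa pb in
-- At a crossing the determinant of four vectors factors into the positive height difference and
-- minus the planar determinant. This is the origin of the minus sign in front of `coneMass`.
theorem det_chordChart_sign {s t : ℝ} (h0 : a 0 s = b 0 t) (h1 : a 1 s = b 1 t)
    (h2 : b 2 t < a 2 s) :
    SignType.sign (fderiv ℝ (chordChart (affineCurve a) (affineCurve b)) (s, t, 1 / 2)).det =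
      -SignType.sign (deriv (a 0) s * deriv (b 1) t - deriv (a 1) s * deriv (b 0) t) := by
  have hX := isLoop_affineCurve ha pa
  have hY := isLoop_affineCurve hb pb
  have e2 : chord (affineCurve a) (affineCurve b) (s, t, 1 / 2) 2 = (a 2 s - b 2 t) / 2 := by
    rw [chord_affineCurve]; simp; ring
  have pos : 0 < chord (affineCurve a) (affineCurve b) (s, t, 1 / 2) 2 := by
    rw [e2]; linarith
  have key := det_fderiv_chord_chart hX hY pos.ne'
  set d := (fderiv ℝ (chordChart (affineCurve a) (affineCurve b)) (s, t, 1 / 2)).det with hd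
  have key' : d * chord (affineCurve a) (affineCurve b) (s, t, 1 / 2) 2 ^ 4 =
      (a 2 s - b 2 t) / 4 *
        -(deriv (a 0) s * deriv (b 1) t - deriv (a 1) s * deriv (b 0) t) := by
    refine key.trans ?_
    simp only [deriv_affineCurve ha pa, deriv_affineCurve hb pb]
    simp [affineCurve, det4, h0, h1]
    ring
  have h3 := congrArg SignType.sign key'
  rwa [sign_mul, sign_mul, sign_pos (pow_pos pos 4), sign_pos (by linarith : 0 < (a 2 s - b 2 t) / 4),
    mul_one, one_mul, Left.sign_neg] at h3

include ha hb pa pb in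
/-- For kernels sufficiently concentrated around the vertical direction, the linking integral of
two curves in 3-space counts the crossings at which the first curve runs above the second. -/
theorem exists_linkInt_affineCurve_eq
    (hab : ∀ s t, a 0 s = b 0 t → a 1 s = b 1 t → a 2 s ≠ b 2 t)
    (htr : ∀ s t, a 0 s = b 0 t → a 1 s = b 1 t →
      deriv (a 0) s * deriv (b 1) t - deriv (a 1) s * deriv (b 0) t ≠ 0)
    (hfin : {p : ℝ × ℝ | p.1 ∈ Ico (0 : ℝ) 1 ∧ p.2 ∈ Ico (0 : ℝ) 1 ∧
      (a 0 p.1 = b 0 p.2 ∧ a 1 p.1 = b 1 p.2)}.Finite) :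
    ∀ᶠ κ in 𝓝[<] (1 : ℝ), ∀ θ : ℝ → ℝ, ContDiff ℝ 1 θ → (∀ x ≤ κ, θ x = 0) →
      linkInt (coneKernel θ vertical) (affineCurve a) (affineCurve b) =
        -coneMass θ * ∑ᶠ p ∈ {p : ℝ × ℝ | p.1 ∈ Ico (0 : ℝ) 1 ∧ p.2 ∈ Ico (0 : ℝ) 1 ∧
          (a 0 p.1 = b 0 p.2 ∧ a 1 p.1 = b 1 p.2 ∧ b 2 p.2 < a 2 p.1)},
          (SignType.sign (deriv (a 0) p.1 * deriv (b 1) p.2 - deriv (a 1) p.1 * deriv (b 0) p.2)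
            : ℝ) := by
  have hX := isLoop_affineCurve ha pa
  have hY := isLoop_affineCurve hb pb
  have hXY := indepCurves_affineCurve hab
  have shift : ∀ {c : ℝ → ℝ}, Function.Periodic c 1 → ∀ (x : ℝ) (m : ℤ), c (x + m) = c x :=
    fun hc x m => by simpa using hc.int_mul m x
  have hfract : ∀ {c : ℝ → ℝ}, Function.Periodic c 1 → ∀ x : ℝ, c (Int.fract x) = c x :=
    fun hc x => by rw [← shift hc (Int.fract x) ⌊x⌋, Int.fract_add_floor]
  have hred : ∀ s t, a 0 s = b 0 t → a 1 s = b 1 t → (Int.fract s, Int.fract t) ∈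
      {p : ℝ × ℝ | p.1 ∈ Ico (0 : ℝ) 1 ∧ p.2 ∈ Ico (0 : ℝ) 1 ∧
        (a 0 p.1 = b 0 p.2 ∧ a 1 p.1 = b 1 p.2)} := fun s t h0 h1 =>
    ⟨⟨Int.fract_nonneg s, Int.fract_lt_one s⟩, ⟨Int.fract_nonneg t, Int.fract_lt_one t⟩, by
      simp only [hfract (pa _), hfract (pb _)]; exact ⟨h0, h1⟩⟩
  have havoid : ∀ T : Set ℝ, T.Finite → ∃ s₀ ∈ Ico (0 : ℝ) 1, s₀ ∉ T := fun T hT =>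
    ((Ico_infinite zero_lt_one).sdiff hT).nonempty
  -- the window avoids the crossings
  obtain ⟨s₀, hs₀, hs₀'⟩ : ∃ s₀ ∈ Ico (0 : ℝ) 1, ∀ s t, a 0 s = b 0 t → a 1 s = b 1 t →
      ∀ m : ℤ, s ≠ s₀ + m := by
    obtain ⟨s₀, h, h'⟩ := havoid _ (hfin.image Prod.fst)
    refine ⟨s₀, h, fun s t h0 h1 m e => h' ⟨_, hred s t h0 h1, ?_⟩⟩
    simp [e, Int.fract_eq_self.2 h]
  obtain ⟨t₀, ht₀, ht₀'⟩ : ∃ t₀ ∈ Ico (0 : ℝ) 1, ∀ s t, a 0 s = b 0 t → a 1 s = b 1 t →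
      ∀ m : ℤ, t ≠ t₀ + m := by
    obtain ⟨t₀, h, h'⟩ := havoid _ (hfin.image Prod.snd)
    refine ⟨t₀, h, fun s t h0 h1 m e => h' ⟨_, hred s t h0 h1, ?_⟩⟩
    simp [e, Int.fract_eq_self.2 h]
  have dper : ∀ {c : ℝ → ℝ}, Function.Periodic c 1 → Function.Periodic (deriv c) 1 :=
    fun hc x => by
      rw [← deriv_comp_add_const]
      congr 1
      exact funext hc
  rw [finsum_periodic_eq (s₀ := s₀) (t₀ := t₀) (fun p m n => by
    simp only [shift (dper (pa _)), shift (dper (pb _))]) (fun p m n => by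
    simp only [shift (pa _), shift (pb _)])]
  set S : Set (ℝ × ℝ) := {p : ℝ × ℝ | p.1 ∈ Ico s₀ (s₀ + 1) ∧ p.2 ∈ Ico t₀ (t₀ + 1) ∧
          (a 0 p.1 = b 0 p.2 ∧ a 1 p.1 = b 1 p.2 ∧ b 2 p.2 < a 2 p.1)} with hS
  have hinj : ∀ {u x y : ℝ}, x ∈ Ico u (u + 1) → y ∈ Ico u (u + 1) →
      Int.fract x = Int.fract y → x = y := fun {u x y} hx hy h => by
    obtain ⟨z, hz⟩ := Int.fract_eq_fract.1 h
    have h1 : z < 1 := by exact_mod_cast (by linarith [hx.2, hy.1] : (z : ℝ) < 1)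
    have h2 : -1 < z := by exact_mod_cast (by linarith [hx.1, hy.2] : (-1 : ℝ) < z)
    have h3 : z = 0 := by omega
    rw [h3] at hz
    push_cast at hz
    linarith
  have hSfin : S.Finite := by
    refine Set.Finite.of_injOn (f := fun p : ℝ × ℝ => (Int.fract p.1, Int.fract p.2))
      (fun p hp => hred _ _ hp.2.2.1 hp.2.2.2.1) (fun p hp q hq h => ?_) hfin
    obtain ⟨h1, h2⟩ := Prod.ext_iff.1 h
    exact Prod.ext (hinj hp.1 hq.1 h1) (hinj hp.2.1 hq.2.1 h2)
  set P := hSfin.toFinset with hP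
  have hPm : ∀ p ∈ P, p ∈ S := fun p hp => hSfin.mem_toFinset.1 hp
  set X := affineCurve a
  set Y := affineCurve b
  set B : Set (ℝ × ℝ × ℝ) := Ioc s₀ (s₀ + 1) ×ˢ Ioc t₀ (t₀ + 1) ×ˢ Ioc (0 : ℝ) 1 with hB
  obtain ⟨U, hU, hUd⟩ := hSfin.t2_separation
  have cch : Continuous (chord X Y) := (contDiff_chord hX hY).continuous
  have cch2 : Continuous fun x => chord X Y x 2 := by fun_prop
  -- The sets U p keep the neighbourhoods of different crossings disjoint, and each fits into the
  -- window because no crossing lies on its edge. Upward chords are needed to pass to the chart.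
  have nbhd : ∀ p ∈ P, ∃ N ⊆ {x : ℝ × ℝ × ℝ | (x.1, x.2.1) ∈ U p ∧ x ∈ B ∧ 0 < chord X Y x 2},
      IsOpen N ∧ (p.1, p.2, 1 / 2) ∈ N ∧ (∀ x ∈ N, DifferentiableAt ℝ (chordChart X Y) x) ∧
      ∃ ε > 0, ∀ Ψ : ℝ × ℝ × ℝ → ℝ, (∀ q, ε ≤ ‖q‖ → Ψ q = 0) →
      ∫ x in N, Ψ (chordChart X Y x) * (fderiv ℝ (chordChart X Y) x).det =
        (SignType.sign (fderiv ℝ (chordChart X Y) (p.1, p.2, 1 / 2)).det : ℝ) * ∫ q, Ψ q := by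
    intro p hp
    have i2 : (volume : Measure (ℝ × ℝ)).IsAddHaarMeasure :=
      Measure.prod.instIsAddHaarMeasure (volume : Measure ℝ) (volume : Measure ℝ)
    have i3 : (volume : Measure (ℝ × ℝ × ℝ)).IsAddHaarMeasure :=
      Measure.prod.instIsAddHaarMeasure (volume : Measure ℝ) (volume : Measure (ℝ × ℝ))
    obtain ⟨h1, h2, h3, h4, h5⟩ := hPm p hp
    have pos : 0 < chord X Y (p.1, p.2, 1 / 2) 2 := by
      rw [chord_affineCurve]; simp; linarith
    refine exists_nhds_integral_comp_mul_det volume (contDiffAt_chordChart hX hY pos.ne') ?_ ?_ ?_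
    · simp only [chordChart, X, Y, chord_affineCurve]
      simp [h3, h4]
      constructor <;> left <;> ring
    · rw [← sign_ne_zero, det_chordChart_sign ha hb pa pb h3 h4 h5]
      have := sign_ne_zero.2 (htr _ _ h3 h4)
      revert this
      generalize SignType.sign
        (deriv (a 0) p.1 * deriv (b 1) p.2 - deriv (a 1) p.1 * deriv (b 0) p.2) = σ
      revert σ
      decide
    · refine Filter.Eventually.and ?_ (Filter.Eventually.and ?_ ?_)
      · have c : Continuous fun x : ℝ × ℝ × ℝ => (x.1, x.2.1) := by fun_prop
        exact c.continuousAt.eventually_mem ((hU p).2.mem_nhds (hU p).1)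
      · refine prod_mem_nhds (Ioc_mem_nhds ?_ h1.2) (prod_mem_nhds (Ioc_mem_nhds ?_ h2.2)
          (Ioc_mem_nhds (by norm_num) (by norm_num)))
        · exact lt_of_le_of_ne h1.1 fun h => hs₀' _ _ h3 h4 0 (by simp [h])
        · exact lt_of_le_of_ne h2.1 fun h => ht₀' _ _ h3 h4 0 (by simp [h])
      · exact cch2.continuousAt.eventually_const_lt pos
  choose! N hN hNo hzN hNd ε hε hint using nbhd
  have hκ1 : ∀ᶠ κ in 𝓝[<] (1 : ℝ), ∀ p ∈ P, (Real.sqrt (1 + ε p ^ 2))⁻¹ ≤ κ :=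
    (Filter.eventually_all_finset P).2 fun p hp => eventually_inv_sqrt_le (hε p hp)
  -- Outside the chosen neighbourhoods no chord points vertically upwards, so by compactness the
  -- cosine has a maximum below 1 and the kernel vanishes there for κ close to 1.
  have hκ2 : ∀ᶠ κ in 𝓝[<] (1 : ℝ), ∀ x ∈ B, (∀ p ∈ P, x ∉ N p) →
      inner ℝ vertical (chord X Y x) / ‖chord X Y x‖ ≤ κ := by
    set C : Set (ℝ × ℝ × ℝ) := (Icc s₀ (s₀ + 1) ×ˢ Icc t₀ (t₀ + 1) ×ˢ Icc (0 : ℝ) 1) \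
      ⋃ p ∈ P, N p with hC
    have hCc : IsCompact C := (isCompact_Icc.prod (isCompact_Icc.prod isCompact_Icc)).diff
      (isOpen_biUnion fun p hp => hNo p hp)
    have hne : ∀ x ∈ C, ‖chord X Y x‖ ≠ 0 := fun x hx =>
      norm_ne_zero_iff.2 (hXY x.1 x.2.1 x.2.2 hx.1.2.2)
    have hcont : ContinuousOn (fun x => inner ℝ vertical (chord X Y x) / ‖chord X Y x‖) C :=
      ContinuousOn.div (by fun_prop) (by fun_prop) hne
    have hlt : ∀ x ∈ C, inner ℝ vertical (chord X Y x) / ‖chord X Y x‖ < 1 := by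
      rintro ⟨s, t, r⟩ hx
      rw [div_lt_one ((norm_nonneg _).lt_of_ne' (hne _ hx)), inner_vertical]
      -- Equality in Cauchy–Schwarz: the chord is vertical, hence r = 1/2 and the parameters form a
      -- crossing with the first curve above.
      by_contra! hle
      have hn : ‖chord X Y (s, t, r)‖ ^ 2 = chord X Y (s, t, r) 0 ^ 2 + chord X Y (s, t, r) 1 ^ 2 +
          chord X Y (s, t, r) 2 ^ 2 + chord X Y (s, t, r) 3 ^ 2 := by
        rw [EuclideanSpace.norm_sq_eq, Fin.sum_univ_four]
        simp
      have hpos : 0 < chord X Y (s, t, r) 2 := ((norm_nonneg _).lt_of_ne' (hne _ hx)).trans_le hle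
      have hsq : ‖chord X Y (s, t, r)‖ ^ 2 ≤ chord X Y (s, t, r) 2 ^ 2 :=
        pow_le_pow_left₀ (norm_nonneg _) hle 2
      have z0 : chord X Y (s, t, r) 0 = 0 := by
        rw [← sq_eq_zero_iff]
        nlinarith [sq_nonneg (chord X Y (s, t, r) 0), sq_nonneg (chord X Y (s, t, r) 1),
          sq_nonneg (chord X Y (s, t, r) 3)]
      have z1 : chord X Y (s, t, r) 1 = 0 := by
        rw [← sq_eq_zero_iff]
        nlinarith [sq_nonneg (chord X Y (s, t, r) 0), sq_nonneg (chord X Y (s, t, r) 1),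
          sq_nonneg (chord X Y (s, t, r) 3)]
      have z3 : chord X Y (s, t, r) 3 = 0 := by
        rw [← sq_eq_zero_iff]
        nlinarith [sq_nonneg (chord X Y (s, t, r) 0), sq_nonneg (chord X Y (s, t, r) 1),
          sq_nonneg (chord X Y (s, t, r) 3)]
      simp only [X, Y, chord_affineCurve] at z0 z1 z3 hpos
      simp at z0 z1 z3 hpos
      have hr : r = 1 / 2 := by linarith
      subst hr
      have h0 : a 0 s = b 0 t := by linarith
      have h1 : a 1 s = b 1 t := by linarith
      obtain ⟨⟨hs, ht, -⟩, hU'⟩ := hx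
      -- The compact box includes the right edges, which S omits; the integer shift 1 in the choice
      -- of s₀ and t₀ excludes crossings there.
      have hmem : ((s, t) : ℝ × ℝ) ∈ S :=
        ⟨⟨hs.1, lt_of_le_of_ne hs.2 fun h => hs₀' _ _ h0 h1 1 (by simpa using h)⟩,
          ⟨ht.1, lt_of_le_of_ne ht.2 fun h => ht₀' _ _ h0 h1 1 (by simpa using h)⟩, h0, h1, by
          show b 2 t < a 2 s
          linarith⟩
      exact hU' (mem_biUnion (hSfin.mem_toFinset.2 hmem) (hzN _ (hSfin.mem_toFinset.2 hmem)))
    have hBC : ∀ x ∈ B, (∀ p ∈ P, x ∉ N p) → x ∈ C := fun x hx h =>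
      ⟨Set.prod_mono Ioc_subset_Icc_self (Set.prod_mono Ioc_subset_Icc_self Ioc_subset_Icc_self) hx, by
        simpa using h⟩
    rcases C.eq_empty_or_nonempty with h | h
    · exact Eventually.of_forall fun κ x hx hx' => by
        have := hBC x hx hx'
        rw [h] at this
        exact this.elim
    · obtain ⟨x₀, hx₀, hmax⟩ := hCc.exists_isMaxOn h hcont
      filter_upwards [nhdsWithin_le_nhds (lt_mem_nhds (hlt x₀ hx₀))] with κ hκ x hx hx'
      exact (hmax (hBC x hx hx')).trans hκ.le
  filter_upwards [hκ1, hκ2] with κ h1 h2 θ hθ hθ0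
  obtain ⟨int, e⟩ := linkInt_eq_setIntegral (isKernel_coneKernel hθ vertical) hX hY hXY s₀ t₀
  rw [e, setIntegral_eq_sum_of_eq_zero (P := P) (N := N)
    (measurableSet_Ioc.prod (measurableSet_Ioc.prod measurableSet_Ioc)) int
    (fun p hp => (hNo p hp).measurableSet) (fun p hp x hx => (hN p hp hx).2.1) ?_ ?_]
  · rw [finsum_mem_eq_finite_toFinset_sum _ hSfin, Finset.mul_sum]
    refine Finset.sum_congr rfl fun p hp => ?_
    obtain ⟨_, _, h3, h4, h5⟩ := hPm p hp
    have := hint p hp (fun q => coneKernel θ vertical !₂[q.1, q.2.1, 1, q.2.2])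
      fun q hq => coneKernel_chart_eq_zero hθ0 (hε p hp).le (h1 p hp) hq
    rw [det_chordChart_sign ha hb pa pb h3 h4 h5] at this
    rw [← setIntegral_congr_fun (hNo p hp).measurableSet, this, coneMass]
    · push_cast; ring
    · intro x hx
      have pos := (hN p hp hx).2.2
      have k := det_fderiv_chord_chart hX hY pos.ne'
      simp only
      rw [coneKernel_chord θ pos]
      have k' : (fderiv ℝ (chordChart X Y) x).det * chord X Y x 2 ^ 4 =
        x.2.2 * (1 - x.2.2) * det4 (X x.1) (Y x.2.1) (deriv X x.1) (deriv Y x.2.1) := k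
      have : x.2.2 * (1 - x.2.2) * (coneKernel θ vertical
          !₂[(chordChart X Y x).1, (chordChart X Y x).2.1, 1, (chordChart X Y x).2.2] /
          chord X Y x 2 ^ 4) * det4 (X x.1) (Y x.2.1) (deriv X x.1) (deriv Y x.2.1) =
          coneKernel θ vertical
          !₂[(chordChart X Y x).1, (chordChart X Y x).2.1, 1, (chordChart X Y x).2.2] /
          chord X Y x 2 ^ 4 * ((fderiv ℝ (chordChart X Y) x).det * chord X Y x 2 ^ 4) := by
        rw [k']; ring
      rw [this]
      have := (pow_pos pos 4).ne'
      field_simp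
  · intro p hp q hq hpq
    refine disjoint_left.2 fun x hx hx' => ?_
    exact disjoint_left.1 (hUd (hPm p hp) (hPm q hq) hpq) (hN p hp hx).1 (hN q hq hx').1
  · intro x hx hx'
    rw [coneKernel, hθ0 _ (h2 x hx hx')]
    simp

end Count

end

end KnotTheory

namespace KnotTheory

noncomputable section

/-! ### The linking number of two curves -/

/-- The linking integrals of the two curves for all kernels concentrated near their axis are those
of linking number `n`. -/
def HasLinkNumber (X Y : ℝ → E4) (n : ℤ) : Prop :=
  ∀ᶠ κ in 𝓝[<] (1 : ℝ), ∀ θ : ℝ → ℝ, ContDiff ℝ 1 θ → (∀ x ≤ κ, θ x = 0) →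
    linkInt (coneKernel θ vertical) X Y = -coneMass θ * n

/-- Provides a kernel of nonzero mass, so that `HasLinkNumber` determines its integer. The profile
rises smoothly from 0 at κ to 1 at 1, and the bound on κ makes its support in the chart compact. -/
theorem eventually_exists_coneMass_pos : ∀ᶠ κ in 𝓝[<] (1 : ℝ), ∃ θ : ℝ → ℝ, ContDiff ℝ 1 θ ∧
    (∀ x ≤ κ, θ x = 0) ∧ 0 < coneMass θ := by
  filter_upwards [eventually_inv_sqrt_le one_pos, self_mem_nhdsWithin] with κ hκ hκ1
  have h1 : 0 < 1 - κ := by linarith [mem_Iio.1 hκ1]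
  set θ : ℝ → ℝ := fun x => Real.smoothTransition ((x - κ) / (1 - κ)) with hθ
  have hc : ContDiff ℝ 1 θ := (Real.smoothTransition.contDiff (n := 1)).comp
    ((contDiff_id.sub contDiff_const).div_const _)
  have h0 : ∀ x ≤ κ, θ x = 0 := fun x hx => Real.smoothTransition.zero_of_nonpos
    (div_nonpos_of_nonpos_of_nonneg (by linarith) h1.le)
  refine ⟨θ, hc, h0, ?_⟩
  have hv : ∀ q : ℝ × ℝ × ℝ, ‖(!₂[q.1, q.2.1, 1, q.2.2] : E4)‖ ≠ 0 := fun q h => by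
    have := norm_sq_chart q
    rw [h] at this
    nlinarith [sq_nonneg q.1, sq_nonneg q.2.1, sq_nonneg q.2.2]
  have hcv : Continuous fun q : ℝ × ℝ × ℝ => (!₂[q.1, q.2.1, 1, q.2.2] : E4) := by
    refine (PiLp.continuous_toLp 2 _).comp (continuous_pi fun i => ?_)
    fin_cases i <;> simp <;> fun_prop
  refine Continuous.integral_pos_of_hasCompactSupport_nonneg_nonzero (x := 0) ?_ ?_ ?_ ?_
  · unfold coneKernel
    refine Continuous.div (hc.continuous.comp (Continuous.div ?_ hcv.norm hv)) (hcv.norm.pow 4)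
      fun q => pow_ne_zero 4 (hv q)
    exact continuous_const.inner hcv
  · refine HasCompactSupport.intro (isCompact_closedBall 0 1) fun q hq => ?_
    refine coneKernel_chart_eq_zero h0 zero_le_one hκ ?_
    rw [mem_closedBall_zero_iff] at hq
    linarith
  · intro q
    exact div_nonneg (Real.smoothTransition.nonneg _) (pow_nonneg (norm_nonneg _) 4)
  · have e := norm_sq_chart 0
    simp only [Prod.fst_zero, Prod.snd_zero] at e
    have e1 : ‖(!₂[0, 0, 1, 0] : E4)‖ = 1 := by
      rw [← sq_eq_sq₀ (norm_nonneg _) zero_le_one, e]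
      norm_num
    simp only [coneKernel, Prod.fst_zero, Prod.snd_zero, e1, inner_vertical, hθ]
    have : (1 - κ) / (1 - κ) = 1 := div_self h1.ne'
    simp [this]

theorem HasLinkNumber.unique {X Y : ℝ → E4} {m n : ℤ} (hm : HasLinkNumber X Y m)
    (hn : HasLinkNumber X Y n) : m = n := by
  obtain ⟨κ, h1, h2, θ, hθ, h0, hpos⟩ := (hm.and (hn.and eventually_exists_coneMass_pos)).exists
  have e := (h1 θ hθ h0).symm.trans (h2 θ hθ h0)
  exact_mod_cast mul_left_cancel₀ (neg_ne_zero.2 hpos.ne') e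

theorem HasLinkNumber.congr {X Y X' Y' : ℝ → E4} {n : ℤ} (h : HasLinkNumber X Y n)
    (e : ∀ k, IsKernel k → linkInt k X' Y' = linkInt k X Y) : HasLinkNumber X' Y' n := by
  filter_upwards [h] with κ hκ θ hθ h0
  rw [e _ (isKernel_coneKernel hθ _), hκ θ hθ h0]

/-- Exchanging the curves turns the axis of the kernel upside down, and independence of the axis
turns it back. For diagrams this equates the counts of over- and under-crossings. -/
theorem HasLinkNumber.symm {X Y : ℝ → E4} {n : ℤ} (hX : IsLoop X) (hY : IsLoop Y)
    (hXY : IndepCurves X Y) (h : HasLinkNumber X Y n) : HasLinkNumber Y X n := by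
  filter_upwards [h] with κ hκ θ hθ h0
  rw [linkInt_swap (isKernel_coneKernel hθ _) hY hX hXY.symm, ← hκ θ hθ h0]
  simp only [coneKernel_neg]
  exact linkInt_coneKernel_eq hθ (by rw [norm_neg, norm_vertical]) norm_vertical hX hY hXY

/-! ### Diagrams and the linking number -/

/-- The knot as a curve in Euclidean space. -/
def Knot.curve (K : Knot) (t : ℝ) : E4 := K t

theorem Knot.isLoop (K : Knot) : IsLoop K.curve where
  periodic t := by simp only [Knot.curve, K.periodic t]
  contDiff := K.smooth.of_le (by exact_mod_cast le_top)

theorem Knot.norm_curve (K : Knot) (t : ℝ) : ‖K.curve t‖ = 1 := norm_eq_of_mem_sphere (K t)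

theorem Knot.Disjoint.curve_ne {J K : Knot} (h : J.Disjoint K) (s t : ℝ) :
    J.curve s ≠ K.curve t := Subtype.coe_ne_coe.2 (h s t)

theorem Knot.Disjoint.symm {J K : Knot} (h : J.Disjoint K) : K.Disjoint J :=
  fun s t => (h t s).symm

theorem Knot.Disjoint.indepCurves {J K : Knot} (h : J.Disjoint K) :
    IndepCurves J.curve K.curve := fun s t =>
  mem_indepPairs_of_norm (J.norm_curve s) (K.norm_curve t) (h.curve_ne s t)

/-- The coordinates of the stereographic image of the knot. -/
def stereoCurve (A : Rotation) (K : Knot) (i : Fin 3) (t : ℝ) : ℝ := stereo A (K t) i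

theorem Rotation.transpose_mul_self (A : Rotation) : A.1.transpose * A.1 = 1 :=
  (Matrix.mem_orthogonalGroup_iff' _ _).1 (Matrix.mem_specialOrthogonalGroup_iff.1 A.2).1

theorem Rotation.det_eq_one (A : Rotation) : A.1.det = 1 :=
  (Matrix.mem_specialOrthogonalGroup_iff.1 A.2).2

theorem matMap_curve_apply (A : Rotation) (K : Knot) (t : ℝ) (i : Fin 4) :
    matMap A.1 (K.curve t) i = rotate A (K t) i := rfl

theorem contDiff_rotate (A : Rotation) (K : Knot) (i : Fin 4) :
    ContDiff ℝ ∞ fun t => rotate A (K t) i :=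
  contDiff_euclidean.1 ((matMap A.1).contDiff.comp K.smooth) i

theorem contDiff_stereoCurve {A : Rotation} {K : Knot} (hK : ∀ t, rotate A (K t) 3 ≠ 1) (i : Fin 3) :
    ContDiff ℝ ∞ (stereoCurve A K i) :=
  (contDiff_rotate A K i.castSucc).div (contDiff_const.sub (contDiff_rotate A K 3)) fun t =>
    sub_ne_zero.2 (hK t).symm

theorem periodic_stereoCurve (A : Rotation) (K : Knot) (i : Fin 3) :
    Function.Periodic (stereoCurve A K i) 1 := fun t => by
  simp only [stereoCurve, K.periodic t]

theorem hasDerivAt_shadow {A : Rotation} {K : Knot} (hK : ∀ t, rotate A (K t) 3 ≠ 1) (t : ℝ) :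
    HasDerivAt (shadow A K) (deriv (stereoCurve A K 0) t, deriv (stereoCurve A K 1) t) t :=
  HasDerivAt.prodMk
    ((contDiff_stereoCurve hK 0).differentiable (by simp) t).hasDerivAt
    ((contDiff_stereoCurve hK 1).differentiable (by simp) t).hasDerivAt

theorem rotate_lt_one {A : Rotation} {K : Knot} (hK : ∀ t, rotate A (K t) 3 ≠ 1) (t : ℝ) :
    rotate A (K t) 3 < 1 := by
  refine lt_of_le_of_ne ?_ (hK t)
  have h := PiLp.norm_apply_le (matMap A.1 (K.curve t)) 3
  rw [norm_matMap A.transpose_mul_self, K.norm_curve, matMap_curve_apply, Real.norm_eq_abs] at h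
  exact (le_abs_self _).trans h

theorem rotate_sub_pole {A : Rotation} {K : Knot} (hK : ∀ t, rotate A (K t) 3 ≠ 1) (t : ℝ) :
    matMap A.1 (K.curve t) - pole =
      (1 - rotate A (K t) 3) • affineCurve (stereoCurve A K) t := by
  have h : 1 - rotate A (K t) 3 ≠ 0 := sub_ne_zero.2 (hK t).symm
  ext i
  rw [PiLp.sub_apply, matMap_curve_apply]
  fin_cases i <;> simp [affineCurve, stereoCurve, stereo, pole, mul_div_cancel₀ _ h]

section Diagram

variable {A : Rotation} {J K : Knot} (hJ : ∀ t, rotate A (J t) 3 ≠ 1)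
  (hK : ∀ t, rotate A (K t) 3 ≠ 1) (hJK : J.Disjoint K)

include hJ hK hJK in
-- Equal stereographic images would put two distinct points of the sphere on one ray from the pole,
-- contrary to `mem_indepPairs_sub_pole` at σ = 1.
theorem stereoCurve_ne (s t : ℝ) (h0 : stereoCurve A J 0 s = stereoCurve A K 0 t)
    (h1 : stereoCurve A J 1 s = stereoCurve A K 1 t) :
    stereoCurve A J 2 s ≠ stereoCurve A K 2 t := by
  intro h2
  have e : affineCurve (stereoCurve A J) s = affineCurve (stereoCurve A K) t := by
    simp [affineCurve, h0, h1, h2]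
  have ne : (matMap A.1 (J.curve s), matMap A.1 (K.curve t)) ∈ indepPairs := by
    refine mem_indepPairs_matMap (fun v hv => ?_) (hJK.indepCurves s t)
    rw [← norm_eq_zero, ← norm_matMap A.transpose_mul_self, hv, norm_zero]
  have hp : ∀ {L : Knot}, (∀ t, rotate A (L t) 3 ≠ 1) → ∀ t, matMap A.1 (L.curve t) ≠ pole := by
    intro L hL t h
    apply hL t
    rw [← matMap_curve_apply, h]
    simp [pole]
  have hn : ∀ (L : Knot) t, ‖matMap A.1 (L.curve t)‖ = 1 := fun L t => by
    rw [norm_matMap A.transpose_mul_self, L.norm_curve]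
  have key := mem_indepPairs_sub_pole (hn J s) (hn K t) (hp hJ s) (hp hK t) (fun h => by
    rw [h] at ne
    exact ne (1 / 2) (by norm_num) (by module)) (σ := 1) (by norm_num)
  rw [one_smul, rotate_sub_pole hJ, rotate_sub_pole hK, e] at key
  have p1 : 0 < 1 - rotate A (J s) 3 := by linarith [rotate_lt_one hJ s]
  have p2 : 0 < 1 - rotate A (K t) 3 := by linarith [rotate_lt_one hK t]
  set x := 1 - rotate A (J s) 3
  set y := 1 - rotate A (K t) 3
  have hs : 0 < x + y := by linarith
  -- The parameter solving (1 - r) x = r y.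
  refine key (x / (x + y)) ⟨by positivity, (div_le_one hs).2 (by linarith)⟩ ?_
  simp only [smul_smul, ← sub_smul]
  have : (1 - x / (x + y)) * x - x / (x + y) * y = 0 := by field_simp; ring
  rw [this, zero_smul]

include hJ hK hJK in
-- Rescaling by the distance to the hyperplane through the pole gives the rotated knots with apex at
-- the pole; moving the apex to the centre and undoing the rotation leaves the original knots with a
-- rotated axis, which does not matter.
theorem linkInt_stereoCurve {θ : ℝ → ℝ} (hθ : ContDiff ℝ 1 θ) :
    linkInt (coneKernel θ vertical) J.curve K.curve =
      linkInt (coneKernel θ vertical) (affineCurve (stereoCurve A J))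
        (affineCurve (stereoCurve A K)) := by
  have hk := isKernel_coneKernel hθ vertical
  have hM := A.transpose_mul_self
  have hp : ∀ {L : Knot}, (∀ t, rotate A (L t) 3 ≠ 1) → ∀ t, matMap A.1 (L.curve t) ≠ pole := by
    intro L hL t h
    apply hL t
    rw [← matMap_curve_apply, h]
    simp [pole]
  have hn : ∀ (L : Knot) t, ‖matMap A.1 (L.curve t)‖ = 1 := fun L t => by
    rw [norm_matMap hM, L.norm_curve]
  have hT : ‖matMap A.1.transpose vertical‖ = 1 := by
    rw [norm_matMap, norm_vertical]
    rw [Matrix.transpose_transpose]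
    exact mul_eq_one_comm.1 hM
  have hl : ∀ {L : Knot}, (∀ t, rotate A (L t) 3 ≠ 1) →
      IsLoop (affineCurve (stereoCurve A L)) := fun hL =>
    isLoop_affineCurve (fun i => (contDiff_stereoCurve hL i).of_le (by exact_mod_cast le_top))
      (periodic_stereoCurve A _)
  have hr : ∀ L : Knot, ContDiff ℝ 1 fun t => 1 - rotate A (L t) 3 := fun L =>
    contDiff_const.sub ((contDiff_rotate A L 3).of_le (by exact_mod_cast le_top))
  have hper : ∀ L : Knot, Function.Periodic (fun t => 1 - rotate A (L t) 3) 1 := fun L t => by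
    simp only [L.periodic t]
  rw [linkInt_smul hk (hl hJ) (hl hK) (indepCurves_affineCurve (stereoCurve_ne hJ hK hJK)) (hr J)
    (hr K) (hper J) (hper K) (fun t => by linarith [rotate_lt_one hJ t])
    (fun t => by linarith [rotate_lt_one hK t])]
  simp only [← rotate_sub_pole hJ, ← rotate_sub_pole hK]
  rw [← linkInt_sub_pole hk (J.isLoop.matMap A.1) (K.isLoop.matMap A.1) (hn J) (hn K) (hp hJ)
    (hp hK), linkInt_orthogonal hθ _ hM J.isLoop K.isLoop hJK.indepCurves, A.det_eq_one, one_mul]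
  · exact linkInt_coneKernel_eq hθ norm_vertical hT J.isLoop K.isLoop hJK.indepCurves
  · intro s t h
    refine hJK.curve_ne s t (sub_eq_zero.1 ?_)
    rw [← norm_eq_zero, ← norm_matMap hM, map_sub, h, sub_self, norm_zero]

end Diagram

/-- The sum of the signs of the crossings at which `J` runs above `K`. -/
def overSum (A : Rotation) (J K : Knot) : ℤ :=
  ∑ᶠ p ∈ {p : ℝ × ℝ | p ∈ crossings A J K ∧ height A K p.2 < height A J p.1},
    (SignType.sign (planeDet (deriv (shadow A J) p.1) (deriv (shadow A K) p.2)) : ℤ)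

/-- The projection is transversal at the crossings between `J` and `K`. -/
structure IsTransversal (A : Rotation) (J K : Knot) : Prop where
  misses_left : ∀ t, rotate A (J t) 3 ≠ 1
  misses_right : ∀ t, rotate A (K t) 3 ≠ 1
  finite : (crossings A J K).Finite
  transversal : ∀ p ∈ crossings A J K,
    planeDet (deriv (shadow A J) p.1) (deriv (shadow A K) p.2) ≠ 0

theorem swap_mem_crossings {A : Rotation} {J K : Knot} {p : ℝ × ℝ} :
    p.swap ∈ crossings A K J ↔ p ∈ crossings A J K :=
  ⟨fun h => ⟨h.2.1, h.1, h.2.2.symm⟩, fun h => ⟨h.2.1, h.1, h.2.2.symm⟩⟩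

theorem planeDet_swap (v w : ℝ × ℝ) : planeDet w v = -planeDet v w := by
  unfold planeDet; ring

theorem IsTransversal.symm {A : Rotation} {J K : Knot} (h : IsTransversal A J K) :
    IsTransversal A K J where
  misses_left := h.misses_right
  misses_right := h.misses_left
  finite := h.finite.of_injOn (f := Prod.swap) (fun _ hp => swap_mem_crossings.2 hp)
    Prod.swap_injective.injOn
  transversal p hp := by
    rw [planeDet_swap]
    exact neg_ne_zero.2 (h.transversal p.swap (swap_mem_crossings.2 hp))

theorem IsDiagram.isTransversal {A : Rotation} {J K : Knot} (h : IsDiagram A ![J, K]) :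
    IsTransversal A J K := by
  have key : ∀ p ∈ crossings A J K,
      (((0 : Fin 2), p.1), ((1 : Fin 2), p.2)) ∈ doublePoints A ![J, K] := fun p hp =>
    ⟨hp.1, hp.2.1, fun e => zero_ne_one (congrArg Prod.fst e), hp.2.2⟩
  have hinj : Function.Injective fun p : ℝ × ℝ => (((0 : Fin 2), p.1), ((1 : Fin 2), p.2)) :=
    fun p q e => Prod.ext (congrArg (fun x => x.1.2) e) (congrArg (fun x => x.2.2) e)
  refine ⟨h.misses_pole 0, h.misses_pole 1, ?_, ?_⟩
  · exact Set.Finite.of_injOn key hinj.injOn h.finite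
  · intro p hp
    have := h.transversal _ (key p hp)
    exact this

section Transversal

variable {A : Rotation} {J K : Knot} (h : IsTransversal A J K) (hJK : J.Disjoint K)

include h hJK in
theorem IsTransversal.height_ne {p : ℝ × ℝ} (hp : p ∈ crossings A J K) :
    height A J p.1 ≠ height A K p.2 :=
  stereoCurve_ne h.misses_left h.misses_right hJK _ _ (congrArg Prod.fst hp.2.2)
    (congrArg Prod.snd hp.2.2)

include h hJK in
theorem IsTransversal.hasLinkNumber : HasLinkNumber J.curve K.curve (overSum A J K) := by
  have hc : ∀ {L : Knot}, (∀ t, rotate A (L t) 3 ≠ 1) → ∀ i, ContDiff ℝ 1 (stereoCurve A L i) :=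
    fun hL i => (contDiff_stereoCurve hL i).of_le (by exact_mod_cast le_top)
  have hd1 : ∀ t, deriv (shadow A J) t = _ := fun t => (hasDerivAt_shadow h.misses_left t).deriv
  have hd2 : ∀ t, deriv (shadow A K) t = _ := fun t => (hasDerivAt_shadow h.misses_right t).deriv
  have hcr : ∀ s t, stereoCurve A J 0 s = stereoCurve A K 0 t →
      stereoCurve A J 1 s = stereoCurve A K 1 t → shadow A J s = shadow A K t :=
    fun s t h0 h1 => Prod.ext h0 h1
  have hper : ∀ {f : ℝ → ℝ}, Function.Periodic f 1 → ∀ t, f (Int.fract t) = f t := fun hf t => by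
    conv_rhs => rw [← Int.fract_add_floor t]
    simpa using (hf.int_mul ⌊t⌋ (Int.fract t)).symm
  have hdper : ∀ {f : ℝ → ℝ}, Function.Periodic f 1 → Function.Periodic (deriv f) 1 := fun hf x => by
    rw [← deriv_comp_add_const]
    congr 1
    exact funext hf
  have pJ := periodic_stereoCurve A J
  have pK := periodic_stereoCurve A K
  have := exists_linkInt_affineCurve_eq (hc h.misses_left) (hc h.misses_right) pJ pK
    (stereoCurve_ne h.misses_left h.misses_right hJK) (fun s t h0 h1 => by
      have := h.transversal (Int.fract s, Int.fract t)
        ⟨⟨Int.fract_nonneg s, Int.fract_lt_one s⟩, ⟨Int.fract_nonneg t, Int.fract_lt_one t⟩,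
          hcr _ _ (by rw [hper (pJ 0), hper (pK 0), h0]) (by rw [hper (pJ 1), hper (pK 1), h1])⟩
      simpa only [hd1, hd2, planeDet, hper (hdper (pJ _)), hper (hdper (pK _))] using this)
    (h.finite.subset fun p hp => ⟨hp.1, hp.2.1, hcr _ _ hp.2.2.1 hp.2.2.2⟩)
  filter_upwards [this] with κ hκ θ hθ h0
  rw [linkInt_stereoCurve h.misses_left h.misses_right hJK hθ, hκ θ hθ h0, overSum]
  congr 1
  have hset : {p : ℝ × ℝ | p ∈ crossings A J K ∧ height A K p.2 < height A J p.1} =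
      {p : ℝ × ℝ | p.1 ∈ Ico (0 : ℝ) 1 ∧ p.2 ∈ Ico (0 : ℝ) 1 ∧
        (stereoCurve A J 0 p.1 = stereoCurve A K 0 p.2 ∧
          stereoCurve A J 1 p.1 = stereoCurve A K 1 p.2 ∧
          stereoCurve A K 2 p.2 < stereoCurve A J 2 p.1)} := by
    ext p
    constructor
    · exact fun hp => ⟨hp.1.1, hp.1.2.1, congrArg Prod.fst hp.1.2.2, congrArg Prod.snd hp.1.2.2,
        hp.2⟩
    · exact fun hp => ⟨⟨hp.1, hp.2.1, hcr _ _ hp.2.2.1 hp.2.2.2.1⟩, hp.2.2.2.2⟩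
  have e := AddMonoidHom.map_finsum_mem (fun p : ℝ × ℝ =>
    (SignType.sign (planeDet (deriv (shadow A J) p.1) (deriv (shadow A K) p.2)) : ℤ))
    (Int.castAddHom ℝ) (h.finite.subset fun p hp => hp.1 :
      {p : ℝ × ℝ | p ∈ crossings A J K ∧ height A K p.2 < height A J p.1}.Finite)
  rw [Int.coe_castAddHom] at e
  refine Eq.trans ?_ e.symm
  refine finsum_mem_congr hset.symm fun p _ => ?_
  simp [hd1, hd2, planeDet]

include h hJK in
-- Crossings are split according to the upper strand. The sign convention always puts the upper
-- strand first, so those with K above form the over-sum of the exchanged pair.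
theorem IsTransversal.crossingSum_eq : crossingSum A J K = overSum A J K + overSum A K J := by
  have hsplit : crossings A J K =
      {p : ℝ × ℝ | p ∈ crossings A J K ∧ height A K p.2 < height A J p.1} ∪
      {p : ℝ × ℝ | p ∈ crossings A J K ∧ height A J p.1 < height A K p.2} := by
    ext p
    constructor
    · intro hp
      rcases lt_or_gt_of_ne (h.height_ne hJK hp) with h1 | h1
      exacts [Or.inr ⟨hp, h1⟩, Or.inl ⟨hp, h1⟩]
    · rintro (hp | hp) <;> exact hp.1
  unfold crossingSum
  rw [hsplit, finsum_mem_union (disjoint_left.2 fun p hp hp' => lt_asymm hp.2 hp'.2)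
    (h.finite.subset fun p hp => hp.1) (h.finite.subset fun p hp => hp.1)]
  congr 1
  · refine finsum_mem_congr rfl fun p hp => ?_
    rw [crossingSign, if_pos hp.2]
  · refine finsum_mem_eq_of_bijOn Prod.swap ⟨fun p hp => ⟨swap_mem_crossings.2 hp.1, hp.2⟩,
      Prod.swap_injective.injOn, fun p hp => ⟨p.swap, ⟨swap_mem_crossings.2 hp.1, hp.2⟩,
        p.swap_swap⟩⟩ fun p hp => ?_
    rw [crossingSign, if_neg (not_lt_of_gt hp.2)]
    rfl

include h hJK in
-- Each of the two over-sums is the integer read off from the integrals, the second by exchange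
-- symmetry; hence the factor 2 and the independence of the diagram.
theorem IsTransversal.crossingSum_eq_two_mul {n : ℤ} (hn : HasLinkNumber J.curve K.curve n) :
    crossingSum A J K = 2 * n := by
  rw [h.crossingSum_eq hJK, (h.hasLinkNumber hJK).unique hn,
    ((h.symm.hasLinkNumber hJK.symm).symm K.isLoop J.isLoop hJK.symm.indepCurves).unique hn]
  ring

end Transversal

theorem exists_lk_eq {J K : Knot} (hd : ∃ A, IsDiagram A ![J, K]) :
    ∃ A, IsDiagram A ![J, K] ∧ lk J K = crossingSum A J K / 2 :=
  ⟨hd.choose, hd.choose_spec, by rw [lk, dif_pos hd]⟩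

/-- The crossing sum of the chosen diagram is even, so the integer division in `lk` is exact. -/
theorem hasLinkNumber_lk {J K : Knot} (hJK : J.Disjoint K) (hd : ∃ A, IsDiagram A ![J, K]) :
    HasLinkNumber J.curve K.curve (lk J K) := by
  obtain ⟨A, hA, e⟩ := exists_lk_eq hd
  have hn := hA.isTransversal.hasLinkNumber hJK
  rw [e, hA.isTransversal.crossingSum_eq_two_mul hJK hn]
  simpa using hn

end

end KnotTheory

namespace KnotTheory

noncomputable section

/-! ### Reversal -/

theorem linkInt_comp_neg (h : E4 → ℝ) {X : ℝ → E4} (hX : IsLoop X) (Y : ℝ → E4) :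
    linkInt h (fun t => X (-t)) Y = -linkInt h X Y := by
  have hp : Function.Periodic (fun s => linkForm h Y (X s) (deriv X s)) 1 := fun s => by
    simp only [hX.periodic s, hX.deriv_periodic s]
  unfold linkInt
  have e : ∀ s, linkForm h Y (X (-s)) (deriv (fun t => X (-t)) s) =
      -linkForm h Y (X (-s)) (deriv X (-s)) := fun s => by
    rw [deriv_comp_neg, map_neg]
  simp only [e]
  rw [intervalIntegral.integral_neg, intervalIntegral.integral_comp_neg
    (fun s => linkForm h Y (X s) (deriv X s))]
  -- The substitution leads to the period [-1, 0], which is moved back to [0, 1].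
  have := hp.intervalIntegral_add_eq (-1) 0
  rw [neg_add_cancel, zero_add] at this
  rw [neg_zero, this]

theorem HasLinkNumber.comp_neg_left {X Y : ℝ → E4} (hX : IsLoop X) {n : ℤ}
    (h : HasLinkNumber X Y n) : HasLinkNumber (fun t => X (-t)) Y (-n) := by
  filter_upwards [h] with κ hκ θ hθ h0
  rw [linkInt_comp_neg _ hX, hκ θ hθ h0]
  push_cast
  ring

theorem Knot.Disjoint.reverse_left {J K : Knot} (h : J.Disjoint K) : J.reverse.Disjoint K :=
  fun s t => h (-s) t

theorem HasLinkNumber.reverse_left {J K : Knot} {n : ℤ} (h : HasLinkNumber J.curve K.curve n) :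
    HasLinkNumber J.reverse.curve K.curve (-n) := h.comp_neg_left J.isLoop

theorem HasLinkNumber.reverse_right {J K : Knot} (hJK : J.Disjoint K) {n : ℤ}
    (h : HasLinkNumber J.curve K.curve n) : HasLinkNumber J.curve K.reverse.curve (-n) :=
  (h.symm J.isLoop K.isLoop hJK.indepCurves).reverse_left.symm K.reverse.isLoop J.isLoop
    hJK.symm.reverse_left.indepCurves

/-! ### Ambient isotopy -/

theorem Knot.contMDiff (K : Knot) : ContMDiff 𝓘(ℝ, ℝ) (𝓡 3) ∞ K :=
  K.smooth.contMDiff.codRestrict_sphere fun t => (K t).2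

/-- Every stage of the isotopy is injective, so the moved curves stay disjoint on the sphere and
therefore independent. With the apex at the centre, no point of the sphere has to be avoided on the
way. -/
theorem linkInt_eq_of_isotopy {h : E4 → ℝ} (hh : IsKernel h) {J K J' K' : Knot}
    (hJK : J.Disjoint K) {H : ℝ → Diffeomorph (𝓡 3) (𝓡 3) S3 S3 ∞}
    (hH : ContMDiff (𝓘(ℝ, ℝ).prod (𝓡 3)) (𝓡 3) ∞ (fun p : ℝ × S3 => H p.1 p.2))
    (h0 : ∀ x, H 0 x = x) (hJ : ∀ t, H 1 (J t) = J' t) (hK : ∀ t, H 1 (K t) = K' t) :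
    linkInt h J'.curve K'.curve = linkInt h J.curve K.curve := by
  have hc : ∀ L : Knot, Continuous (Function.uncurry fun τ t => ((H τ (L t) : S3) : E4)) :=
    fun L => continuous_subtype_val.comp (hH.continuous.comp
      (continuous_fst.prodMk (L.contMDiff.continuous.comp continuous_snd)))
  have hl : ∀ (L : Knot) (τ : ℝ), IsLoop fun t => ((H τ (L t) : S3) : E4) := fun L τ =>
    ⟨fun t => by simp only [L.periodic t], by
      have h1 : ContMDiff 𝓘(ℝ, ℝ) 𝓘(ℝ, E4) ∞ fun t => ((H τ (L t) : S3) : E4) :=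
        contMDiff_coe_sphere.comp ((H τ).contMDiff.comp L.contMDiff)
      exact h1.contDiff.of_le (by exact_mod_cast le_top)⟩
  have := linkInt_eq_of_homotopy hh (hc J) (hc K) (hl J) (hl K) (fun τ s t =>
    mem_indepPairs_of_norm (norm_eq_of_mem_sphere _) (norm_eq_of_mem_sphere _) fun e =>
      hJK s t ((H τ).injective (Subtype.coe_injective e))) 1 0
  simp only [hJ, hK, h0] at this
  exact this

/-! ### Crossing changes -/

theorem AmbientIsotopic.disjoint {J K : Knot} {L : Fin 2 → Knot} (h : AmbientIsotopic ![J, K] L)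
    (hJK : J.Disjoint K) : (L 0).Disjoint (L 1) := by
  obtain ⟨H, -, -, h1⟩ := h
  intro s t e
  rw [← h1 0 s, ← h1 1 t] at e
  exact hJK s t ((H 1).injective e)

theorem AmbientIsotopic.hasLinkNumber {J K : Knot} {L : Fin 2 → Knot}
    (h : AmbientIsotopic ![J, K] L) (hJK : J.Disjoint K) {n : ℤ}
    (hn : HasLinkNumber J.curve K.curve n) : HasLinkNumber (L 0).curve (L 1).curve n := by
  obtain ⟨H, hH, h0, h1⟩ := h
  exact hn.congr fun k hk => linkInt_eq_of_isotopy hk hJK hH h0 (h1 0) (h1 1)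

/-- The exchanged crossing has both points on component 0, so at every crossing between the two
components the same strand stays on top. -/
theorem DiffersByCrossingChange.crossingSum_eq {A : Rotation} {L L' : Fin 2 → Knot}
    (h : DiffersByCrossingChange A L L' 0) :
    crossingSum A (L 0) (L 1) = crossingSum A (L' 0) (L' 1) := by
  obtain ⟨-, -, hs, s₀, t₀, -, -, -, hh⟩ := h
  have hs' : ∀ j, shadow A (L j) = shadow A (L' j) := fun j => funext (hs j)
  have hc : crossings A (L 0) (L 1) = crossings A (L' 0) (L' 1) := by
    unfold crossings
    rw [hs', hs']
  refine finsum_mem_congr hc fun p hp => ?_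
  rw [← hc] at hp
  have e : height A (L 1) p.2 < height A (L 0) p.1 ↔ height A (L' 1) p.2 < height A (L' 0) p.1 :=
    hh (1, p.2) (0, p.1) ⟨hp.2.1, hp.1, fun e => one_ne_zero (congrArg Prod.fst e), hp.2.2.symm⟩
      (fun e => one_ne_zero (congrArg (fun x => x.1.1) e))
      (fun e => one_ne_zero (congrArg (fun x => x.1.1) e))
  unfold crossingSign
  rw [hs', hs', if_congr e rfl rfl]

theorem IsCrossingChange.linkNumber_eq {J K M : Knot} (h : IsCrossingChange J K M)
    (hJ : J.Disjoint M) (hK : K.Disjoint M) {m n : ℤ} (hm : HasLinkNumber J.curve M.curve m)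
    (hn : HasLinkNumber K.curve M.curve n) : m = n := by
  obtain ⟨A, L, L', h1, h2, h3⟩ := h
  have e : ∀ L : Fin 2 → Knot, L = ![L 0, L 1] := fun L => by
    funext i
    fin_cases i <;> rfl
  have d1 := h3.1
  have d2 := h3.2.1
  rw [e L] at d1
  rw [e L'] at d2
  have e1 := d1.isTransversal.crossingSum_eq_two_mul (h1.disjoint hJ) (h1.hasLinkNumber hJ hm)
  have e2 := d2.isTransversal.crossingSum_eq_two_mul (h2.disjoint hK) (h2.hasLinkNumber hK hn)
  have := h3.crossingSum_eq
  omega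

end

end KnotTheory

namespace KnotTheory

noncomputable section

/-! ### Connected sums -/

/-- Primitives along two parametrisations of the same path have equal increments. Only continuity of
the parameters is used, which suits the topological disc and the reparametrised arcs. -/
theorem PrimitiveOn.sub_eq_sub {α β : Type*} [TopologicalSpace α] [TopologicalSpace β]
    {η : E4 → E4 →L[ℝ] ℝ} {X : α → E4} {Y : β → E4} {F : α → ℝ} {G : β → ℝ} {S : Set α} {T : Set β}
    (hF : PrimitiveOn η X F S) (hG : PrimitiveOn η Y G T) (hX : ContinuousOn X S) {s t : ℝ}
    (hst : s ≤ t) {γ : ℝ → α} {δ : ℝ → β} (hγ : ContinuousOn γ (Icc s t))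
    (hδ : ContinuousOn δ (Icc s t)) (hγS : MapsTo γ (Icc s t) S) (hδT : MapsTo δ (Icc s t) T)
    (h : ∀ u ∈ Icc s t, X (γ u) = Y (δ u)) : F (γ t) - F (γ s) = G (δ t) - G (δ s) := by
  have h1 := hF.comp hγ hγS
  have h2 := (hG.comp hδ hδT).congr_map (D' := X ∘ γ) fun u hu => (h u hu).symm
  have := h1.sub_eq_const isPreconnected_Icc (hX.comp hγ hγS) h2 (left_mem_Icc.2 hst)
    (right_mem_Icc.2 hst)
  simp only [Function.comp_apply] at this
  linarith

theorem linkInt_eq_sub (h : E4 → ℝ) {X : ℝ → E4} (hX : IsLoop X) {Y : ℝ → E4}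
    (hc : Continuous fun s => linkForm h Y (X s) (deriv X s)) (a : ℝ) :
    linkInt h X Y = (∫ s in (0 : ℝ)..a + 1, linkForm h Y (X s) (deriv X s)) -
      ∫ s in (0 : ℝ)..a, linkForm h Y (X s) (deriv X s) := by
  have hp : Function.Periodic (fun s => linkForm h Y (X s) (deriv X s)) 1 := fun s => by
    simp only [hX.periodic s, hX.deriv_periodic s]
  have := hp.intervalIntegral_add_eq 0 a
  rw [zero_add] at this
  rw [linkInt, this, intervalIntegral.integral_interval_sub_left (hc.intervalIntegrable _ _)
    (hc.intervalIntegrable _ _)]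

theorem exists_affine_param {s t x : ℝ} (h : s < t) (hx : x ∈ Icc s t) :
    ∃ u ∈ Icc (0 : ℝ) 1, x = s + u * (t - s) := by
  have h' : 0 < t - s := by linarith
  exact ⟨(x - s) / (t - s), ⟨div_nonneg (by linarith [hx.1]) h'.le,
    (div_le_one h').2 (by linarith [hx.2])⟩, by field_simp; ring⟩

theorem Traces.mem_range {f g : ℝ → S3} {s t u v : ℝ} (h : Traces f s t g u v) {x : ℝ}
    (hx : x ∈ Icc s t) : f x ∈ range g := by
  obtain ⟨φ, -, -, -, -, h⟩ := h
  exact ⟨φ x, (h x hx).symm⟩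

theorem IsConnectedSumAlong.disjoint {D : ℝ × ℝ → S3} {K₁ K₂ K K₃ : Knot}
    (h : IsConnectedSumAlong D K₁ K₂ K) (h₁ : K₁.Disjoint K₃) (h₂ : K₂.Disjoint K₃)
    (hD : ∀ q ∈ unitSquare, D q ∉ range K₃) : K.Disjoint K₃ := by
  obtain ⟨-, -, -, -, a, b, c, d, p₀, p₁, p₂, p₃, hab, hba, hcd, hdc, hp₀, hp₁, hp₂, hp₃, hl, hr, t₁,
    hbot, t₂, htop⟩ := h
  intro s t e
  obtain ⟨x, hx, ex⟩ := K.periodic.exists_mem_Ico one_pos s p₀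
  rw [ex] at e
  rcases le_total x p₁ with h1 | h1
  · obtain ⟨y, hy⟩ := t₁.mem_range ⟨hx.1, h1⟩
    exact h₁ y t (hy.trans e)
  rcases le_total x p₂ with h2 | h2
  · obtain ⟨u, hu, rfl⟩ := exists_affine_param hp₁ ⟨h1, h2⟩
    rw [hbot u hu] at e
    exact hD (u, 0) ⟨hu, by simp⟩ ⟨t, e.symm⟩
  rcases le_total x p₃ with h3 | h3
  · obtain ⟨y, hy⟩ := t₂.mem_range ⟨h2, h3⟩
    exact h₂ y t (hy.trans e)
  · obtain ⟨u, hu, rfl⟩ := exists_affine_param hp₃ ⟨h3, hx.2.le⟩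
    rw [htop u hu] at e
    exact hD (1 - u, 1) ⟨⟨by linarith [hu.2], by linarith [hu.1]⟩, by simp⟩ ⟨t, e.symm⟩

/-- The connected sum consists of the remaining arcs and the lower and upper sides of the disc. A
primitive of the linking form of K₃ on the disc shows that these two sides contribute exactly what
the removed arcs, the left and right sides, would have contributed. -/
theorem linkInt_connectedSum {k : E4 → ℝ} (hk : IsKernel k) {D : ℝ × ℝ → S3} {K₁ K₂ K K₃ : Knot}
    (h : IsConnectedSumAlong D K₁ K₂ K) (h₁ : K₁.Disjoint K₃) (h₂ : K₂.Disjoint K₃)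
    (hD : ∀ q ∈ unitSquare, D q ∉ range K₃) :
    linkInt k K.curve K₃.curve = linkInt k K₁.curve K₃.curve + linkInt k K₂.curve K₃.curve := by
  have h₀ := h.disjoint h₁ h₂ hD
  obtain ⟨hDc, -, -, -, a, b, c, d, p₀, p₁, p₂, p₃, hab, hba, hcd, hdc, hp₀, hp₁, hp₂, hp₃, hl, hr,
    ⟨φ₁, c₁, -, s₁, e₁, t₁⟩, hbot, ⟨φ₂, c₂, -, s₂, e₂, t₂⟩, htop⟩ := h
  have hη := locallyExact_linkForm hk K₃.isLoop
  have hc := continuousOn_linkForm hk K₃.isLoop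
  have hU : ∀ {L : Knot}, L.Disjoint K₃ → ∀ t, L.curve t ∈ coneCompl K₃.curve :=
    fun hL t s => hL.indepCurves t s
  have hG : ∀ {L : Knot}, L.Disjoint K₃ → _ := fun {L} hL =>
    primitiveOn_integral hη hc L.isLoop.contDiff (hU hL)
  have hcont : ∀ {L : Knot}, L.Disjoint K₃ →
      Continuous fun s => linkForm k K₃.curve (L.curve s) (deriv L.curve s) := fun {L} hL =>
    (hc.comp_continuous L.isLoop.continuous (hU hL)).clm_apply L.isLoop.continuous_deriv
  have cD : ContinuousOn (fun q => (D q : E4)) unitSquare :=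
    continuous_subtype_val.comp_continuousOn hDc
  obtain ⟨F, hF⟩ := hη.exists_primitiveOn_square cD fun q hq t =>
    mem_indepPairs_of_norm (norm_eq_of_mem_sphere _) (K₃.norm_curve t)
      (Subtype.coe_ne_coe.2 fun e => hD q hq ⟨t, e.symm⟩)
  have cK : ∀ L : Knot, ContinuousOn L.curve univ := fun L => L.isLoop.continuous.continuousOn
  have arc₁ := (hG h₀).sub_eq_sub (hG h₁) (cK K) hp₀.le continuousOn_id c₁ (mapsTo_univ _ _)
    (mapsTo_univ _ _) (fun u hu => congrArg Subtype.val (t₁ u hu))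
  have arc₂ := (hG h₀).sub_eq_sub (hG h₂) (cK K) hp₂.le continuousOn_id c₂ (mapsTo_univ _ _)
    (mapsTo_univ _ _) (fun u hu => congrArg Subtype.val (t₂ u hu))
  have left := hF.sub_eq_sub (hG h₁) cD zero_le_one (γ := fun t => (0, t))
    (δ := fun t => a + t * (b - a)) (by fun_prop) (by fun_prop) (fun u hu => ⟨by simp, hu⟩)
    (mapsTo_univ _ _) (fun u hu => congrArg Subtype.val (hl u hu))
  have right := hF.sub_eq_sub (hG h₂) cD zero_le_one (γ := fun t => (1, 1 - t))
    (δ := fun t => c + t * (d - c)) (by fun_prop) (by fun_prop)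
    (fun u hu => ⟨by simp, by linarith [hu.2], by linarith [hu.1]⟩)
    (mapsTo_univ _ _) (fun u hu => congrArg Subtype.val (hr u hu))
  have bot := hF.sub_eq_sub (hG h₀) cD zero_le_one (γ := fun t => (t, 0))
    (δ := fun t => p₁ + t * (p₂ - p₁)) (by fun_prop) (by fun_prop) (fun u hu => ⟨hu, by simp⟩)
    (mapsTo_univ _ _) (fun u hu => congrArg Subtype.val (hbot u hu).symm)
  have top := hF.sub_eq_sub (hG h₀) cD zero_le_one (γ := fun t => (1 - t, 1))
    (δ := fun t => p₃ + t * (p₀ + 1 - p₃)) (by fun_prop) (by fun_prop)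
    (fun u hu => ⟨⟨by linarith [hu.2], by linarith [hu.1]⟩, by simp⟩)
    (mapsTo_univ _ _) (fun u hu => congrArg Subtype.val (htop u hu).symm)
  simp only [id_eq, s₁, e₁, s₂, e₂] at arc₁ arc₂
  simp only [zero_mul, one_mul, add_zero, add_sub_cancel, sub_self, sub_zero] at left right bot top
  rw [linkInt_eq_sub k K.isLoop (hcont h₀) p₀, linkInt_eq_sub k K₁.isLoop (hcont h₁) a,
    linkInt_eq_sub k K₂.isLoop (hcont h₂) c]
  linarith

theorem IsConnectedSumAlong.hasLinkNumber {D : ℝ × ℝ → S3} {K₁ K₂ K K₃ : Knot}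
    (h : IsConnectedSumAlong D K₁ K₂ K) (h₁ : K₁.Disjoint K₃) (h₂ : K₂.Disjoint K₃)
    (hD : ∀ q ∈ unitSquare, D q ∉ range K₃) {m n : ℤ} (hm : HasLinkNumber K₁.curve K₃.curve m)
    (hn : HasLinkNumber K₂.curve K₃.curve n) : HasLinkNumber K.curve K₃.curve (m + n) := by
  filter_upwards [hm, hn] with κ h3 h4 θ hθ h0
  rw [linkInt_connectedSum (isKernel_coneKernel hθ _) h h₁ h₂ hD, h3 θ hθ h0, h4 θ hθ h0]
  push_cast
  ring

end

end KnotTheory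

namespace KnotTheory

noncomputable section

/-! ### Generic projections of curves in 3-space -/

theorem det_clm_prod_two (L : ℝ × ℝ →L[ℝ] ℝ × ℝ) {a b : ℝ × ℝ} (ha : L (1, 0) = a)
    (hb : L (0, 1) = b) : L.det = planeDet a b := by
  have h : L.det = LinearMap.det (L : ℝ × ℝ →ₗ[ℝ] ℝ × ℝ) := rfl
  rw [h, ← LinearMap.det_toMatrix (Module.Basis.finTwoProd ℝ), Matrix.det_fin_two]
  simp [LinearMap.toMatrix_apply, ha, hb, planeDet]
  ring

/-- Two plane curves which cross transversally meet in an isolated point. -/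
theorem eventually_ne_of_planeDet_ne_zero {f g : ℝ → ℝ × ℝ} {s t : ℝ} {v w : ℝ × ℝ}
    (hf : HasDerivAt f v s) (hg : HasDerivAt g w t) (h : planeDet v w ≠ 0) :
    ∀ᶠ p in 𝓝[≠] (s, t), f p.1 ≠ g p.2 := by
  have h1 : HasFDerivAt (fun p : ℝ × ℝ => f p.1 - g p.2) _ (s, t) :=
    (hf.hasFDerivAt.comp (s, t) (hasFDerivAt_fst (𝕜 := ℝ) (p := (s, t)))).sub
      (hg.hasFDerivAt.comp (s, t) (hasFDerivAt_snd (𝕜 := ℝ) (p := (s, t))))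
  have h2 := h1.eventually_ne (c := 0) ?_
  · filter_upwards [h2] with p hp he
    exact hp (sub_eq_zero.2 he)
  · refine (LinearMap.injective_iff_antilipschitz (𝕜 := ℝ) (ContinuousLinearMap.toLinearMap _)).1
      ?_ |>.imp fun _ h => h.2
    rw [← LinearMap.ker_eq_bot, LinearMap.ker_eq_bot']
    rintro ⟨a, b⟩ hab
    simp at hab
    rw [sub_eq_zero] at hab
    have e1 : a * v.1 = b * w.1 := congrArg Prod.fst hab
    have e2 : a * v.2 = b * w.2 := congrArg Prod.snd hab
    have ha : a * planeDet v w = 0 := by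
      unfold planeDet
      linear_combination w.2 * e1 - w.1 * e2
    have hb : b * planeDet v w = 0 := by
      unfold planeDet
      linear_combination v.2 * e1 - v.1 * e2
    exact Prod.ext ((mul_eq_zero.1 ha).resolve_right h) ((mul_eq_zero.1 hb).resolve_right h)

/-- The direction of the line through the point `(a, b, c)` and a point of the curve `(x, y, z)`,
in an affine chart. -/
def slopeTo (x y z : ℝ → ℝ) (a b c : ℝ) (t : ℝ) : ℝ × ℝ :=
  ((a - x t) / (c - z t), (b - y t) / (c - z t))

/-- When the connecting direction is (v, 1), the velocity of the slope is a nonzero multiple of the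
velocity of the projection along (v, 1). Critical slopes thus correspond to non-transversal
crossings. -/
theorem hasDerivAt_slopeTo {x y z : ℝ → ℝ} {a b c t : ℝ} (hx : DifferentiableAt ℝ x t)
    (hy : DifferentiableAt ℝ y t) (hz : DifferentiableAt ℝ z t) (hc : c ≠ z t) {v : ℝ × ℝ}
    (h1 : a - x t = v.1 * (c - z t)) (h2 : b - y t = v.2 * (c - z t)) :
    HasDerivAt (slopeTo x y z a b c)
      ((-(c - z t)⁻¹) • (deriv x t - v.1 * deriv z t, deriv y t - v.2 * deriv z t)) t := by
  have hne : c - z t ≠ 0 := sub_ne_zero.2 hc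
  have hd := hz.hasDerivAt.const_sub c
  refine (((hx.hasDerivAt.const_sub a).div hd hne).prodMk
    ((hy.hasDerivAt.const_sub b).div hd hne)).congr_deriv ?_
  rw [h1, h2]
  ext <;> simp <;> field_simp <;> ring

theorem slopeTo_eq {x y z : ℝ → ℝ} {a b c t : ℝ} (hc : c ≠ z t) {v : ℝ × ℝ}
    (h1 : a - x t = v.1 * (c - z t)) (h2 : b - y t = v.2 * (c - z t)) :
    slopeTo x y z a b c t = v := by
  have hne : c - z t ≠ 0 := sub_ne_zero.2 hc
  rw [slopeTo, h1, h2, mul_div_cancel_right₀ _ hne, mul_div_cancel_right₀ _ hne]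

theorem planeDet_smul_smul (a b : ℝ) (v w : ℝ × ℝ) :
    planeDet (a • v) (b • w) = a * b * planeDet v w := by
  simp [planeDet]; ring

theorem countable_of_eventually_notMem {X : Type*} [TopologicalSpace X]
    [SecondCountableTopology X] {S : Set X} (h : ∀ x ∈ S, ∀ᶠ y in 𝓝[≠] x, y ∉ S) :
    S.Countable := by
  obtain ⟨t, ht, htc, hS⟩ := TopologicalSpace.countable_cover_nhdsWithin
    (f := fun x => ({x} : Set X)) (s := S) fun x hx => by
      have h1 := eventually_nhdsWithin_iff.1 (h x hx)
      refine mem_nhdsWithin_iff_eventually.2 (h1.mono fun y hy hyS => ?_)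
      by_contra hne
      exact hy hne hyS
  rw [biUnion_of_singleton] at hS
  exact htc.mono hS

/-- Open sets in a metrizable space are countable unions of closed sets. Unlike measurability,
σ-compactness passes to projections, as the triple-point argument requires. -/
theorem isSigmaCompact_inter {X : Type*} [TopologicalSpace X] [SigmaCompactSpace X]
    [TopologicalSpace.MetrizableSpace X] {C U : Set X} (hC : IsClosed C) (hU : IsOpen U) :
    IsSigmaCompact (C ∩ U) := by
  let _ := TopologicalSpace.metrizableSpaceMetric X
  obtain ⟨F, hF, -, hFU, -⟩ := hU.exists_iUnion_isClosed
  rw [← hFU, inter_iUnion]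
  exact isSigmaCompact_iUnion _ fun n =>
    isSigmaCompact_univ.of_isClosed_subset (hC.inter (hF n)) (subset_univ _)

theorem _root_.IsSigmaCompact.measurableSet {X : Type*} [TopologicalSpace X] [T2Space X]
    [MeasurableSpace X] [OpensMeasurableSpace X] {S : Set X} (hS : IsSigmaCompact S) :
    MeasurableSet S := by
  obtain ⟨K, hK, rfl⟩ := hS
  exact MeasurableSet.iUnion fun n => (hK n).measurableSet

instance isAddHaarMeasure_volume_plane : (volume : Measure (ℝ × ℝ)).IsAddHaarMeasure :=
  Measure.prod.instIsAddHaarMeasure (volume : Measure ℝ) (volume : Measure ℝ)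

/-- The projection along (v, 1) fails to be an immersion only if (v, 1) is a tangent direction, and
the tangent directions form a differentiable curve in the plane of slopes, a null set. -/
theorem ae_immersive {x y z : ℝ → ℝ} (hx : ContDiff ℝ 2 x) (hy : ContDiff ℝ 2 y)
    (hz : ContDiff ℝ 2 z) (h : ∀ t, ¬(deriv x t = 0 ∧ deriv y t = 0 ∧ deriv z t = 0)) :
    ∀ᵐ v : ℝ × ℝ, ∀ t, ¬(deriv x t - v.1 * deriv z t = 0 ∧ deriv y t - v.2 * deriv z t = 0) := by
  have hd : ∀ {f : ℝ → ℝ}, ContDiff ℝ 2 f → Differentiable ℝ (deriv f) := fun {f} hf =>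
    ((contDiff_succ_iff_deriv (n := 1)).1 (by rwa [one_add_one_eq_two])).2.2.differentiable one_ne_zero
  set Φ : ℝ × ℝ → ℝ × ℝ := fun p => (deriv x p.1 / deriv z p.1, deriv y p.1 / deriv z p.1)
  -- A dummy second coordinate makes the curve the image of a null line in the plane, so that the
  -- equidimensional theorem on images of null sets applies.
  set S : Set (ℝ × ℝ) := {p | deriv z p.1 ≠ 0 ∧ p.2 = 0} with hS
  have hS0 : volume S = 0 := by
    refine measure_mono_null (t := univ ×ˢ {0}) (fun p hp => ⟨mem_univ _, hp.2⟩) ?_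
    rw [Measure.volume_eq_prod, Measure.prod_prod]
    simp
  have hΦ : DifferentiableOn ℝ Φ S := fun p hp => by
    have h1 := (hd hx).comp (differentiable_fst (𝕜 := ℝ) (E := ℝ) (F := ℝ))
    have h2 := (hd hy).comp (differentiable_fst (𝕜 := ℝ) (E := ℝ) (F := ℝ))
    have h3 := (hd hz).comp (differentiable_fst (𝕜 := ℝ) (E := ℝ) (F := ℝ))
    have h4 := ((h1 p).mul ((h3 p).inv hp.1))
    have h5 := ((h2 p).mul ((h3 p).inv hp.1))
    simp only [Φ, div_eq_mul_inv]
    exact (h4.prodMk h5).differentiableWithinAt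
  have := addHaar_image_eq_zero_of_differentiableOn_of_addHaar_eq_zero volume hΦ hS0
  filter_upwards [measure_eq_zero_iff_ae_notMem.1 this] with v hv t ht
  have hzt : deriv z t ≠ 0 := fun e => h t ⟨by simpa [e] using ht.1, by simpa [e] using ht.2, e⟩
  refine hv ⟨(t, 0), ⟨hzt, rfl⟩, ?_⟩
  refine Prod.ext ?_ ?_
  · simp only [Φ]
    rw [div_eq_iff hzt]
    linarith [ht.1]
  · simp only [Φ]
    rw [div_eq_iff hzt]
    linarith [ht.2]

section Curves

variable {x₁ y₁ z₁ x₂ y₂ z₂ x₃ y₃ z₃ : ℝ → ℝ}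

theorem differentiableAt_slopeTo (hx₁ : ContDiff ℝ 1 x₁) (hy₁ : ContDiff ℝ 1 y₁) (hz₁ : ContDiff ℝ 1 z₁)
    (hx₂ : ContDiff ℝ 1 x₂) (hy₂ : ContDiff ℝ 1 y₂) (hz₂ : ContDiff ℝ 1 z₂) {p : ℝ × ℝ}
    (hp : z₁ p.1 ≠ z₂ p.2) : DifferentiableAt ℝ
      (fun p : ℝ × ℝ => slopeTo x₂ y₂ z₂ (x₁ p.1) (y₁ p.1) (z₁ p.1) p.2) p := by
  have h1 : ∀ {f : ℝ → ℝ}, ContDiff ℝ 1 f → Differentiable ℝ fun p : ℝ × ℝ => f p.1 := fun hf =>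
    (hf.comp contDiff_fst).differentiable one_ne_zero
  have h2 : ∀ {f : ℝ → ℝ}, ContDiff ℝ 1 f → Differentiable ℝ fun p : ℝ × ℝ => f p.2 := fun hf =>
    (hf.comp contDiff_snd).differentiable one_ne_zero
  have hne : z₁ p.1 - z₂ p.2 ≠ 0 := sub_ne_zero.2 hp
  have h3 := ((h1 hx₁ p).fun_sub (h2 hx₂ p)).mul (((h1 hz₁ p).fun_sub (h2 hz₂ p)).inv hne)
  have h4 := ((h1 hy₁ p).fun_sub (h2 hy₂ p)).mul (((h1 hz₁ p).fun_sub (h2 hz₂ p)).inv hne)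
  simp only [slopeTo, div_eq_mul_inv]
  exact h3.prodMk h4

/-- The equidimensional case of Sard's theorem, which needs only C¹: bad directions are critical
values of the map sending two parameters to the slope of their connecting line. -/
theorem ae_transversal (hx₁ : ContDiff ℝ 1 x₁) (hy₁ : ContDiff ℝ 1 y₁) (hz₁ : ContDiff ℝ 1 z₁)
    (hx₂ : ContDiff ℝ 1 x₂) (hy₂ : ContDiff ℝ 1 y₂) (hz₂ : ContDiff ℝ 1 z₂) :
    ∀ᵐ v : ℝ × ℝ, ∀ s t, z₁ s ≠ z₂ t → x₁ s - x₂ t = v.1 * (z₁ s - z₂ t) →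
      y₁ s - y₂ t = v.2 * (z₁ s - z₂ t) →
      planeDet (deriv x₁ s - v.1 * deriv z₁ s, deriv y₁ s - v.2 * deriv z₁ s)
        (deriv x₂ t - v.1 * deriv z₂ t, deriv y₂ t - v.2 * deriv z₂ t) ≠ 0 := by
  have hd : ∀ {f : ℝ → ℝ}, ContDiff ℝ 1 f → Differentiable ℝ f := fun hf =>
    hf.differentiable one_ne_zero
  set Φ : ℝ × ℝ → ℝ × ℝ := fun p => slopeTo x₂ y₂ z₂ (x₁ p.1) (y₁ p.1) (z₁ p.1) p.2 with hΦ
  set S : Set (ℝ × ℝ) := {p | z₁ p.1 ≠ z₂ p.2 ∧ (fderiv ℝ Φ p).det = 0} with hS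
  have hΦd : ∀ p : ℝ × ℝ, z₁ p.1 ≠ z₂ p.2 → HasFDerivAt Φ (fderiv ℝ Φ p) p := fun p hp =>
    (differentiableAt_slopeTo hx₁ hy₁ hz₁ hx₂ hy₂ hz₂ hp).hasFDerivAt
  have := addHaar_image_eq_zero_of_det_fderivWithin_eq_zero volume
    (fun p (hp : p ∈ S) => (hΦd p hp.1).hasFDerivWithinAt) fun p hp => hp.2
  filter_upwards [measure_eq_zero_iff_ae_notMem.1 this] with v hv s t hz h1 h2 h0
  refine hv ⟨(s, t), ⟨hz, ?_⟩, slopeTo_eq hz h1 h2⟩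
  have e2 := (hΦd (s, t) hz).comp_hasDerivAt t ((hasDerivAt_const t s).prodMk (hasDerivAt_id t))
  have e1 := (hΦd (s, t) hz).comp_hasDerivAt s ((hasDerivAt_id s).prodMk (hasDerivAt_const s t))
  have f2 := hasDerivAt_slopeTo (hd hx₂ t) (hd hy₂ t) (hd hz₂ t) hz h1 h2
  have f1 := hasDerivAt_slopeTo (a := x₂ t) (b := y₂ t) (c := z₂ t) (v := v)
    (hd hx₁ s) (hd hy₁ s) (hd hz₁ s) hz.symm (by linarith) (by linarith)
  have e : (Φ ∘ fun s => (s, t)) = slopeTo x₁ y₁ z₁ (x₂ t) (y₂ t) (z₂ t) := by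
    funext u
    simp only [hΦ, Function.comp_apply, slopeTo]
    rw [← neg_sub (x₂ t), ← neg_sub (y₂ t), ← neg_sub (z₂ t), neg_div_neg_eq, neg_div_neg_eq]
  have f1' : HasDerivAt (Φ ∘ fun s => (s, t)) _ s := e ▸ f1
  rw [det_clm_prod_two _ (e1.unique f1') (e2.unique f2), planeDet_smul_smul, h0, mul_zero]

/-- Non-transversal directions may be discarded. For a fixed first point, the other two points of a
collinear triple transversal at them are then isolated, so the pairs formed by the first two
parameters fill a null set, with countable slices. Its image under the differentiable slope map is
null. -/
theorem ae_no_triple (hx₁ : ContDiff ℝ 1 x₁) (hy₁ : ContDiff ℝ 1 y₁) (hz₁ : ContDiff ℝ 1 z₁)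
    (hx₂ : ContDiff ℝ 1 x₂) (hy₂ : ContDiff ℝ 1 y₂) (hz₂ : ContDiff ℝ 1 z₂)
    (hx₃ : ContDiff ℝ 1 x₃) (hy₃ : ContDiff ℝ 1 y₃) (hz₃ : ContDiff ℝ 1 z₃) :
    ∀ᵐ v : ℝ × ℝ, ∀ s t u, z₁ s ≠ z₂ t → z₁ s ≠ z₃ u → z₂ t ≠ z₃ u →
      x₁ s - x₂ t = v.1 * (z₁ s - z₂ t) → y₁ s - y₂ t = v.2 * (z₁ s - z₂ t) →
      x₁ s - x₃ u = v.1 * (z₁ s - z₃ u) → y₁ s - y₃ u = v.2 * (z₁ s - z₃ u) → False := by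
  have hd : ∀ {f : ℝ → ℝ}, ContDiff ℝ 1 f → Differentiable ℝ f := fun hf =>
    hf.differentiable one_ne_zero
  have c : ∀ {f : ℝ → ℝ}, ContDiff ℝ 1 f → Continuous f := fun hf => hf.continuous
  have c' : ∀ {f : ℝ → ℝ}, ContDiff ℝ 1 f → Continuous (deriv f) := fun hf =>
    hf.continuous_deriv le_rfl
  have := c hx₁; have := c hy₁; have := c hz₁; have := c hx₂; have := c hy₂; have := c hz₂
  have := c hx₃; have := c hy₃; have := c hz₃; have := c' hx₂; have := c' hy₂; have := c' hz₂
  have := c' hx₃; have := c' hy₃; have := c' hz₃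
  -- triples of collinear points, the projection being transversal at the last two
  set C : Set ((ℝ × ℝ) × ℝ) := {p |
    (x₁ p.1.1 - x₂ p.1.2) * (z₁ p.1.1 - z₃ p.2) = (x₁ p.1.1 - x₃ p.2) * (z₁ p.1.1 - z₂ p.1.2) ∧
    (y₁ p.1.1 - y₂ p.1.2) * (z₁ p.1.1 - z₃ p.2) = (y₁ p.1.1 - y₃ p.2) * (z₁ p.1.1 - z₂ p.1.2)}
    with hC
  set δ : (ℝ × ℝ) × ℝ → ℝ := fun p => planeDet
    (deriv x₂ p.1.2 * (z₁ p.1.1 - z₂ p.1.2) - (x₁ p.1.1 - x₂ p.1.2) * deriv z₂ p.1.2,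
      deriv y₂ p.1.2 * (z₁ p.1.1 - z₂ p.1.2) - (y₁ p.1.1 - y₂ p.1.2) * deriv z₂ p.1.2)
    (deriv x₃ p.2 * (z₁ p.1.1 - z₂ p.1.2) - (x₁ p.1.1 - x₂ p.1.2) * deriv z₃ p.2,
      deriv y₃ p.2 * (z₁ p.1.1 - z₂ p.1.2) - (y₁ p.1.1 - y₂ p.1.2) * deriv z₃ p.2) with hδ
  set U : Set ((ℝ × ℝ) × ℝ) := {p | z₁ p.1.1 - z₂ p.1.2 ≠ 0 ∧ z₁ p.1.1 - z₃ p.2 ≠ 0 ∧ δ p ≠ 0}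
    with hU
  have hCc : IsClosed C := (isClosed_eq (by fun_prop) (by fun_prop)).inter
    (isClosed_eq (by fun_prop) (by fun_prop))
  have hδc : Continuous δ := by
    simp only [hδ, planeDet]
    fun_prop
  have hUo : IsOpen U := (isOpen_ne_fun (by fun_prop) (by fun_prop)).inter
    ((isOpen_ne_fun (by fun_prop) (by fun_prop)).inter (isOpen_ne_fun (by fun_prop) (by fun_prop)))
  set T : Set (ℝ × ℝ) := Prod.fst '' (C ∩ U) with hT
  have hTm : MeasurableSet T :=
    ((isSigmaCompact_inter hCc hUo).image continuous_fst).measurableSet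
  have hTs : ∀ s, (Prod.mk s ⁻¹' T).Countable := by
    intro s
    have hcount : {q : ℝ × ℝ | ((s, q.1), q.2) ∈ C ∩ U}.Countable := by
      refine countable_of_eventually_notMem fun q hq => ?_
      obtain ⟨⟨e1, e2⟩, w2, w3, hdet⟩ := hq
      simp only at e1 e2 w2 w3 hdet
      set v : ℝ × ℝ := ((x₁ s - x₂ q.1) / (z₁ s - z₂ q.1), (y₁ s - y₂ q.1) / (z₁ s - z₂ q.1))
        with hv
      have v1 : x₁ s - x₂ q.1 = v.1 * (z₁ s - z₂ q.1) := by simp only [hv]; field_simp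
      have v2 : y₁ s - y₂ q.1 = v.2 * (z₁ s - z₂ q.1) := by simp only [hv]; field_simp
      have v3 : x₁ s - x₃ q.2 = v.1 * (z₁ s - z₃ q.2) := by
        rw [v1] at e1
        apply mul_right_cancel₀ w2
        linarith
      have v4 : y₁ s - y₃ q.2 = v.2 * (z₁ s - z₃ q.2) := by
        rw [v2] at e2
        apply mul_right_cancel₀ w2
        linarith
      have n2 := sub_ne_zero.1 w2
      have n3 := sub_ne_zero.1 w3
      have key := eventually_ne_of_planeDet_ne_zero
        (hasDerivAt_slopeTo (hd hx₂ q.1) (hd hy₂ q.1) (hd hz₂ q.1) n2 v1 v2)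
        (hasDerivAt_slopeTo (hd hx₃ q.2) (hd hy₃ q.2) (hd hz₃ q.2) n3 v3 v4) (by
          rw [planeDet_smul_smul]
          refine mul_ne_zero (mul_ne_zero (neg_ne_zero.2 (inv_ne_zero w2))
            (neg_ne_zero.2 (inv_ne_zero w3))) fun h => hdet ?_
          simp only [hδ, v1, v2]
          have := planeDet_smul_smul (z₁ s - z₂ q.1) (z₁ s - z₂ q.1)
            (deriv x₂ q.1 - v.1 * deriv z₂ q.1, deriv y₂ q.1 - v.2 * deriv z₂ q.1)
            (deriv x₃ q.2 - v.1 * deriv z₃ q.2, deriv y₃ q.2 - v.2 * deriv z₃ q.2)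
          rw [h, mul_zero] at this
          rw [← this]
          simp only [planeDet, Prod.smul_mk, smul_eq_mul]
          ring)
      filter_upwards [key] with r hr hrS
      obtain ⟨⟨f1, f2⟩, u2, u3, -⟩ := hrS
      simp only at f1 f2 u2 u3
      refine hr (Prod.ext ?_ ?_)
      · simp only [slopeTo]
        rw [div_eq_div_iff u2 u3, f1]
      · simp only [slopeTo]
        rw [div_eq_div_iff u2 u3, f2]
    refine (hcount.image Prod.fst).mono ?_
    rintro t ⟨⟨⟨s', t'⟩, u⟩, hp, he⟩
    simp only [Prod.mk.injEq] at he
    obtain ⟨rfl, rfl⟩ := he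
    exact ⟨(t', u), hp, rfl⟩
  have hT0 : volume T = 0 := by
    rw [Measure.volume_eq_prod, Measure.measure_prod_null hTm]
    exact Eventually.of_forall fun s => (hTs s).measure_zero _
  have hdiff : DifferentiableOn ℝ
      (fun p : ℝ × ℝ => slopeTo x₂ y₂ z₂ (x₁ p.1) (y₁ p.1) (z₁ p.1) p.2) T := by
    rintro _ ⟨p, hp, rfl⟩
    exact (differentiableAt_slopeTo hx₁ hy₁ hz₁ hx₂ hy₂ hz₂ (sub_ne_zero.1 hp.2.1)).differentiableWithinAt
  have hnull := addHaar_image_eq_zero_of_differentiableOn_of_addHaar_eq_zero volume hdiff hT0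
  filter_upwards [measure_eq_zero_iff_ae_notMem.1 hnull,
    ae_transversal hx₂ hy₂ hz₂ hx₃ hy₃ hz₃] with v hv htr s t u n2 n3 n23 v1 v2 v3 v4
  refine hv ⟨(s, t), ⟨((s, t), u), ⟨⟨?_, ?_⟩, sub_ne_zero.2 n2, sub_ne_zero.2 n3, ?_⟩, rfl⟩,
    slopeTo_eq n2 v1 v2⟩
  · simp only [v1, v3]; ring
  · simp only [v2, v4]; ring
  · have := htr t u n23 (by linarith) (by linarith)
    have e := planeDet_smul_smul (z₁ s - z₂ t) (z₁ s - z₂ t)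
            (deriv x₂ t - v.1 * deriv z₂ t, deriv y₂ t - v.2 * deriv z₂ t)
            (deriv x₃ u - v.1 * deriv z₃ u, deriv y₃ u - v.2 * deriv z₃ u)
    have hne := mul_ne_zero (mul_ne_zero (sub_ne_zero.2 n2) (sub_ne_zero.2 n2)) this
    rw [← e] at hne
    intro h0
    apply hne
    rw [← h0]
    simp only [hδ, v1, v2, planeDet, Prod.smul_mk, smul_eq_mul]
    ring

end Curves

end

end KnotTheory

namespace KnotTheory

noncomputable section

/-! ### Existence of diagrams -/

theorem rotate_apply (A : Rotation) (x : S3) (i : Fin 4) : rotate A x i =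
    A.1 i 0 * (x : E4) 0 + A.1 i 1 * (x : E4) 1 + A.1 i 2 * (x : E4) 2 + A.1 i 3 * (x : E4) 3 := by
  simp [rotate, Matrix.mulVec, dotProduct, Fin.sum_univ_four]

theorem sum_sq_rotate (A : Rotation) (x : S3) :
    rotate A x 0 ^ 2 + rotate A x 1 ^ 2 + rotate A x 2 ^ 2 + rotate A x 3 ^ 2 = 1 := by
  have h : ‖matMap A.1 (x : E4)‖ = 1 := by
    rw [norm_matMap A.transpose_mul_self, norm_eq_of_mem_sphere]
  have e := EuclideanSpace.real_norm_sq_eq (matMap A.1 (x : E4))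
  rw [h, Fin.sum_univ_four] at e
  simpa [matMap_apply, rotate] using e.symm

theorem rotate_injective (A : Rotation) : Function.Injective (rotate A) := by
  intro x y h
  have e : matMap A.1 (x : E4) = matMap A.1 (y : E4) := by
    simp only [matMap_apply]
    exact congrArg _ h
  have := congrArg (matMap A.1.transpose) e
  rw [← matMap_mul, ← matMap_mul, A.transpose_mul_self, matMap_one, matMap_one] at this
  exact Subtype.ext this

theorem mul_stereo {A : Rotation} {x : S3} (hx : rotate A x 3 ≠ 1) (i : Fin 3) :
    rotate A x i.castSucc = (1 - rotate A x 3) * stereo A x i := by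
  rw [stereo, mul_div_cancel₀ _ (sub_ne_zero.2 hx.symm)]

theorem stereo_injective {A : Rotation} {x y : S3} (hx : rotate A x 3 ≠ 1)
    (hy : rotate A y 3 ≠ 1) (h : ∀ i, stereo A x i = stereo A y i) : x = y := by
  -- The sphere equation recovers the last coordinate from the stereographic ones.
  have key : ∀ {x : S3}, rotate A x 3 ≠ 1 → (1 - rotate A x 3) *
      (1 + stereo A x 0 ^ 2 + stereo A x 1 ^ 2 + stereo A x 2 ^ 2) = 2 := by
    intro x hx
    have e := sum_sq_rotate A x
    have e0 : rotate A x 0 = _ := mul_stereo hx 0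
    have e1 : rotate A x 1 = _ := mul_stereo hx 1
    have e2 : rotate A x 2 = _ := mul_stereo hx 2
    rw [e0, e1, e2] at e
    apply mul_left_cancel₀ (sub_ne_zero.2 hx.symm)
    linear_combination e
  have h3 : rotate A x 3 = rotate A y 3 := by
    have kx := key hx
    have ky := key hy
    rw [h 0, h 1, h 2, ← ky] at kx
    have : 0 < 1 + stereo A y 0 ^ 2 + stereo A y 1 ^ 2 + stereo A y 2 ^ 2 := by positivity
    linarith [mul_right_cancel₀ this.ne' kx]
  refine rotate_injective A (funext fun i => ?_)
  refine Fin.lastCases h3 (fun i => ?_) i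
  rw [mul_stereo hx, mul_stereo hy, h, h3]

/-- If the stereographic velocity vanished, the velocity on the sphere would point along the ray to
the pole. Differentiating the sphere equation then forces it to be zero, against immersivity of the
knot. -/
theorem stereoCurve_immersive {A : Rotation} {K : Knot} (hK : ∀ t, rotate A (K t) 3 ≠ 1) (t : ℝ) :
    ¬(deriv (stereoCurve A K 0) t = 0 ∧ deriv (stereoCurve A K 1) t = 0 ∧
      deriv (stereoCurve A K 2) t = 0) := by
  rintro ⟨h0, h1, h2⟩
  have hd : ∀ i, HasDerivAt (fun t => rotate A (K t) i) (deriv (fun t => rotate A (K t) i) t) t :=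
    fun i => ((contDiff_rotate A K i).differentiable (by simp) t).hasDerivAt
  have hs : ∀ i : Fin 3, deriv (stereoCurve A K i) t = 0 → deriv (fun t => rotate A (K t) i.castSucc) t =
      -deriv (fun t => rotate A (K t) 3) t * stereo A (K t) i := by
    intro i hi
    have e : (fun t => rotate A (K t) i.castSucc) =
        fun t => (1 - rotate A (K t) 3) * stereoCurve A K i t := by
      funext t
      exact mul_stereo (hK t) i
    have h := ((hd 3).const_sub 1).mul
      ((contDiff_stereoCurve hK i).differentiable (by simp) t).hasDerivAt
    rw [e]
    refine h.deriv.trans ?_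
    rw [hi, mul_zero, add_zero]
    rfl
  have e0 : deriv (fun t => rotate A (K t) 0) t = _ := hs 0 h0
  have e1 : deriv (fun t => rotate A (K t) 1) t = _ := hs 1 h1
  have e2 : deriv (fun t => rotate A (K t) 2) t = _ := hs 2 h2
  have hsum := ((((hd 0).pow 2).add ((hd 1).pow 2)).add ((hd 2).pow 2)).add ((hd 3).pow 2)
  have hconst : HasDerivAt (fun _ : ℝ => (1 : ℝ)) 0 t := hasDerivAt_const t 1
  have hz := hsum.unique (hconst.congr_of_eventuallyEq
    (Eventually.of_forall fun t => sum_sq_rotate A (K t)))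
  have m0 : rotate A (K t) 0 = _ := mul_stereo (hK t) 0
  have m1 : rotate A (K t) 1 = _ := mul_stereo (hK t) 1
  have m2 : rotate A (K t) 2 = _ := mul_stereo (hK t) 2
  have hq := sum_sq_rotate A (K t)
  have hne : 1 - rotate A (K t) 3 ≠ 0 := sub_ne_zero.2 (hK t).symm
  rw [e0, e1, e2] at hz
  simp only [Nat.cast_ofNat, Nat.add_one_sub_one, pow_one] at hz
  set σ := deriv (fun t => rotate A (K t) 3) t
  have e3 : σ = 0 := by
    apply mul_left_cancel₀ hne
    rw [m0, m1, m2] at hq hz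
    linear_combination (-(1 - rotate A (K t) 3) / 2) * hz - σ * hq
  have hall : ∀ i, deriv (fun t => rotate A (K t) i) t = 0 := by
    intro i
    fin_cases i
    · exact e0.trans (by rw [e3, neg_zero, zero_mul])
    · exact e1.trans (by rw [e3, neg_zero, zero_mul])
    · exact e2.trans (by rw [e3, neg_zero, zero_mul])
    · exact e3
  have hm : deriv (fun t => matMap A.1 (K.curve t)) t = 0 := by
    ext i
    rw [(K.isLoop.matMap A.1).deriv_apply]
    exact hall i
  have hm' := ((matMap A.1).hasFDerivAt.comp_hasDerivAt t (K.isLoop.hasDerivAt t)).deriv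
  have hz' : matMap A.1 (deriv K.curve t) = 0 := hm'.symm.trans hm
  refine K.immersive t ?_
  change deriv K.curve t = 0
  rw [← norm_eq_zero, ← norm_matMap A.transpose_mul_self, hz', norm_zero]

/-- A rotation which moves the unit vector `p` to the pole. -/
def poleMatrix (p : E4) : Matrix (Fin 4) (Fin 4) ℝ :=
  !![p 3, p 2, -p 1, -p 0; -p 2, p 3, p 0, -p 1; p 1, -p 0, p 3, -p 2; p 0, p 1, p 2, p 3]

/-- The matrix is left multiplication by the conjugate of the unit quaternion p, with the last
coordinate as real part. -/
theorem poleMatrix_mem {p : E4} (hp : ‖p‖ = 1) :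
    poleMatrix p ∈ Matrix.specialOrthogonalGroup (Fin 4) ℝ := by
  have h := EuclideanSpace.real_norm_sq_eq p
  rw [hp, Fin.sum_univ_four] at h
  rw [Matrix.mem_specialOrthogonalGroup_iff, Matrix.mem_orthogonalGroup_iff]
  constructor
  · ext i j
    fin_cases i <;> fin_cases j <;>
      simp [poleMatrix, Matrix.mul_apply, Fin.sum_univ_four] <;>
      first | linear_combination -h | ring1
  · simp [poleMatrix, Matrix.det_succ_row_zero, Fin.sum_univ_succ, Fin.succAbove]
    linear_combination (-(p 0 ^ 2 + p 1 ^ 2 + p 2 ^ 2 + p 3 ^ 2) - 1) * h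

/-- The lines through the origin and the points of the link form a set of Hausdorff dimension at
most 2 in 4-space. A nonzero vector outside it gives a point of the sphere off the link, which is
rotated to the pole. -/
theorem exists_rotation_misses_pole {ι : Type} [Finite ι] (L : ι → Knot) :
    ∃ A : Rotation, ∀ i t, rotate A (L i t) 3 ≠ 1 := by
  have hd : dimH (⋃ i, range fun p : ℝ × ℝ => p.1 • (L i).curve p.2) <
      Module.finrank ℝ E4 := by
    rw [dimH_iUnion]
    refine lt_of_le_of_lt (b := ((2 : ℕ) : ENNReal)) (iSup_le fun i => ?_) ?_
    · have hc : ContDiff ℝ 1 fun p : ℝ × ℝ => p.1 • (L i).curve p.2 :=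
        contDiff_fst.smul ((L i).isLoop.contDiff.comp contDiff_snd)
      simpa using hc.dimH_range_le
    · rw [finrank_euclideanSpace_fin]
      norm_num
  obtain ⟨w, hw0, hw⟩ := (dense_compl_of_dimH_lt_finrank hd).inter_open_nonempty {0}ᶜ
    isOpen_compl_singleton ⟨pole, by simp [pole]⟩
  have hn : ‖w‖ ≠ 0 := norm_ne_zero_iff.2 hw0
  set p : E4 := ‖w‖⁻¹ • w with hp
  have hp1 : ‖p‖ = 1 := by
    rw [hp, norm_smul, norm_inv, norm_norm, inv_mul_cancel₀ hn]
  refine ⟨⟨poleMatrix p, poleMatrix_mem hp1⟩, fun i t h => hw (mem_iUnion.2 ⟨i, (‖w‖, t), ?_⟩)⟩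
  rw [rotate_apply] at h
  simp [poleMatrix] at h
  have hx := EuclideanSpace.real_norm_sq_eq ((L i).curve t)
  have hq := EuclideanSpace.real_norm_sq_eq p
  rw [(L i).norm_curve, Fin.sum_univ_four] at hx
  rw [hp1, Fin.sum_univ_four] at hq
  have e : (L i).curve t = p := by
    rw [← sub_eq_zero, ← norm_eq_zero, ← sq_eq_zero_iff, EuclideanSpace.real_norm_sq_eq,
      Fin.sum_univ_four]
    simp only [PiLp.sub_apply]
    change p 0 * (L i).curve t 0 + p 1 * (L i).curve t 1 + p 2 * (L i).curve t 2 +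
      p 3 * (L i).curve t 3 = 1 at h
    linear_combination -hx - hq - 2 * h
  simp only
  rw [e, hp, smul_inv_smul₀ hn]

end

end KnotTheory

/-! ### Tilting the direction of projection and general position. -/

namespace KnotTheory

noncomputable section

/-- A rotation of 3-space which moves the direction `(α, β, 1)` to a multiple of the vertical
direction. -/
def tiltMatrix (α β : ℝ) : Matrix (Fin 4) (Fin 4) ℝ :=
  let m := √(1 + α ^ 2)
  let n := √(1 + α ^ 2 + β ^ 2)
  !![1 / m, 0, -α / m, 0; -(α * β) / (m * n), m / n, -β / (m * n), 0; α / n, β / n, 1 / n, 0;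
    0, 0, 0, 1]

theorem tiltMatrix_mem (α β : ℝ) :
    tiltMatrix α β ∈ Matrix.specialOrthogonalGroup (Fin 4) ℝ := by
  have hm : √(1 + α ^ 2) ^ 2 = 1 + α ^ 2 := Real.sq_sqrt (by positivity)
  have hn : √(1 + α ^ 2 + β ^ 2) ^ 2 = 1 + α ^ 2 + β ^ 2 := Real.sq_sqrt (by positivity)
  have hm0 : √(1 + α ^ 2) ≠ 0 := (Real.sqrt_pos.2 (by positivity)).ne'
  have hn0 : √(1 + α ^ 2 + β ^ 2) ≠ 0 := (Real.sqrt_pos.2 (by positivity)).ne'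
  unfold tiltMatrix
  set m := √(1 + α ^ 2)
  set n := √(1 + α ^ 2 + β ^ 2)
  have e : β ^ 2 = n ^ 2 - m ^ 2 := by linarith
  have e' : α ^ 2 = m ^ 2 - 1 := by linarith
  rw [Matrix.mem_specialOrthogonalGroup_iff, Matrix.mem_orthogonalGroup_iff]
  constructor
  · ext i j
    fin_cases i <;> fin_cases j <;>
      simp [Matrix.mul_apply, Fin.sum_univ_four] <;> field_simp <;> ring_nf <;>
      simp only [e, e'] <;> ring
  · simp [Matrix.det_succ_row_zero, Fin.sum_univ_succ, Fin.succAbove]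
    field_simp
    ring_nf
    simp only [e, e']
    ring

/-- The linear map of the plane by which the projection along `(α, β, 1)` to the horizontal plane
differs from the vertical projection after tilting. -/
def tiltPlane (α β : ℝ) (p : ℝ × ℝ) : ℝ × ℝ :=
  (p.1 / √(1 + α ^ 2), ((1 + α ^ 2) * p.2 - α * β * p.1) / (√(1 + α ^ 2) * √(1 + α ^ 2 + β ^ 2)))

theorem planeDet_tiltPlane (α β : ℝ) (p q : ℝ × ℝ) :
    planeDet (tiltPlane α β p) (tiltPlane α β q) = planeDet p q / √(1 + α ^ 2 + β ^ 2) := by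
  have hm : √(1 + α ^ 2) ^ 2 = 1 + α ^ 2 := Real.sq_sqrt (by positivity)
  have hm0 : √(1 + α ^ 2) ≠ 0 := (Real.sqrt_pos.2 (by positivity)).ne'
  have hn0 : √(1 + α ^ 2 + β ^ 2) ≠ 0 := (Real.sqrt_pos.2 (by positivity)).ne'
  simp only [planeDet, tiltPlane]
  field_simp
  rw [hm]
  ring

theorem tiltPlane_injective (α β : ℝ) : Function.Injective (tiltPlane α β) := by
  intro p q h
  have hm0 : √(1 + α ^ 2) ≠ 0 := (Real.sqrt_pos.2 (by positivity)).ne'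
  have hn0 : √(1 + α ^ 2 + β ^ 2) ≠ 0 := (Real.sqrt_pos.2 (by positivity)).ne'
  simp only [tiltPlane, Prod.mk.injEq] at h
  have h1 := (div_left_inj' hm0).1 h.1
  have h2 := (div_left_inj' (mul_ne_zero hm0 hn0)).1 h.2
  rw [h1, sub_left_inj] at h2
  exact Prod.ext h1 (mul_left_cancel₀ (by positivity : 1 + α ^ 2 ≠ 0) h2)

/-- The rotation `A` followed by the tilt. -/
def tilt (A : Rotation) (v : ℝ × ℝ) : Rotation := ⟨tiltMatrix v.1 v.2, tiltMatrix_mem v.1 v.2⟩ * A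

theorem rotate_tilt (A : Rotation) (v : ℝ × ℝ) (x : S3) (i : Fin 4) : rotate (tilt A v) x i =
    tiltMatrix v.1 v.2 i 0 * rotate A x 0 + tiltMatrix v.1 v.2 i 1 * rotate A x 1 +
      tiltMatrix v.1 v.2 i 2 * rotate A x 2 + tiltMatrix v.1 v.2 i 3 * rotate A x 3 := by
  have : rotate (tilt A v) x = (tiltMatrix v.1 v.2).mulVec (rotate A x) := by
    simp [rotate, tilt]
  rw [this]
  simp [Matrix.mulVec, dotProduct, Fin.sum_univ_four]

/-- The oblique projection of the stereographic image of a knot. -/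
def oblique (A : Rotation) (v : ℝ × ℝ) (K : Knot) (t : ℝ) : ℝ × ℝ :=
  (stereoCurve A K 0 t - v.1 * stereoCurve A K 2 t, stereoCurve A K 1 t - v.2 * stereoCurve A K 2 t)

theorem rotate_tilt_three (A : Rotation) (v : ℝ × ℝ) (x : S3) :
    rotate (tilt A v) x 3 = rotate A x 3 := by
  rw [rotate_tilt]; simp [tiltMatrix]

/-- After the tilt the planar projection is a fixed invertible linear image of the projection along
(v, 1), so generic properties of the direction transfer to an admissible rotation. -/
theorem shadow_tilt (A : Rotation) (v : ℝ × ℝ) (K : Knot) (t : ℝ) :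
    shadow (tilt A v) K t = tiltPlane v.1 v.2 (oblique A v K t) := by
  have hm : √(1 + v.1 ^ 2) ^ 2 = 1 + v.1 ^ 2 := Real.sq_sqrt (by positivity)
  have hm0 : √(1 + v.1 ^ 2) ≠ 0 := (Real.sqrt_pos.2 (by positivity)).ne'
  have hn0 : √(1 + v.1 ^ 2 + v.2 ^ 2) ≠ 0 := (Real.sqrt_pos.2 (by positivity)).ne'
  have e0 : rotate (tilt A v) (K t) (Fin.castSucc 0) = _ := rotate_tilt A v (K t) 0
  have e1 : rotate (tilt A v) (K t) (Fin.castSucc 1) = _ := rotate_tilt A v (K t) 1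
  simp only [shadow, tiltPlane, oblique, stereoCurve, stereo, rotate_tilt_three, e0, e1]
  simp only [tiltMatrix]
  simp
  constructor
  · field_simp
    ring
  · field_simp
    rw [hm]
    ring

theorem hasDerivAt_oblique {A : Rotation} {K : Knot} (hK : ∀ t, rotate A (K t) 3 ≠ 1) (v : ℝ × ℝ)
    (t : ℝ) : HasDerivAt (oblique A v K)
      (deriv (stereoCurve A K 0) t - v.1 * deriv (stereoCurve A K 2) t,
        deriv (stereoCurve A K 1) t - v.2 * deriv (stereoCurve A K 2) t) t := by
  have h : ∀ i, HasDerivAt (stereoCurve A K i) (deriv (stereoCurve A K i) t) t := fun i =>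
    ((contDiff_stereoCurve hK i).differentiable (by simp) t).hasDerivAt
  exact ((h 0).sub ((h 2).const_mul v.1)).prodMk ((h 1).sub ((h 2).const_mul v.2))

theorem deriv_shadow_tilt {A : Rotation} {K : Knot} (hK : ∀ t, rotate A (K t) 3 ≠ 1) (v : ℝ × ℝ)
    (t : ℝ) : deriv (shadow (tilt A v) K) t =
      tiltPlane v.1 v.2 (deriv (oblique A v K) t) := by
  have h := hasDerivAt_oblique hK v t
  have h1 : HasDerivAt (fun t => (oblique A v K t).1) (deriv (oblique A v K) t).1 t := by
    rw [h.deriv]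
    exact hasFDerivAt_fst.comp_hasDerivAt t h
  have h2 : HasDerivAt (fun t => (oblique A v K t).2) (deriv (oblique A v K) t).2 t := by
    rw [h.deriv]
    exact hasFDerivAt_snd.comp_hasDerivAt t h
  rw [funext (shadow_tilt A v K)]
  exact ((h1.div_const _).prodMk (((h2.const_mul _).sub (h1.const_mul _)).div_const _)).deriv

/-- An immersion is locally injective. -/
theorem eventually_eq_of_hasStrictDerivAt {f : ℝ → ℝ × ℝ} {v : ℝ × ℝ} {s : ℝ}
    (hf : HasStrictDerivAt f v s) (hv : v ≠ 0) :
    ∀ᶠ p in 𝓝 (s, s), f p.1 = f p.2 → p.1 = p.2 := by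
  have hn : 0 < ‖v‖ := norm_pos_iff.2 hv
  have := (hasStrictFDerivAt_iff_isLittleO.1 hf.hasStrictFDerivAt).def (half_pos hn)
  filter_upwards [this] with p hp he
  rw [he, sub_self, zero_sub, norm_neg] at hp
  by_contra hne
  have h1 : 0 < ‖p.1 - p.2‖ := norm_pos_iff.2 (sub_ne_zero.2 hne)
  have h2 : ‖(p.1 - p.2) • v‖ ≤ ‖v‖ / 2 * ‖p.1 - p.2‖ := hp
  rw [norm_smul] at h2
  nlinarith

section Generic

variable {ι : Type} {A : Rotation} {L : ι → Knot} (hpole : ∀ i t, rotate A (L i t) 3 ≠ 1)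
  {v : ℝ × ℝ}

include hpole in
theorem height_ne_of_oblique_eq {i j : ι} {s t : ℝ} (hne : L i s ≠ L j t)
    (h : oblique A v (L i) s = oblique A v (L j) t) :
    stereoCurve A (L i) 2 s ≠ stereoCurve A (L j) 2 t := by
  intro h2
  have h0 := congrArg Prod.fst h
  have h1 := congrArg Prod.snd h
  simp only [oblique, h2, sub_left_inj] at h0 h1
  refine hne (stereo_injective (hpole i s) (hpole j t) fun k => ?_)
  fin_cases k
  exacts [h0, h1, h2]

theorem sub_eq_of_oblique_eq {J K : Knot} {s t : ℝ} (h : oblique A v J s = oblique A v K t) :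
    stereoCurve A J 0 s - stereoCurve A K 0 t =
      v.1 * (stereoCurve A J 2 s - stereoCurve A K 2 t) ∧
    stereoCurve A J 1 s - stereoCurve A K 1 t =
      v.2 * (stereoCurve A J 2 s - stereoCurve A K 2 t) := by
  have h0 := congrArg Prod.fst h
  have h1 := congrArg Prod.snd h
  simp only [oblique] at h0 h1
  constructor <;> linarith

/-- Different parameters in a period belong to different points of a link. -/
theorem apply_ne_of_ne (hdis : ∀ i j, i ≠ j → (L i).Disjoint (L j)) {x y : ι × ℝ}
    (hx : x.2 ∈ Ico (0 : ℝ) 1) (hy : y.2 ∈ Ico (0 : ℝ) 1) (hxy : x ≠ y) :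
    L x.1 x.2 ≠ L y.1 y.2 := by
  obtain ⟨i, s⟩ := x
  obtain ⟨j, t⟩ := y
  by_cases hij : i = j
  · subst hij
    intro h
    obtain ⟨n, hn⟩ := (L i).injective _ _ h
    simp only at hx hy hn
    have h1 : n < 1 := by exact_mod_cast (by linarith [hx.2, hy.1] : (n : ℝ) < 1)
    have h2 : -1 < n := by exact_mod_cast (by linarith [hx.1, hy.2] : (-1 : ℝ) < n)
    have h3 : n = 0 := by omega
    rw [h3, Int.cast_zero, sub_eq_zero] at hn
    exact hxy (by rw [hn])
  · exact hdis i j hij s t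

include hpole in
-- Infinitely many double points would accumulate in the closed square. At an accumulation point
-- representing one point of the link this contradicts local injectivity of an immersion, at a
-- genuine crossing it contradicts transversality, and elsewhere continuity.
theorem finite_oblique_eq {i j : ι} (hdis : i ≠ j → (L i).Disjoint (L j))
    (himm : ∀ t, deriv (oblique A v (L i)) t ≠ 0)
    (htr : ∀ s t, L i s ≠ L j t → oblique A v (L i) s = oblique A v (L j) t →
      planeDet (deriv (oblique A v (L i)) s) (deriv (oblique A v (L j)) t) ≠ 0) :
    {p : ℝ × ℝ | p ∈ Ico (0 : ℝ) 1 ×ˢ Ico (0 : ℝ) 1 ∧ L i p.1 ≠ L j p.2 ∧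
      oblique A v (L i) p.1 = oblique A v (L j) p.2}.Finite := by
  by_contra hinf
  obtain ⟨⟨s, t⟩, -, hacc⟩ := Set.Infinite.exists_accPt_of_subset_isCompact hinf
    ((isCompact_Icc (a := (0 : ℝ)) (b := 1)).prod (isCompact_Icc (a := (0 : ℝ)) (b := 1)))
    fun p hp => Set.prod_mono Ico_subset_Icc_self Ico_subset_Icc_self hp.1
  rw [accPt_iff_frequently_nhdsNE] at hacc
  refine hacc ?_
  have hd : ∀ k t, HasDerivAt (oblique A v (L k)) (deriv (oblique A v (L k)) t) t := fun k t =>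
    (hasDerivAt_oblique (hpole k) v t).differentiableAt.hasDerivAt
  by_cases hst : L i s = L j t
  · have hij : i = j := by
      by_contra hij
      exact hdis hij s t hst
    subst hij
    obtain ⟨n, hn⟩ := (L i).injective _ _ hst
    -- The shift covers limits such as (0, 1), where both parameters describe the same point at
    -- opposite ends of the period.
    have hs : s = t + n := by linarith
    have hper : ∀ u, L i (u + n) = L i u := fun u => by
      simpa using (L i).periodic.int_mul n u
    have hsm : ContDiff ℝ 1 (oblique A v (L i)) := by
      have h : ∀ k, ContDiff ℝ 1 (stereoCurve A (L i) k) := fun k =>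
        (contDiff_stereoCurve (hpole i) k).of_le (by exact_mod_cast le_top)
      exact ((h 0).sub (contDiff_const.mul (h 2))).prodMk
        ((h 1).sub (contDiff_const.mul (h 2)))
    have hloc := eventually_eq_of_hasStrictDerivAt
      (hsm.contDiffAt.hasStrictDerivAt (x := s) one_ne_zero) (himm s)
    have hc : Continuous fun p : ℝ × ℝ => (p.1, p.2 + n) := by fun_prop
    have ht := hc.tendsto (s, t)
    simp only [← hs] at ht
    filter_upwards [nhdsWithin_le_nhds (ht.eventually hloc)] with p hp
    rintro ⟨-, hne, he⟩
    have e : oblique A v (L i) (p.2 + n) = oblique A v (L i) p.2 := by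
      simp only [oblique, stereoCurve, hper]
    have := hp (he.trans e.symm)
    apply hne
    rw [this]
    exact hper p.2
  · by_cases he : oblique A v (L i) s = oblique A v (L j) t
    · filter_upwards [eventually_ne_of_planeDet_ne_zero (hd i s) (hd j t) (htr s t hst he)]
        with p hp hpS
      exact hp hpS.2.2
    · have c : ∀ k, Continuous (oblique A v (L k)) := fun k =>
        continuous_iff_continuousAt.2 fun t => (hd k t).continuousAt
      have c1 : Continuous fun p : ℝ × ℝ => oblique A v (L i) p.1 := (c i).comp continuous_fst
      have c2 : Continuous fun p : ℝ × ℝ => oblique A v (L j) p.2 := (c j).comp continuous_snd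
      filter_upwards [nhdsWithin_le_nhds ((isOpen_ne_fun c1 c2).mem_nhds he)] with p hp hpS
      exact hp hpS.2.2

end Generic

/-- Every link has a diagram. -/
theorem exists_isDiagram {ι : Type} [Finite ι] {L : ι → Knot}
    (hdis : ∀ i j, i ≠ j → (L i).Disjoint (L j)) : ∃ A, IsDiagram A L := by
  obtain ⟨A, hpole⟩ := exists_rotation_misses_pole L
  have h1 : ∀ i k, ContDiff ℝ 1 (stereoCurve A (L i) k) := fun i k =>
    (contDiff_stereoCurve (hpole i) k).of_le (by exact_mod_cast le_top)
  have h2 : ∀ i k, ContDiff ℝ 2 (stereoCurve A (L i) k) := fun i k =>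
    contDiff_infty.1 (contDiff_stereoCurve (hpole i) k) 2
  -- There are finitely many components, so all the generic conditions hold together for almost
  -- every direction. Repeated indices are included to cover self-crossings.
  obtain ⟨v, ⟨g1, g2⟩, g3⟩ := (((ae_all_iff.2 fun i => ae_immersive (h2 i 0) (h2 i 1) (h2 i 2)
    (stereoCurve_immersive (hpole i))).and (ae_all_iff.2 fun i => ae_all_iff.2 fun j =>
    ae_transversal (h1 i 0) (h1 i 1) (h1 i 2) (h1 j 0) (h1 j 1) (h1 j 2))).and
    (ae_all_iff.2 fun i => ae_all_iff.2 fun j => ae_all_iff.2 fun k =>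
    ae_no_triple (h1 i 0) (h1 i 1) (h1 i 2) (h1 j 0) (h1 j 1) (h1 j 2) (h1 k 0) (h1 k 1)
      (h1 k 2))).exists
  have hd : ∀ i t, deriv (oblique A v (L i)) t = _ := fun i t =>
    (hasDerivAt_oblique (hpole i) v t).deriv
  have himm : ∀ i t, deriv (oblique A v (L i)) t ≠ 0 := fun i t h => by
    rw [hd] at h
    exact g1 i t ⟨congrArg Prod.fst h, congrArg Prod.snd h⟩
  have htr : ∀ i j s t, L i s ≠ L j t → oblique A v (L i) s = oblique A v (L j) t →
      planeDet (deriv (oblique A v (L i)) s) (deriv (oblique A v (L j)) t) ≠ 0 :=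
    fun i j s t hne h => by
      rw [hd, hd]
      exact g2 i j s t (height_ne_of_oblique_eq hpole hne h) (sub_eq_of_oblique_eq h).1
        (sub_eq_of_oblique_eq h).2
  have hobl : ∀ q ∈ doublePoints (tilt A v) L, L q.1.1 q.1.2 ≠ L q.2.1 q.2.2 ∧
      oblique A v (L q.1.1) q.1.2 = oblique A v (L q.2.1) q.2.2 := fun q hq => by
    refine ⟨apply_ne_of_ne hdis hq.1 hq.2.1 hq.2.2.1, tiltPlane_injective v.1 v.2 ?_⟩
    rw [← shadow_tilt, ← shadow_tilt]
    exact hq.2.2.2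
  have hzero : tiltPlane v.1 v.2 0 = 0 := by simp [tiltPlane]
  refine ⟨tilt A v, ⟨fun i t => ?_, fun i t h => ?_, ?_, fun q hq => ?_, fun x y z hy hz => ?_⟩⟩
  · rw [rotate_tilt_three]
    exact hpole i t
  · rw [deriv_shadow_tilt (hpole i), ← hzero] at h
    exact himm i t (tiltPlane_injective _ _ h)
  · refine (finite_iUnion fun i => finite_iUnion fun j =>
      (finite_oblique_eq hpole (hdis i j) (himm i) (htr i j)).image
        fun p : ℝ × ℝ => ((i, p.1), (j, p.2))).subset fun q hq => ?_
    exact mem_iUnion.2 ⟨q.1.1, mem_iUnion.2 ⟨q.2.1, (q.1.2, q.2.2), ⟨⟨hq.1, hq.2.1⟩, hobl q hq⟩, rfl⟩⟩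
  · rw [deriv_shadow_tilt (hpole _), deriv_shadow_tilt (hpole _), planeDet_tiltPlane]
    exact div_ne_zero (htr _ _ _ _ (hobl q hq).1 (hobl q hq).2)
      (Real.sqrt_pos.2 (by positivity)).ne'
  · by_contra hyz
    obtain ⟨y1, y2⟩ := hobl _ hy
    obtain ⟨z1, z2⟩ := hobl _ hz
    have hne := apply_ne_of_ne hdis hy.2.1 hz.2.1 hyz
    exact g3 _ _ _ _ _ _ (height_ne_of_oblique_eq hpole y1 y2)
      (height_ne_of_oblique_eq hpole z1 z2) (height_ne_of_oblique_eq hpole hne (y2.symm.trans z2))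
      (sub_eq_of_oblique_eq y2).1 (sub_eq_of_oblique_eq y2).2 (sub_eq_of_oblique_eq z2).1
      (sub_eq_of_oblique_eq z2).2

theorem Knot.Disjoint.exists_isDiagram {J K : Knot} (h : J.Disjoint K) :
    ∃ A, IsDiagram A ![J, K] := by
  refine KnotTheory.exists_isDiagram fun i j hij => ?_
  fin_cases i <;> fin_cases j
  exacts [absurd rfl hij, h, h.symm, absurd rfl hij]

theorem Knot.Disjoint.hasLinkNumber {J K : Knot} (h : J.Disjoint K) :
    HasLinkNumber J.curve K.curve (lk J K) := hasLinkNumber_lk h h.exists_isDiagram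

end

end KnotTheory

end

/-! ### Assembly of the theorem. -/

open KnotTheory
theorem mainTheorem12 :
    -- the linking number is well defined: diagrams exist, and all of them compute it
    (∀ K₁ K₂ : Knot, K₁.Disjoint K₂ →
      (∃ A, IsDiagram A ![K₁, K₂]) ∧
      ∀ A, IsDiagram A ![K₁, K₂] → crossingSum A K₁ K₂ = 2 * lk K₁ K₂) ∧
    -- additivity under connected sum, the disc being disjoint from the third knot
    (∀ (K₁ K₂ K₃ K : Knot) (D : ℝ × ℝ → S3),
      K₁.Disjoint K₂ → K₁.Disjoint K₃ → K₂.Disjoint K₃ →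
      IsConnectedSumAlong D K₁ K₂ K →
      (∀ q ∈ unitSquare, D q ∉ Set.range K₃) →
      lk K K₃ = lk K₁ K₃ + lk K₂ K₃) ∧
    -- reversal of the orientation of one component
    (∀ K₁ K₂ : Knot, K₁.Disjoint K₂ →
      lk K₁ K₂.reverse = - lk K₁ K₂ ∧ lk K₁.reverse K₂ = - lk K₁ K₂) ∧
    -- invariance under a crossing change
    (∀ K₁ K₂ K₃ : Knot, K₁.Disjoint K₃ → K₂.Disjoint K₃ →
      IsCrossingChange K₁ K₂ K₃ → lk K₁ K₃ = lk K₂ K₃) := by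
  refine ⟨fun J K h => ⟨h.exists_isDiagram, fun A hA =>
    hA.isTransversal.crossingSum_eq_two_mul h h.hasLinkNumber⟩,
    fun K₁ K₂ K₃ K D _ h₁ h₂ h hD => ?_, fun J K h => ⟨?_, ?_⟩, fun K₁ K₂ K₃ h₁ h₂ h =>
    h.linkNumber_eq h₁ h₂ h₁.hasLinkNumber h₂.hasLinkNumber⟩
  · exact (h.disjoint h₁ h₂ hD).hasLinkNumber.unique
      (h.hasLinkNumber h₁ h₂ hD h₁.hasLinkNumber h₂.hasLinkNumber)
  · exact h.symm.reverse_left.symm.hasLinkNumber.unique (h.hasLinkNumber.reverse_right h)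
  · exact h.reverse_left.hasLinkNumber.unique h.hasLinkNumber.reverse_left
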